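/- Let $n\ge 1$ be an integer. Every metric space $Z$ is equipped with its $n$-dimensional Hausdorff measure $\mathcal H^n$, normalized to agree with Lebesgue measure on $\mathbb R^n$. A metric space $Z$ is a metric measure space if it is proper (closed bounded sets are compact) and $0<\mathcal H^n(B)<\infty$ for every ball $B\subset Z$ of positive radius; it is $n$-rectifiable if there are countably many Borel sets $E_i\subset\mathbb R^n$ and Lipschitz maps $g_i:E_i\to Z$ with $\mathcal H^n\big(Z\setminus\bigcup_i g_i(E_i)\big)=0$. Curves in $Z$ are continuous maps $\gamma:[0,1]\to Z$. For a Borel function $\rho:Z\to[0,\infty]$, let $\int_\gamma\rho$ be the integral of $\rho$ along the arc length parametrization of $\gamma$ if $\gamma$ has finite length, and $\infty$ otherwise. The $n$-modulus of a family $\Gamma$ of curves is $$\operatorname{Mod}_n(\Gamma)=\inf\Big\{\int_Z\rho^n\,d\mathcal H^n:\ \rho:Z\to[0,\infty]\text{ Borel},\ \int_\gamma\rho\ge 1\text{ for all }\gamma\in\Gamma\Big\}.$$ A Borel function $g:Z\to[0,\infty]$ is an upper gradient of $u:Z\to\mathbb R$ if $|u(\gamma(1))-u(\gamma(0))|\le\int_\gamma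 g$ for every curve $\gamma$, and an $n$-weak upper gradient if this holds for every curve outside some family of $n$-modulus zero. We write $u\in N^{1,n}(Z)$ if $u\in L^n(Z)$ and $u$ has an upper gradient in $L^n(Z)$; the minimal $n$-weak upper gradient $g_u$ of such a $u$ is the (almost everywhere unique) $n$-weak upper gradient in $L^n(Z)$ which is almost everywhere at most any other $n$-weak upper gradient in $L^n(Z)$. The space $Z$ has the $n$-Sobolev-to-Lipschitz property if every $u\in N^{1,n}(Z)$ with $g_u\le 1$ almost everywhere agrees almost everywhere with a $1$-Lipschitz function. A homeomorphism $h:Z\to W$ is quasiconformal (with index $n$) if there is $K<\infty$ such that $\operatorname{Mod}_n(\Gamma)\le K\operatorname{Mod}_n(h(\Gamma))$ for every family $\Gamma$ of curves in $Z$, where $h(\Gamma)=\{h\circ\gamma:\gamma\in\Gamma\}$. **Proposition.** Let $X$ and $Y$ be $n$-rectifiable metric measure spaces and let $f:X\to Y$ be a $1$-Lipschitz homeomorphism which is volume preserving, i.e. $f_*\mathcal H^n_X=\mathcal H^n_Y$. If $f^{-1}:Y\to X$ is quasiconformal and $Y$ has the $n$-Sobolev-to-Lipschitz property, then $f$ is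 an isometry. -/

import Mathlib

open MeasureTheory Set
open scoped ENNReal NNReal unitInterval

/-- A metric measure space: a proper metric space whose measure is positive and finite on every
ball of positive radius. -/
structure IsMetricMeasureSpace (X : Type*) [MetricSpace X] [MeasurableSpace X]
    (μ : Measure X) : Prop where
  proper : ProperSpace X
  ball_pos : ∀ (x : X) (r : ℝ), 0 < r → 0 < μ (Metric.ball x r)
  ball_lt_top : ∀ (x : X) (r : ℝ), 0 < r → μ (Metric.ball x r) < ∞

/-- `X` is `n`-rectifiable: up to an `n`-dimensional Hausdorff null set, it is covered by countably
many Lipschitz images of Borel subsets of `ℝⁿ`. (`μHE[n]` is the `n`-dimensional Hausdorff measure,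
normalized so as to agree with Lebesgue measure on `ℝⁿ`.) -/
def IsRectifiableSpace (n : ℕ) (X : Type*) [MetricSpace X] [MeasurableSpace X]
    [BorelSpace X] : Prop :=
  ∃ (E : ℕ → Set (EuclideanSpace ℝ (Fin n))) (g : (i : ℕ) → E i → X) (L : ℕ → ℝ≥0),
    (∀ i, MeasurableSet (E i)) ∧ (∀ i, LipschitzWith (L i) (g i)) ∧
      (μHE[n] : Measure X) (⋃ i, range (g i))ᶜ = 0

/-- The length of a curve. -/
noncomputable def curveLength {X : Type*} [MetricSpace X] (γ : C(I, X)) : ℝ≥0∞ :=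
  eVariationOn γ univ

open Classical in
/-- The line integral of `g` over `γ`: the integral over `[0, ℓ(γ)]` of `g` along the arc length
parametrization of `γ` if `γ` is rectifiable, and `∞` otherwise. -/
noncomputable def lineIntegral {X : Type*} [MetricSpace X] (g : X → ℝ≥0∞) (γ : C(I, X)) : ℝ≥0∞ :=
  if curveLength γ = ∞ then ∞
  else ∫⁻ t in Icc (0 : ℝ) (curveLength γ).toReal, g (naturalParameterization γ univ 0 t)

/-- The `p`-modulus of a family `Γ` of curves. -/
noncomputable def curveModulus {X : Type*} [MetricSpace X] [MeasurableSpace X] (p : ℝ)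
    (μ : Measure X) (Γ : Set C(I, X)) : ℝ≥0∞ :=
  ⨅ (ρ : X → ℝ≥0∞) (_ : Measurable ρ ∧ ∀ γ ∈ Γ, 1 ≤ lineIntegral ρ γ), ∫⁻ x, ρ x ^ p ∂μ

/-- The Borel function `g : X → [0, ∞]` is an upper gradient of `u`. -/
def IsUpperGradient {X : Type*} [MetricSpace X] [MeasurableSpace X] (u : X → ℝ)
    (g : X → ℝ≥0∞) : Prop :=
  Measurable g ∧ ∀ γ : C(I, X), edist (u (γ 1)) (u (γ 0)) ≤ lineIntegral g γ

/-- The Borel function `g : X → [0, ∞]` is a `p`-weak upper gradient of `u`: the upper gradient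
inequality holds for all curves outside a family of `p`-modulus zero. -/
def IsWeakUpperGradient {X : Type*} [MetricSpace X] [MeasurableSpace X] (p : ℝ) (μ : Measure X)
    (u : X → ℝ) (g : X → ℝ≥0∞) : Prop :=
  Measurable g ∧ ∃ Γ₀ : Set C(I, X), curveModulus p μ Γ₀ = 0 ∧
    ∀ γ : C(I, X), γ ∉ Γ₀ → edist (u (γ 1)) (u (γ 0)) ≤ lineIntegral g γ

/-- `u` is `p`-Newtonian, i.e. it represents an element of the Newtonian Sobolev space
`N^{1,p}(X)`: it is `p`-integrable and has a `p`-integrable upper gradient. -/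
def IsNewtonian {X : Type*} [MetricSpace X] [MeasurableSpace X] (p : ℝ) (μ : Measure X)
    (u : X → ℝ) : Prop :=
  MemLp u (ENNReal.ofReal p) μ ∧
    ∃ g : X → ℝ≥0∞, IsUpperGradient u g ∧ ∫⁻ x, g x ^ p ∂μ < ∞

/-- `g` is a (hence, up to null sets, the) minimal `p`-weak upper gradient of `u`: a `p`-integrable
`p`-weak upper gradient that is almost everywhere bounded by every other one. -/
def IsMinimalWeakUpperGradient {X : Type*} [MetricSpace X] [MeasurableSpace X] (p : ℝ)
    (μ : Measure X) (u : X → ℝ) (g : X → ℝ≥0∞) : Prop :=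
  IsWeakUpperGradient p μ u g ∧ ∫⁻ x, g x ^ p ∂μ < ∞ ∧
    ∀ h : X → ℝ≥0∞, IsWeakUpperGradient p μ u h → ∫⁻ x, h x ^ p ∂μ < ∞ → ∀ᵐ x ∂μ, g x ≤ h x

/-- The `p`-Sobolev-to-Lipschitz property: every `p`-Newtonian function whose minimal `p`-weak upper
gradient is at most `1` almost everywhere has a `1`-Lipschitz representative. -/
def HasSobolevToLipschitz {X : Type*} [MetricSpace X] [MeasurableSpace X] (p : ℝ)
    (μ : Measure X) : Prop :=
  ∀ u : X → ℝ, IsNewtonian p μ u →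
    ∀ g : X → ℝ≥0∞, IsMinimalWeakUpperGradient p μ u g → (∀ᵐ x ∂μ, g x ≤ 1) →
      ∃ v : X → ℝ, LipschitzWith 1 v ∧ ∀ᵐ x ∂μ, u x = v x

/-- The homeomorphism `u : (X, μ) → (Y, ν)` is (geometrically) quasiconformal with index `Q`:
for some finite constant `K`, one has `Mod_Q Γ ≤ K * Mod_Q u(Γ)` for every family `Γ` of curves
in `X`. -/
def IsQuasiconformal {X Y : Type*} [MetricSpace X] [MeasurableSpace X] [MetricSpace Y]
    [MeasurableSpace Y] (Q : ℝ) (μ : Measure X) (ν : Measure Y) (u : X ≃ₜ Y) : Prop :=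
  ∃ K : ℝ≥0, ∀ Γ : Set C(I, X),
    curveModulus Q μ Γ ≤ K * curveModulus Q ν ((fun γ => (u : C(X, Y)).comp γ) '' Γ)

/-! Since `f` is already `1`-Lipschitz, only the reverse inequality is needed. It is obtained by
testing the Sobolev-to-Lipschitz property on the cut-off distances `u = max 0 (R - d(f⁻¹ ·, x₀))`.
The point is that `u` has a weak upper gradient bounded by `1`, that is, that `f⁻¹` does not
lengthen almost every curve of `Y`.

Volume preservation is an infinitesimal rigidity statement. In a Lipschitz chart `g` of `X`, the
metric derivatives of `g` and `f ∘ g` are suprema of derivatives of real functions: the distances to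
a dense sequence of `X` together with the distances of `f` to a dense sequence of `Y`, respectively
the latter alone. The metric derivative of `f ∘ g` is thus at most that of `g`. If it were strictly
smaller somewhere on a set of positive measure, its unit balls would be strictly larger there, and
`f` would lose volume. This uses an upper bound for the measure of an image by Vitali coverings
(`hausdorffMeasure_image_le_of_supDeriv`) and a lower bound by the isodiametric inequality for norms
(`volume_le_mul_hausdorffMeasure_image`), which rests on Prékopa-Leindler. The comparison is
`hausdorffMeasure_image_setOf_not_supDeriv_le`.

Hence there is a null set `N` in `X` such that `f` does not shorten curves spending zero time in `N`
(`exists_null_forall_edist_le_eVariationOn`): almost every derivative along such a curve is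
controlled by the speed of its image. Curves in `X` of positive length in `N` have modulus zero
because `∞ · 1_N` has zero energy, and quasiconformality of `f⁻¹` carries this to `Y`. So the
indicator of the image of a ball is a weak upper gradient of `u`
(`isWeakUpperGradient_max_sub_dist_symm`). A minimal one exists by
`exists_isMinimalWeakUpperGradient`, and as `u` is continuous and the measure has full support, `u`
itself is `1`-Lipschitz. Its values at `f x` and `f x₀` give the claim. -/

/-! ### Brunn-Minkowski, Prékopa-Leindler and the isodiametric inequality -/

/-- The translates `K + min L` and `max K + L` both lie in `K + L ⊆ 2C` and share at most the point
`max K + min L`. -/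
theorem volume_add_le_of_isCompact_of_midpoint_mem {K L C : Set ℝ} (hK : IsCompact K)
    (hL : IsCompact L) (hK0 : K.Nonempty) (hL0 : L.Nonempty)
    (h : ∀ a ∈ K, ∀ b ∈ L, (a + b) / 2 ∈ C) : volume K + volume L ≤ 2 * volume C := by
  obtain ⟨M, hM, hMmax⟩ := hK.exists_isGreatest hK0
  obtain ⟨m, hm, hmmin⟩ := hL.exists_isLeast hL0
  set S : Set ℝ := (fun x => x * (1 / 2 : ℝ)) ⁻¹' C
  have hS : volume S = 2 * volume C := by
    rw [Real.volume_preimage_mul_right (by norm_num)]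
    norm_num
  rw [← hS]
  set K' : Set ℝ := (fun x => x + (-m)) ⁻¹' K
  set L' : Set ℝ := (fun x => x + (-M)) ⁻¹' L
  have hK' : volume K' = volume K := measure_preimage_add_right _ _ _
  have hL' : volume L' = volume L := measure_preimage_add_right _ _ _
  have hL'm : MeasurableSet L' := (measurable_id.add_const _) hL.measurableSet
  have hd : AEDisjoint volume K' L' := by
    refine measure_mono_null (t := {M + m}) ?_ (by simp)
    intro x hx
    have h1 : x + -m ≤ M := hMmax hx.1
    have h2 : m ≤ x + -M := hmmin hx.2
    simp only [mem_singleton_iff]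
    linarith
  rw [← hK', ← hL', ← measure_union₀ hL'm.nullMeasurableSet hd]
  refine measure_mono (union_subset ?_ ?_)
  · intro x hx
    have := h _ hx _ hm
    simp only [S, mem_preimage]
    convert this using 1
    ring
  · intro x hx
    have := h _ hM _ hx
    simp only [S, mem_preimage]
    convert this using 1
    ring

/-- The one-dimensional Brunn-Minkowski inequality. -/
theorem volume_add_le_of_midpoint_mem {A B C : Set ℝ} (hA : MeasurableSet A)
    (hB : MeasurableSet B) (hA0 : A.Nonempty) (hB0 : B.Nonempty)
    (h : ∀ a ∈ A, ∀ b ∈ B, (a + b) / 2 ∈ C) : volume A + volume B ≤ 2 * volume C := by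
  obtain ⟨a, ha⟩ := hA0
  obtain ⟨b, hb⟩ := hB0
  have key : ∀ K ⊆ A, IsCompact K → ∀ L ⊆ B, IsCompact L →
      volume K + volume L ≤ 2 * volume C := by
    intro K hKA hK L hLB hL
    -- Adjoining `a` and `b` makes the compact sets nonempty without leaving `A` and `B`.
    refine le_trans (add_le_add (measure_mono (subset_insert a K))
      (measure_mono (subset_insert b L))) ?_
    refine volume_add_le_of_isCompact_of_midpoint_mem (hK.insert a) (hL.insert b)
      (insert_nonempty _ _) (insert_nonempty _ _) fun x hx y hy => h x ?_ y ?_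
    · exact insert_subset ha hKA hx
    · exact insert_subset hb hLB hy
  refine le_of_forall_lt fun r hr => ?_
  rw [hA.measure_eq_iSup_isCompact, hB.measure_eq_iSup_isCompact] at hr
  refine lt_of_lt_of_le hr ?_
  have hne : Nonempty {K : Set ℝ // K ⊆ A ∧ IsCompact K} := ⟨⟨∅, empty_subset _, isCompact_empty⟩⟩
  have hne' : Nonempty {K : Set ℝ // K ⊆ B ∧ IsCompact K} := ⟨⟨∅, empty_subset _, isCompact_empty⟩⟩
  have e1 : (⨆ K, ⨆ (_ : K ⊆ A), ⨆ (_ : IsCompact K), volume K)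
      = ⨆ K : {K : Set ℝ // K ⊆ A ∧ IsCompact K}, volume K.1 := by
    rw [iSup_subtype]; simp only [iSup_and]
  have e2 : (⨆ K, ⨆ (_ : K ⊆ B), ⨆ (_ : IsCompact K), volume K)
      = ⨆ K : {K : Set ℝ // K ⊆ B ∧ IsCompact K}, volume K.1 := by
    rw [iSup_subtype]; simp only [iSup_and]
  rw [e1, e2]
  refine ENNReal.iSup_add_iSup_le fun K L => key _ K.2.1 K.2.2 _ L.2.1 L.2.2

theorem ENNReal.mul_le_sq_of_add_le {A B H : ℝ≥0∞} (h : A + B ≤ 2 * H) : A * B ≤ H ^ 2 := by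
  rcases eq_or_ne H ∞ with rfl | hH
  · simp
  have h2 : 2 * H ≠ ∞ := ENNReal.mul_ne_top (by simp) hH
  have hA : A ≠ ∞ := ne_top_of_le_ne_top h2 (le_trans le_self_add h)
  have hB : B ≠ ∞ := ne_top_of_le_ne_top h2 (le_trans le_add_self h)
  lift A to ℝ≥0 using hA
  lift B to ℝ≥0 using hB
  lift H to ℝ≥0 using hH
  norm_cast at h ⊢
  have h' : (A : ℝ) + B ≤ 2 * H := by exact_mod_cast h
  have : (A : ℝ) * B ≤ H ^ 2 := by
    nlinarith [sq_nonneg ((A : ℝ) - B), A.2, B.2, H.2]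
  exact_mod_cast this

/-- Layer cake: since `f` and `g` both have supremum `1`, their superlevel sets are nonempty for
exactly the same `t < 1`, and one-dimensional Brunn-Minkowski applies level by level. For `t ≥ 1`
they are empty. -/
theorem lintegral_add_le_of_midpoint {f g h : ℝ → ℝ} (hf : Measurable f) (hg : Measurable g)
    (hh : Measurable h) (hf0 : 0 ≤ f) (hg0 : 0 ≤ g) (hh0 : 0 ≤ h) (hf1 : ∀ x, f x ≤ 1)
    (hg1 : ∀ x, g x ≤ 1) (hfs : ∀ t < 1, ∃ x, t < f x) (hgs : ∀ t < 1, ∃ x, t < g x)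
    (H : ∀ x y, f x * g y ≤ h ((x + y) / 2) ^ 2) :
    (∫⁻ x, ENNReal.ofReal (f x)) + ∫⁻ x, ENNReal.ofReal (g x)
      ≤ 2 * ∫⁻ x, ENNReal.ofReal (h x) := by
  have cake : ∀ f : ℝ → ℝ, Measurable f → 0 ≤ f →
      ∫⁻ x, ENNReal.ofReal (f x) = ∫⁻ t in Ioi 0, volume {a | t < f a} := fun f hf hf0 =>
    lintegral_eq_lintegral_meas_lt _ (Filter.Eventually.of_forall hf0) hf.aemeasurable
  have anti : ∀ f : ℝ → ℝ, Antitone fun t => volume {a | t < f a} := fun f s t hst =>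
    measure_mono fun a (ha : t < f a) => lt_of_le_of_lt hst ha
  rw [cake f hf hf0, cake g hg hg0, cake h hh hh0, ← lintegral_add_left (anti f).measurable,
    ← lintegral_const_mul _ (anti h).measurable]
  refine setLIntegral_mono' measurableSet_Ioi fun t ht => ?_
  rcases lt_or_ge t 1 with h1 | h1
  · refine volume_add_le_of_midpoint_mem (measurableSet_lt measurable_const hf)
      (measurableSet_lt measurable_const hg) (hfs t h1) (hgs t h1) ?_
    intro a (ha : t < f a) b (hb : t < g b)
    have ht' : 0 < t := ht
    have h2 := H a b
    have h3 : t * t < f a * g b := mul_lt_mul'' ha hb ht'.le ht'.le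
    change t < h _
    have h4 : 0 ≤ h ((a + b) / 2) := hh0 _
    nlinarith
  · have e : ∀ f : ℝ → ℝ, (∀ x, f x ≤ 1) → {a | t < f a} = ∅ := by
      intro f hf
      ext x
      simp only [mem_ofPred_eq, mem_empty_iff_false, iff_false, not_lt]
      exact (hf x).trans h1
    rw [e f hf1, e g hg1]
    simp

/-- Dividing `f` and `g` by their suprema `a`, `b` and `h` by `√(ab)` reduces to the additive
inequality, and the arithmetic-geometric mean inequality turns the sum into a product. Truncating
the normalized `h` at `1` is harmless because the other two functions are at most `1`. -/
theorem prekopa_leindler_real_of_bounded {f g h : ℝ → ℝ≥0∞} (hf : Measurable f)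
    (hg : Measurable g) (hh : Measurable h) {M : ℝ≥0∞} (hM : M ≠ ∞) (hfM : ∀ x, f x ≤ M)
    (hgM : ∀ x, g x ≤ M) (H : ∀ x y, f x * g y ≤ h ((x + y) / 2) ^ 2) :
    (∫⁻ x, f x) * ∫⁻ x, g x ≤ (∫⁻ x, h x) ^ 2 := by
  set a := ⨆ x, f x
  set b := ⨆ x, g x
  have ha : a ≠ ∞ := ne_top_of_le_ne_top hM (iSup_le hfM)
  have hb : b ≠ ∞ := ne_top_of_le_ne_top hM (iSup_le hgM)
  rcases eq_or_ne a 0 with ha0 | ha0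
  · have : ∀ x, f x = 0 := fun x => le_antisymm ((le_iSup f x).trans ha0.le) bot_le
    simp [this]
  rcases eq_or_ne b 0 with hb0 | hb0
  · have : ∀ x, g x = 0 := fun x => le_antisymm ((le_iSup g x).trans hb0.le) bot_le
    simp [this]
  set c : ℝ≥0∞ := (a * b) ^ (1 / 2 : ℝ)
  have hc2 : c ^ 2 = a * b := by
    rw [← ENNReal.rpow_natCast, ← ENNReal.rpow_mul]; norm_num
  have hc : c ≠ ∞ := by
    intro hc; rw [hc] at hc2
    exact ENNReal.mul_ne_top ha hb (by rw [← hc2]; simp)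
  have hc0 : c ≠ 0 := by
    intro hc; rw [hc] at hc2
    exact mul_ne_zero ha0 hb0 (by rw [← hc2]; simp)
  have main : ∀ (f : ℝ → ℝ≥0∞) (a : ℝ≥0∞), a = ⨆ x, f x → a ≠ ∞ → a ≠ 0 →
      (∀ x, (f x / a) ≤ 1) ∧ (∀ t < 1, ∃ x, t < (f x / a).toReal) := by
    intro f a ha hat ha0
    have h1 : ∀ x, (f x / a) ≤ 1 := fun x => by
      refine ENNReal.div_le_of_le_mul ?_
      rw [one_mul, ha]; exact le_iSup f x
    refine ⟨h1, fun t ht => ?_⟩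
    rcases lt_or_ge t 0 with h0 | h0
    · exact ⟨0, h0.trans_le ENNReal.toReal_nonneg⟩
    have : ENNReal.ofReal t * a < ⨆ x, f x := by
      rw [← ha]
      calc ENNReal.ofReal t * a < 1 * a := by
            refine ENNReal.mul_lt_mul_left ha0 hat ?_
            rw [← ENNReal.ofReal_one]
            exact (ENNReal.ofReal_lt_ofReal_iff one_pos).2 ht
        _ = a := one_mul a
    obtain ⟨x, hx⟩ := lt_iSup_iff.1 this
    refine ⟨x, ?_⟩
    rw [← ENNReal.ofReal_lt_iff_lt_toReal h0 (ne_top_of_le_ne_top ENNReal.one_ne_top (h1 x))]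
    exact (ENNReal.lt_div_iff_mul_lt (Or.inl ha0) (Or.inl hat)).2 hx
  obtain ⟨f1, fs⟩ := main f a rfl ha ha0
  obtain ⟨g1, gs⟩ := main g b rfl hb hb0
  have ftop : ∀ x, f x / a ≠ ∞ := fun x => ne_top_of_le_ne_top ENNReal.one_ne_top (f1 x)
  have gtop : ∀ x, g x / b ≠ ∞ := fun x => ne_top_of_le_ne_top ENNReal.one_ne_top (g1 x)
  have htop : ∀ x, min (h x / c) 1 ≠ ∞ := fun x =>
    ne_top_of_le_ne_top ENNReal.one_ne_top (min_le_right _ _)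
  have key := lintegral_add_le_of_midpoint (f := fun x => (f x / a).toReal)
    (g := fun x => (g x / b).toReal) (h := fun x => (min (h x / c) 1).toReal)
    (hf.div_const a).ennreal_toReal (hg.div_const b).ennreal_toReal
    ((hh.div_const c).min measurable_const).ennreal_toReal
    (fun x => ENNReal.toReal_nonneg) (fun x => ENNReal.toReal_nonneg)
    (fun x => ENNReal.toReal_nonneg)
    (fun x => ENNReal.toReal_le_of_le_ofReal zero_le_one (by simpa using f1 x))
    (fun x => ENNReal.toReal_le_of_le_ofReal zero_le_one (by simpa using g1 x)) fs gs ?_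
  · simp only [ENNReal.ofReal_toReal (ftop _), ENNReal.ofReal_toReal (gtop _),
      ENNReal.ofReal_toReal (htop _)] at key
    have key2 : (∫⁻ x, f x / a) + ∫⁻ x, g x / b ≤ 2 * ∫⁻ x, h x / c :=
      key.trans (mul_le_mul_right (lintegral_mono fun x => min_le_left _ _) 2)
    simp only [div_eq_mul_inv] at key2
    rw [lintegral_mul_const _ hf, lintegral_mul_const _ hg, lintegral_mul_const _ hh] at key2
    have key3 := ENNReal.mul_le_sq_of_add_le key2
    have e1 : (∫⁻ x, f x) * ∫⁻ x, g x
        = a * b * (((∫⁻ x, f x) * a⁻¹) * ((∫⁻ x, g x) * b⁻¹)) := by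
      calc (∫⁻ x, f x) * ∫⁻ x, g x
          = (a * a⁻¹) * (b * b⁻¹) * ((∫⁻ x, f x) * ∫⁻ x, g x) := by
            rw [ENNReal.mul_inv_cancel ha0 ha, ENNReal.mul_inv_cancel hb0 hb]; simp
        _ = _ := by ring
    have e2 : (∫⁻ x, h x) ^ 2 = a * b * ((∫⁻ x, h x) * c⁻¹) ^ 2 := by
      rw [← hc2]
      calc (∫⁻ x, h x) ^ 2 = (c * c⁻¹) ^ 2 * (∫⁻ x, h x) ^ 2 := by
            rw [ENNReal.mul_inv_cancel hc0 hc]; simp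
        _ = _ := by ring
    rw [e1, e2]
    gcongr
  · intro x y
    rw [← ENNReal.toReal_mul, ← ENNReal.toReal_pow]
    refine ENNReal.toReal_mono (ENNReal.pow_ne_top (htop _)) ?_
    have h1 : f x / a * (g y / b) ≤ (h ((x + y) / 2) / c) ^ 2 := by
      simp only [div_eq_mul_inv]
      rw [mul_pow, ← ENNReal.inv_pow, hc2, ENNReal.mul_inv (Or.inl ha0) (Or.inl ha)]
      calc f x * a⁻¹ * (g y * b⁻¹) = f x * g y * (a⁻¹ * b⁻¹) := by ring
        _ ≤ _ := by gcongr; exact H x y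
    rcases le_total (h ((x + y) / 2) / c) 1 with h2 | h2
    · rwa [min_eq_left h2]
    · rw [min_eq_right h2]
      simpa using mul_le_mul' (f1 x) (g1 y)

/-- The one-dimensional Prékopa-Leindler inequality (for midpoints). -/
theorem prekopa_leindler_real {f g h : ℝ → ℝ≥0∞} (hf : Measurable f) (hg : Measurable g)
    (hh : Measurable h) (H : ∀ x y, f x * g y ≤ h ((x + y) / 2) ^ 2) :
    (∫⁻ x, f x) * ∫⁻ x, g x ≤ (∫⁻ x, h x) ^ 2 := by
  have key : ∀ f : ℝ → ℝ≥0∞, Measurable f →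
      ∫⁻ x, f x = ⨆ n : ℕ, ∫⁻ x, min (f x) n := by
    intro f hf
    rw [← lintegral_iSup (fun n => hf.min measurable_const)]
    · congr 1
      ext x
      refine le_antisymm ?_ (iSup_le fun n => min_le_left _ _)
      rcases eq_or_ne (f x) ∞ with h | h
      · simp [h, ENNReal.iSup_natCast]
      · obtain ⟨n, hn⟩ := ENNReal.exists_nat_gt h
        exact le_iSup_of_le n (by rw [min_eq_left hn.le])
    · intro m n hmn x
      exact min_le_min_left _ (by exact_mod_cast hmn)
  rw [key f hf, key g hg, ENNReal.iSup_mul]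
  refine iSup_le fun m => ?_
  rw [ENNReal.mul_iSup]
  refine iSup_le fun n => ?_
  refine prekopa_leindler_real_of_bounded (hf.min measurable_const) (hg.min measurable_const) hh
    (M := max m n) (by simp) (fun x => (min_le_right _ _).trans (le_max_left _ _))
    (fun x => (min_le_right _ _).trans (le_max_right _ _)) fun x y => ?_
  exact (mul_le_mul' (min_le_left _ _) (min_le_left _ _)).trans (H x y)

/-- The Prékopa-Leindler inequality (for midpoints). -/
theorem prekopa_leindler_pi {n : ℕ} {f g h : (Fin n → ℝ) → ℝ≥0∞} (hf : Measurable f)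
    (hg : Measurable g) (hh : Measurable h)
    (H : ∀ x y, f x * g y ≤ h ((2⁻¹ : ℝ) • (x + y)) ^ 2) :
    (∫⁻ x, f x) * ∫⁻ x, g x ≤ (∫⁻ x, h x) ^ 2 := by
  induction n with
  | zero =>
    rw [Measure.volume_pi_eq_dirac default]
    simp only [lintegral_dirac]
    convert H default default using 3
  | succ n ih =>
    set e := (MeasurableEquiv.piFinSuccAbove (fun _ : Fin (n + 1) => ℝ) 0).symm with he
    have hmp : MeasurePreserving e volume volume :=
      (volume_preserving_piFinSuccAbove (fun _ : Fin (n + 1) => ℝ) 0).symm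
    have hadd : ∀ (s t : ℝ) (x y : Fin n → ℝ),
        e ((s + t) / 2, (2⁻¹ : ℝ) • (x + y)) = (2⁻¹ : ℝ) • (e (s, x) + e (t, y)) := by
      intro s t x y
      ext i
      refine Fin.cases ?_ (fun j => ?_) i
      · simp [he, MeasurableEquiv.piFinSuccAbove, Fin.insertNthEquiv]; ring
      · simp [he, MeasurableEquiv.piFinSuccAbove, Fin.insertNthEquiv, mul_add]
    have split : ∀ f : (Fin (n + 1) → ℝ) → ℝ≥0∞, Measurable f →
        ∫⁻ x, f x = ∫⁻ s : ℝ, ∫⁻ x : Fin n → ℝ, f (e (s, x)) := by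
      intro f hf
      rw [← hmp.lintegral_comp hf, Measure.volume_eq_prod,
        lintegral_prod (fun z => f (e z)) (hf.comp e.measurable).aemeasurable]
    have hm : ∀ f : (Fin (n + 1) → ℝ) → ℝ≥0∞, Measurable f →
        Measurable fun s : ℝ => ∫⁻ x : Fin n → ℝ, f (e (s, x)) := fun f hf =>
      (hf.comp e.measurable).lintegral_prod_right'
    have hs : ∀ f : (Fin (n + 1) → ℝ) → ℝ≥0∞, Measurable f → ∀ s : ℝ,
        Measurable fun x : Fin n → ℝ => f (e (s, x)) := fun f hf s =>
      (hf.comp e.measurable).comp measurable_prodMk_left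
    rw [split f hf, split g hg, split h hh]
    -- The marginals in the first coordinate satisfy the one-dimensional hypothesis by the induction
    -- hypothesis for the slices at `s`, `t` and their midpoint.
    refine prekopa_leindler_real (hm f hf) (hm g hg) (hm h hh) fun s t => ?_
    refine ih (hs f hf s) (hs g hg t) (hs h hh _) fun x y => ?_
    rw [hadd]
    exact H _ _

/-- Prékopa-Leindler for the indicators of `A`, `-A` and `C` gives `|A|² ≤ |C|²`. -/
theorem volume_le_volume_half_sub {n : ℕ} {A C : Set (EuclideanSpace ℝ (Fin n))}
    (hA : MeasurableSet A) (hC : MeasurableSet C)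
    (h : ∀ a ∈ A, ∀ b ∈ A, (2⁻¹ : ℝ) • (a - b) ∈ C) : volume A ≤ volume C := by
  set T : (Fin n → ℝ) → EuclideanSpace ℝ (Fin n) := WithLp.toLp 2 with hT
  have hmp : MeasurePreserving T volume volume := PiLp.volume_preserving_toLp (Fin n)
  have key := prekopa_leindler_pi (n := n) (f := (T ⁻¹' A).indicator 1)
    (g := (Neg.neg ⁻¹' (T ⁻¹' A)).indicator 1) (h := (T ⁻¹' C).indicator 1)
    (measurable_one.indicator (hmp.measurable hA))
    (measurable_one.indicator (measurable_neg (hmp.measurable hA)))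
    (measurable_one.indicator (hmp.measurable hC)) ?_
  · rw [lintegral_indicator_one (hmp.measurable hA),
      lintegral_indicator_one (measurable_neg (hmp.measurable hA)),
      lintegral_indicator_one (hmp.measurable hC), Measure.measure_preimage_neg,
      hmp.measure_preimage hA.nullMeasurableSet, hmp.measure_preimage hC.nullMeasurableSet,
      ← pow_two] at key
    by_contra! hlt
    exact absurd key (not_le.2 (ENNReal.pow_lt_pow_left two_ne_zero hlt))
  · intro x y
    by_cases hx : T x ∈ A
    · by_cases hy : T (-y) ∈ A
      · have : T ((2⁻¹ : ℝ) • (x + y)) ∈ C := by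
          convert h _ hx _ hy using 1
          simp [hT]
        rw [indicator_of_mem (show (2⁻¹ : ℝ) • (x + y) ∈ T ⁻¹' C from this)]
        simp only [Pi.one_apply, one_pow]
        exact mul_le_one' (indicator_le_self _ _ _) (indicator_le_self _ _ _)
      · rw [indicator_of_notMem (show y ∉ Neg.neg ⁻¹' (T ⁻¹' A) from hy)]
        simp
    · rw [indicator_of_notMem (show x ∉ T ⁻¹' A from hx)]
      simp

open scoped Pointwise in
/-- The isodiametric inequality for a norm `N` on `ℝⁿ`. -/
theorem volume_le_of_seminorm_sub_le {n : ℕ} (N : Seminorm ℝ (EuclideanSpace ℝ (Fin n)))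
    (hN : Continuous N) {c : ℝ} (hc : 0 < c) (hcN : ∀ v, c * ‖v‖ ≤ N v)
    {V : Set (EuclideanSpace ℝ (Fin n))} {d : ℝ} (hd : 0 ≤ d)
    (hV : ∀ u ∈ V, ∀ v ∈ V, N (u - v) ≤ d) :
    volume V ≤ ENNReal.ofReal d ^ n * volume {v | N v ≤ 1 / 2} := by
  have hcl : ∀ u ∈ closure V, ∀ v ∈ closure V, N (u - v) ≤ d := by
    intro u hu v hv
    have hc : IsClosed {p : EuclideanSpace ℝ (Fin n) × EuclideanSpace ℝ (Fin n) |
      N (p.1 - p.2) ≤ d} := isClosed_le (by fun_prop) continuous_const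
    have : closure (V ×ˢ V) ⊆ _ := closure_minimal (fun p hp => hV _ hp.1 _ hp.2) hc
    rw [closure_prod_eq] at this
    exact this (mk_mem_prod hu hv)
  have hK : MeasurableSet {v | N v ≤ d / 2} := (isClosed_le hN continuous_const).measurableSet
  -- The half-differences of points of the closure lie in the centred `N`-ball of radius `d / 2`.
  have h1 : volume V ≤ volume {v | N v ≤ d / 2} := by
    refine (measure_mono subset_closure).trans
      (volume_le_volume_half_sub isClosed_closure.measurableSet hK fun a ha b hb => ?_)
    have := hcl a ha b hb
    simp only [mem_ofPred_eq, map_smul_eq_mul, Real.norm_eq_abs]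
    rw [abs_of_pos (by norm_num)]
    linarith
  refine h1.trans ?_
  rcases hd.eq_or_lt with rfl | hd
  · have : {v | N v ≤ 0 / 2} ⊆ {0} := by
      intro v hv
      simp only [mem_ofPred_eq, zero_div] at hv
      have := hcN v
      have h2 : c * ‖v‖ ≤ 0 := this.trans hv
      have : ‖v‖ ≤ 0 := by
        by_contra! h
        exact absurd h2 (not_le.2 (mul_pos hc h))
      simpa using this
    -- In dimension zero the factor `d ^ n` equals `1` even for `d = 0`.
    rcases Nat.eq_zero_or_pos n with rfl | hn
    · simp only [pow_zero, one_mul]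
      exact measure_mono fun v hv => (this hv) ▸ by simp
    · have hne : Nonempty (Fin n) := ⟨⟨0, hn⟩⟩
      rw [measure_mono_null this (by simp)]
      exact zero_le
  · have : {v | N v ≤ d / 2} = d • {v | N v ≤ 1 / 2} := by
      ext v
      rw [mem_smul_set_iff_inv_smul_mem₀ hd.ne']
      simp only [mem_ofPred_eq, map_smul_eq_mul, Real.norm_eq_abs, abs_inv, abs_of_pos hd]
      rw [inv_mul_le_iff₀ hd]
      constructor <;> intro h <;> linarith
    rw [this, Measure.addHaar_smul]
    simp [ENNReal.ofReal_pow hd.le, abs_of_pos hd]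

/-! ### The metric derivative as a supremum of derivatives -/

section SupDeriv

variable {ι E : Type*} [NormedAddCommGroup E] [NormedSpace ℝ E] {L : ℝ≥0} {Φ : ι → E → ℝ}

theorem LipschitzWith.abs_fderiv_apply_le {φ : E → ℝ} (hφ : LipschitzWith L φ) (x v : E) :
    |fderiv ℝ φ x v| ≤ L * ‖v‖ :=
  ((fderiv ℝ φ x).le_opNorm v).trans
    (mul_le_mul_of_nonneg_right (norm_fderiv_le_of_lipschitz ℝ hφ) (norm_nonneg v))

theorem bddAbove_range_abs_fderiv (hΦ : ∀ k, LipschitzWith L (Φ k)) (x v : E) :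
    BddAbove (range fun k => |fderiv ℝ (Φ k) x v|) :=
  ⟨L * ‖v‖, by rintro _ ⟨k, rfl⟩; exact (hΦ k).abs_fderiv_apply_le x v⟩

/-- The seminorm `v ↦ sup_k |D Φ_k(x) v|` given by the derivatives at `x` of a family of uniformly
Lipschitz functions; it is the metric derivative at `x` of the map `(Φ_k)_k` into `ℓ^∞`. -/
noncomputable def supDeriv (hΦ : ∀ k, LipschitzWith L (Φ k)) (x : E) : Seminorm ℝ E :=
  Seminorm.of (fun v => ⨆ k, |fderiv ℝ (Φ k) x v|)
    (fun v w => Real.iSup_le (fun k => by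
        rw [map_add]
        exact (abs_add_le _ _).trans (add_le_add (le_ciSup (bddAbove_range_abs_fderiv hΦ x v) k)
          (le_ciSup (bddAbove_range_abs_fderiv hΦ x w) k)))
      (add_nonneg (Real.iSup_nonneg fun _ => abs_nonneg _)
        (Real.iSup_nonneg fun _ => abs_nonneg _)))
    (fun a v => by
      simp only [map_smul, smul_eq_mul, abs_mul, Real.norm_eq_abs]
      exact (Real.mul_iSup_of_nonneg (abs_nonneg a) _).symm)

theorem supDeriv_apply (hΦ : ∀ k, LipschitzWith L (Φ k)) (x v : E) :
    supDeriv hΦ x v = ⨆ k, |fderiv ℝ (Φ k) x v| := rfl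

theorem abs_fderiv_le_supDeriv (hΦ : ∀ k, LipschitzWith L (Φ k)) (x v : E) (k : ι) :
    |fderiv ℝ (Φ k) x v| ≤ supDeriv hΦ x v :=
  le_ciSup (bddAbove_range_abs_fderiv hΦ x v) k

theorem supDeriv_le (hΦ : ∀ k, LipschitzWith L (Φ k)) {x v : E} {a : ℝ} (ha : 0 ≤ a)
    (h : ∀ k, |fderiv ℝ (Φ k) x v| ≤ a) : supDeriv hΦ x v ≤ a :=
  Real.iSup_le h ha

theorem exists_lt_abs_fderiv (hΦ : ∀ k, LipschitzWith L (Φ k)) {x v : E} {a : ℝ} (ha : 0 ≤ a)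
    (h : a < supDeriv hΦ x v) : ∃ k, a < |fderiv ℝ (Φ k) x v| := by
  by_contra! hk
  exact absurd h (not_lt.2 (supDeriv_le hΦ ha hk))

theorem supDeriv_le_mul_norm (hΦ : ∀ k, LipschitzWith L (Φ k)) (x v : E) :
    supDeriv hΦ x v ≤ L * ‖v‖ :=
  supDeriv_le hΦ (by positivity) fun k => (hΦ k).abs_fderiv_apply_le x v

theorem supDeriv_le_add (hΦ : ∀ k, LipschitzWith L (Φ k)) (x v w : E) :
    supDeriv hΦ x v ≤ supDeriv hΦ x w + L * ‖v - w‖ := by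
  calc supDeriv hΦ x v = supDeriv hΦ x (w + (v - w)) := by congr 1; abel
    _ ≤ _ := (map_add_le_add _ _ _).trans (by gcongr; exact supDeriv_le_mul_norm hΦ x _)

theorem continuous_supDeriv (hΦ : ∀ k, LipschitzWith L (Φ k)) (x : E) :
    Continuous (supDeriv hΦ x) := by
  refine (LipschitzWith.of_le_add_mul L fun v w => ?_).continuous
  rw [dist_eq_norm]
  exact supDeriv_le_add hΦ x v w

variable [MeasurableSpace E] [BorelSpace E]

theorem measurable_supDeriv [Countable ι] (hΦ : ∀ k, LipschitzWith L (Φ k))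
    (v : E) : Measurable fun x => supDeriv hΦ x v := by
  simp only [supDeriv_apply]
  exact Measurable.iSup fun k => (measurable_fderiv_apply_const ℝ (Φ k) v).abs

theorem locallyIntegrable_supDeriv [Countable ι] (μ : Measure E) [IsLocallyFiniteMeasure μ]
    (hΦ : ∀ k, LipschitzWith L (Φ k)) (v : E) :
    LocallyIntegrable (fun x => supDeriv hΦ x v) μ := by
  refine (locallyIntegrable_const (L * ‖v‖)).mono
    (measurable_supDeriv hΦ v).aestronglyMeasurable (Filter.Eventually.of_forall fun x => ?_)
  rw [Real.norm_of_nonneg (apply_nonneg _ _), Real.norm_of_nonneg (by positivity)]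
  exact supDeriv_le_mul_norm hΦ x v

omit [NormedSpace ℝ E] in
theorem setIntegral_closedBall_add (μ : Measure E) [μ.IsAddHaarMeasure] (f : E → ℝ) (p : E)
    (s : ℝ) : ∫ b in Metric.closedBall (0 : E) s, f (p + b) ∂μ
      = ∫ q in Metric.closedBall p s, f q ∂μ := by
  have h := (measurePreserving_add_left μ p).setIntegral_preimage_emb
    (measurableEmbedding_addLeft p) f (Metric.closedBall p s)
  rw [← h]
  simp

variable [FiniteDimensional ℝ E]

/-- If the averages over balls of radius `s` of the directional derivatives of a Lipschitz function
are bounded along a segment, then so is, up to an error `2 L s`, its increment. -/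
theorem LipschitzWith.abs_sub_le_of_setIntegral_fderiv_le (μ : Measure E) [μ.IsAddHaarMeasure]
    {φ : E → ℝ} (hφ : LipschitzWith L φ) (y v : E) {s M : ℝ} (hs : 0 < s)
    (hM : ∀ t ∈ Icc (0 : ℝ) 1, ∫ q in Metric.closedBall (y + t • v) s, |fderiv ℝ φ q v| ∂μ
      ≤ M * μ.real (Metric.closedBall 0 s)) :
    |φ (y + v) - φ y| ≤ M + 2 * L * s := by
  set B : Set E := Metric.closedBall 0 s with hB
  set m := μ.real B with hm
  have hBfin : μ B < ∞ := measure_closedBall_lt_top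
  have hm0 : 0 < m := ENNReal.toReal_pos (Metric.measure_closedBall_pos μ 0 hs).ne' hBfin.ne
  have hint : ∀ t : ℝ, IntegrableOn (fun b => φ (y + t • v + b)) B μ := fun t =>
    ContinuousOn.integrableOn_compact (isCompact_closedBall 0 s)
      (hφ.continuous.comp (by fun_prop)).continuousOn
  -- `φ` need not be differentiable on the segment itself, so it is integrated over a ball moving
  -- along the segment. The result is differentiable, with derivative controlled by `hM`, and
  -- differs from `m * φ` by at most `L * s * m`.
  set G : ℝ → ℝ := fun t => ∫ b in B, φ (y + t • v + b) ∂μ with hG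
  have hder : ∀ t : ℝ, HasDerivAt G (∫ b in B, fderiv ℝ φ (y + t • v + b) v ∂μ) t := by
    intro t
    refine (hasDerivAt_integral_of_dominated_loc_of_lip (bound := fun _ => L * ‖v‖)
      (F := fun t b => φ (y + t • v + b)) Filter.univ_mem
      (Filter.Eventually.of_forall fun t => (hint t).aestronglyMeasurable) (hint t) ?_ ?_ ?_ ?_).2
    · exact (((measurable_fderiv_apply_const ℝ φ v).comp
        (measurable_const_add (y + t • v)))).aestronglyMeasurable
    · refine Filter.Eventually.of_forall fun b => LipschitzWith.lipschitzOnWith ?_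
      refine LipschitzWith.of_dist_le_mul fun t₁ t₂ => ?_
      refine (hφ.dist_le_mul _ _).trans (le_of_eq ?_)
      rw [dist_eq_norm, dist_eq_norm, Real.coe_nnabs, abs_of_nonneg (by positivity),
        show y + t₁ • v + b - (y + t₂ • v + b) = (t₁ - t₂) • v by rw [sub_smul]; abel, norm_smul]
      ring
    · exact integrableOn_const hBfin.ne
    · have h1 : ∀ᵐ q ∂μ, DifferentiableAt ℝ φ q := hφ.ae_differentiableAt
      have h2 : ∀ᵐ b ∂μ, DifferentiableAt ℝ φ (y + t • v + b) :=
        (measurePreserving_add_left μ (y + t • v)).quasiMeasurePreserving.ae h1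
      filter_upwards [ae_restrict_of_ae h2] with b hb
      have h3 : HasDerivAt (fun t : ℝ => y + t • v + b) v t := by
        have := (((hasDerivAt_id t).smul_const v).const_add y).add_const b
        simpa using this
      exact hb.hasFDerivAt.comp_hasDerivAt t h3
  have h1 : |G 1 - G 0| ≤ M * m := by
    have := Convex.norm_image_sub_le_of_norm_hasDerivWithin_le (f := G) (C := M * m)
      (s := Icc (0 : ℝ) 1) (fun t _ => (hder t).hasDerivWithinAt) (fun t ht => ?_)
      (convex_Icc 0 1) (left_mem_Icc.2 zero_le_one) (right_mem_Icc.2 zero_le_one)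
    · simpa using this
    · refine le_trans (norm_integral_le_integral_norm _) ?_
      refine le_trans (le_of_eq ?_) (hM t ht)
      exact setIntegral_closedBall_add μ (fun q => |fderiv ℝ φ q v|) _ _
  have h2 : ∀ t : ℝ, |G t - m * φ (y + t • v)| ≤ L * s * m := by
    intro t
    have : G t - m * φ (y + t • v) = ∫ b in B, (φ (y + t • v + b) - φ (y + t • v)) ∂μ := by
      rw [integral_sub (hint t) (integrableOn_const hBfin.ne), setIntegral_const, smul_eq_mul]
    rw [this]
    refine norm_setIntegral_le_of_norm_le_const
      (f := fun b : E => φ (y + t • v + b) - φ (y + t • v)) hBfin fun b hb => ?_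
    refine (hφ.dist_le_mul (y + t • v + b) (y + t • v)).trans ?_
    have hb' : ‖b‖ ≤ s := by simpa [hB] using hb
    rw [dist_eq_norm, add_sub_cancel_left]
    gcongr
  have h3 := h2 1
  have h4 := h2 0
  rw [one_smul] at h3
  rw [zero_smul, add_zero] at h4
  have : m * |φ (y + v) - φ y| ≤ m * (M + 2 * L * s) := by
    rw [← abs_of_pos hm0, ← abs_mul, abs_of_pos hm0]
    rw [abs_le] at h1 h3 h4 ⊢
    constructor <;> nlinarith
  exact le_of_mul_le_mul_left this hm0

/-- Almost everywhere, `supDeriv` controls increments at small scales, uniformly in the family. -/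
theorem ae_abs_sub_le_supDeriv_add [Countable ι] (μ : Measure E) [μ.IsAddHaarMeasure]
    (hΦ : ∀ k, LipschitzWith L (Φ k)) :
    ∀ᵐ x ∂μ, ∀ ε > 0, ∃ δ > 0, ∀ r, 0 < r → r < δ → ∀ y ∈ Metric.closedBall x r,
      ∀ z ∈ Metric.closedBall x r, ∀ k, |Φ k z - Φ k y| ≤ supDeriv hΦ x (z - y) + ε * r := by
  -- Lebesgue differentiation in a dense sequence of directions, along balls that need not be
  -- centred at `x` but have `x` within `K` times their radius.
  have hae : ∀ᵐ x ∂μ, ∀ (j K : ℕ), ∀ {α : Type _} {l : Filter α} (w : α → E) (δ : α → ℝ)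
      (_ : Filter.Tendsto δ l (nhdsWithin 0 (Ioi 0)))
      (_ : ∀ᶠ a in l, x ∈ Metric.closedBall (w a) (K * δ a)),
      Filter.Tendsto (fun a => ⨍ q in Metric.closedBall (w a) (δ a),
        supDeriv hΦ q (TopologicalSpace.denseSeq E j) ∂μ) l
        (nhds (supDeriv hΦ x (TopologicalSpace.denseSeq E j))) := by
    rw [ae_all_iff]; intro j
    rw [ae_all_iff]; intro K
    exact IsUnifLocDoublingMeasure.ae_tendsto_average μ
      (locallyIntegrable_supDeriv μ hΦ (TopologicalSpace.denseSeq E j)) K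
  filter_upwards [hae] with x hx ε hε
  -- At scale `r`, averaging over balls of radius `η * r` will cost `η * r * (1 + 4 * L)` in total.
  -- The same `N = 1 / η` bounds the eccentricity of these balls.
  obtain ⟨N, hN⟩ := exists_nat_gt ((1 + 4 * L) / ε)
  have hN0 : (0 : ℝ) < N := lt_of_le_of_lt (by positivity) hN
  set η : ℝ := 1 / N with hη
  have hη0 : 0 < η := by positivity
  have hηε : η * (1 + 4 * L) ≤ ε := by
    rw [hη, one_div, inv_mul_le_iff₀ hN0]
    rw [div_lt_iff₀ hε] at hN
    linarith
  -- a finite net of directions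
  obtain ⟨F, hF⟩ : ∃ F : Finset ℕ, Metric.closedBall (0 : E) 2 ⊆
      ⋃ j ∈ F, Metric.ball (TopologicalSpace.denseSeq E j) η := by
    refine (isCompact_closedBall (0 : E) 2).elim_finite_subcover _ (fun _ => Metric.isOpen_ball) ?_
    intro v _
    obtain ⟨j, hj⟩ := (TopologicalSpace.denseRange_denseSeq E).exists_dist_lt v hη0
    exact mem_iUnion.2 ⟨j, hj⟩
  -- Pairs of a centre `p` and a scale `r → 0` with `|p - x| ≤ r`. Convergence along this filter is
  -- uniform in the centre, which is needed along whole segments.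
  set l : Filter (E × ℝ) := Filter.comap Prod.snd (nhdsWithin 0 (Ioi 0)) ⊓
    Filter.principal {a | a.1 ∈ Metric.closedBall x a.2} with hl
  have hsnd : Filter.Tendsto (Prod.snd : E × ℝ → ℝ) l (nhdsWithin 0 (Ioi 0)) :=
    Filter.tendsto_comap.mono_left inf_le_left
  have hlim : Filter.Tendsto (fun a : E × ℝ => η * a.2) l (nhdsWithin 0 (Ioi 0)) := by
    rw [tendsto_nhdsWithin_iff] at hsnd ⊢
    refine ⟨by simpa using hsnd.1.const_mul η, ?_⟩
    filter_upwards [hsnd.2] with a ha using mul_pos hη0 ha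
  have hmem : ∀ᶠ a : E × ℝ in l, x ∈ Metric.closedBall a.1 (N * (η * a.2)) := by
    have : ∀ᶠ a : E × ℝ in l, a.1 ∈ Metric.closedBall x a.2 :=
      Filter.mem_inf_of_right (Filter.mem_principal_self _)
    filter_upwards [this] with a ha
    rw [hη, ← mul_assoc, mul_one_div_cancel hN0.ne', one_mul]
    exact Metric.mem_closedBall_comm.1 ha
  have hev : ∀ᶠ a : E × ℝ in l, ∀ j ∈ F,
      ⨍ q in Metric.closedBall a.1 (η * a.2), supDeriv hΦ q (TopologicalSpace.denseSeq E j) ∂μ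
        < supDeriv hΦ x (TopologicalSpace.denseSeq E j) + η := by
    rw [Filter.eventually_all_finset]
    intro j _
    exact (hx j N (fun a : E × ℝ => a.1) _ hlim hmem).eventually
      (gt_mem_nhds (lt_add_of_pos_right _ hη0))
  rw [hl, Filter.eventually_inf_principal, Filter.eventually_comap] at hev
  obtain ⟨δ, hδ, hδ'⟩ := mem_nhdsGT_iff_exists_Ioo_subset.1 hev
  refine ⟨δ, hδ, fun r hr hrδ y hy z hz k => ?_⟩
  have hev' : ∀ p ∈ Metric.closedBall x r, ∀ j ∈ F,
      ⨍ q in Metric.closedBall p (η * r), supDeriv hΦ q (TopologicalSpace.denseSeq E j) ∂μ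
        < supDeriv hΦ x (TopologicalSpace.denseSeq E j) + η := fun p hp =>
    hδ' ⟨hr, hrδ⟩ (p, r) rfl hp
  set w : E := r⁻¹ • (z - y) with hw
  have hrw : z - y = r • w := by rw [hw, smul_inv_smul₀ hr.ne']
  have hw2 : w ∈ Metric.closedBall (0 : E) 2 := by
    rw [mem_closedBall_zero_iff, hw, norm_smul, norm_inv, Real.norm_of_nonneg hr.le,
      inv_mul_le_iff₀ hr, ← dist_eq_norm]
    have h1 := Metric.mem_closedBall.1 hy
    have h2 := Metric.mem_closedBall.1 hz
    have := dist_triangle_right z y x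
    linarith
  clear_value w
  obtain ⟨j, hjF, hj⟩ := mem_iUnion₂.1 (hF hw2)
  set v := TopologicalSpace.denseSeq E j with hv
  rw [Metric.mem_ball, dist_eq_norm] at hj
  have hball : 0 < η * r := mul_pos hη0 hr
  have hvol : 0 < μ.real (Metric.closedBall (0 : E) (η * r)) :=
    ENNReal.toReal_pos (Metric.measure_closedBall_pos μ 0 hball).ne' measure_closedBall_lt_top.ne
  have key := (hΦ k).abs_sub_le_of_setIntegral_fderiv_le μ y (z - y) (s := η * r)
    (M := r * (supDeriv hΦ x w + η + 2 * L * η)) hball ?_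
  · rw [add_sub_cancel] at key
    refine key.trans ?_
    rw [hrw, map_smul_eq_mul, Real.norm_of_nonneg hr.le]
    have := mul_le_mul_of_nonneg_right hηε hr.le
    nlinarith
  · intro t ht
    have hp : y + t • (z - y) ∈ Metric.closedBall x r :=
      (convex_closedBall x r).add_smul_sub_mem hy hz ht
    have h1 := hev' _ hp j hjF
    set p := y + t • (z - y)
    have hvolp : μ.real (Metric.closedBall p (η * r)) =
        μ.real (Metric.closedBall (0 : E) (η * r)) := by
      simp only [measureReal_def, Measure.addHaar_closedBall_center μ p]
    rw [setAverage_eq, hvolp, smul_eq_mul, inv_mul_lt_iff₀ hvol] at h1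
    have hint : IntegrableOn (fun q => supDeriv hΦ q v) (Metric.closedBall p (η * r)) μ :=
      (locallyIntegrable_supDeriv μ hΦ v).integrableOn_isCompact (isCompact_closedBall _ _)
    have hint2 : IntegrableOn (fun q => r * (supDeriv hΦ q v + L * η))
        (Metric.closedBall p (η * r)) μ :=
      (hint.add (integrableOn_const measure_closedBall_lt_top.ne)).const_mul r
    calc ∫ q in Metric.closedBall p (η * r), |fderiv ℝ (Φ k) q (z - y)| ∂μ
        ≤ ∫ q in Metric.closedBall p (η * r), r * (supDeriv hΦ q v + L * η) ∂μ := by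
          refine integral_mono_of_nonneg (Filter.Eventually.of_forall fun q => abs_nonneg _) hint2
            (Filter.Eventually.of_forall fun q => ?_)
          refine (abs_fderiv_le_supDeriv hΦ q _ k).trans ?_
          rw [hrw, map_smul_eq_mul, Real.norm_of_nonneg hr.le]
          refine mul_le_mul_of_nonneg_left ?_ hr.le
          exact (supDeriv_le_add hΦ q w v).trans (by gcongr)
      _ = r * (∫ q in Metric.closedBall p (η * r), supDeriv hΦ q v ∂μ)
          + r * (L * η) * μ.real (Metric.closedBall (0 : E) (η * r)) := by
          rw [integral_const_mul, integral_add hint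
            (integrableOn_const measure_closedBall_lt_top.ne), setIntegral_const, hvolp,
            smul_eq_mul]
          ring
      _ ≤ r * (μ.real (Metric.closedBall (0 : E) (η * r)) * (supDeriv hΦ x v + η))
          + r * (L * η) * μ.real (Metric.closedBall (0 : E) (η * r)) := by gcongr
      _ ≤ _ := by
          have h2 : supDeriv hΦ x v ≤ supDeriv hΦ x w + L * η := by
            refine (supDeriv_le_add hΦ x v w).trans ?_
            rw [norm_sub_rev]
            gcongr
          have h3 := mul_le_mul_of_nonneg_left h2 (mul_pos hr hvol).le
          nlinarith

end SupDeriv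

/-! ### Upper bound for the Hausdorff measure of a Lipschitz image -/

theorem hausdorffMeasure_image_eq_zero {E X : Type*} [NormedAddCommGroup E] [NormedSpace ℝ E]
    [FiniteDimensional ℝ E] [MeasurableSpace E] [BorelSpace E] [MetricSpace X]
    [MeasurableSpace X] [BorelSpace X] (μ : Measure E) [μ.IsAddHaarMeasure] {A : Set E}
    {g : E → X} {C : ℝ≥0} (hg : LipschitzOnWith C g A) (hA : μ A = 0) :
    μH[(Module.finrank ℝ E : ℝ)] (g '' A) = 0 := by
  have h0 : (μH[(Module.finrank ℝ E : ℝ)] : Measure E) A = 0 := by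
    rw [Measure.isAddLeftInvariant_eq_smul (μH[(Module.finrank ℝ E : ℝ)] : Measure E) μ]
    simp [hA]
  have := hg.hausdorffMeasure_image_le (d := Module.finrank ℝ E) (Nat.cast_nonneg _)
  rw [h0, mul_zero] at this
  exact le_antisymm this bot_le

open scoped Pointwise in
-- Scaling and translation invariance. The truncation by `R` keeps the sets bounded even where the
-- seminorm degenerates.
theorem measure_setOf_seminorm_sub_le {E : Type*} [NormedAddCommGroup E] [NormedSpace ℝ E]
    [FiniteDimensional ℝ E] [MeasurableSpace E] [BorelSpace E] (μ : Measure E)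
    [μ.IsAddHaarMeasure] (N : Seminorm ℝ E) (x : E) {r : ℝ} (hr : 0 < r) (R : ℝ) :
    μ {y | N (y - x) ≤ r / 2 ∧ ‖y - x‖ ≤ r * R}
      = ENNReal.ofReal r ^ Module.finrank ℝ E * μ ({v | N v ≤ 1 / 2} ∩ Metric.closedBall 0 R) := by
  have : {y | N (y - x) ≤ r / 2 ∧ ‖y - x‖ ≤ r * R}
      = (fun y => -x + y) ⁻¹' (r • ({v | N v ≤ 1 / 2} ∩ Metric.closedBall 0 R)) := by
    ext y
    rw [mem_preimage, mem_smul_set_iff_inv_smul_mem₀ hr.ne', neg_add_eq_sub]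
    simp only [mem_ofPred_eq, mem_inter_iff, mem_closedBall_zero_iff, map_smul_eq_mul, norm_smul,
      Real.norm_eq_abs, abs_inv, abs_of_pos hr, inv_mul_le_iff₀ hr]
    rw [show r * (1 / 2) = r / 2 by ring]
  rw [this, measure_preimage_add, Measure.addHaar_smul, abs_of_pos (by positivity),
    ENNReal.ofReal_pow hr.le]

/-- Upper bound for the Hausdorff measure of a Lipschitz image in terms of the volume of the unit
balls of the metric derivative. -/
theorem hausdorffMeasure_image_le_of_supDeriv {ι E X : Type*} [NormedAddCommGroup E]
    [NormedSpace ℝ E] [FiniteDimensional ℝ E] [MeasurableSpace E] [BorelSpace E] [MetricSpace X]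
    [MeasurableSpace X] [BorelSpace X] [Countable ι] (μ : Measure E) [μ.IsAddHaarMeasure]
    {L C : ℝ≥0} {Φ : ι → E → ℝ} (hΦ : ∀ k, LipschitzWith L (Φ k)) {A : Set E} {g : E → X}
    (hg : LipschitzOnWith C g A)
    (hgΦ : ∀ y ∈ A, ∀ z ∈ A, ∀ a, 0 ≤ a → (∀ k, |Φ k z - Φ k y| ≤ a) → dist (g y) (g z) ≤ a)
    {s : ℝ≥0∞} (hs0 : s ≠ 0) (hs : s ≠ ∞) {R : ℝ} (hR : 0 < R)
    (hA : ∀ x ∈ A, s ≤ μ ({v | supDeriv hΦ x v ≤ 1 / 2} ∩ Metric.closedBall 0 R)) :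
    μH[(Module.finrank ℝ E : ℝ)] (g '' A) ≤ μ A / s := by
  set n := Module.finrank ℝ E with hn
  suffices H : ∀ ε : ℝ, 0 < ε → μH[(n : ℝ)] (g '' A) ≤
      ENNReal.ofReal (1 + ε) ^ n * ((μ A + ENNReal.ofReal ε) / s) by
    have hlim : Filter.Tendsto (fun ε : ℝ => ENNReal.ofReal (1 + ε) ^ n *
        ((μ A + ENNReal.ofReal ε) / s)) (nhdsWithin 0 (Ioi 0))
        (nhds (ENNReal.ofReal (1 + 0) ^ n * ((μ A + ENNReal.ofReal 0) / s))) := by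
      refine Filter.Tendsto.mono_left ?_ nhdsWithin_le_nhds
      refine ENNReal.Tendsto.mul ?_ (Or.inl (by simp)) ?_ (Or.inr (by simp))
      · exact ((ENNReal.continuous_pow n).comp (ENNReal.continuous_ofReal.comp
          (continuous_const.add continuous_id))).tendsto 0
      · refine ENNReal.Tendsto.div_const ?_ (Or.inr hs0)
        exact (continuous_const.add ENNReal.continuous_ofReal).tendsto 0
    have := ge_of_tendsto hlim (by filter_upwards [self_mem_nhdsWithin] with ε hε using H ε hε)
    simpa using this
  intro ε hε
  obtain ⟨U, hAU, hUo, hU⟩ := exists_isOpen_le_add A μ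
    (ε := ENNReal.ofReal ε) (by simpa using hε)
  set P : E → Prop := fun x => ∀ ε > 0, ∃ δ > 0, ∀ r, 0 < r → r < δ → ∀ y ∈ Metric.closedBall x r,
      ∀ z ∈ Metric.closedBall x r, ∀ k, |Φ k z - Φ k y| ≤ supDeriv hΦ x (z - y) + ε * r with hP
  have hPae : ∀ᵐ x ∂μ, P x := ae_abs_sub_le_supDeriv_add μ hΦ
  set B : E × ℝ → Set E := fun a =>
    {y | supDeriv hΦ a.1 (y - a.1) ≤ a.2 / 2 ∧ ‖y - a.1‖ ≤ a.2 * R} with hB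
  have hBball : ∀ a, B a ⊆ Metric.closedBall a.1 (a.2 * R) := fun a y hy => by
    rw [Metric.mem_closedBall, dist_eq_norm]; exact hy.2
  have hBcl : ∀ a, IsClosed (B a) := fun a => by
    have hc1 : Continuous fun y => supDeriv hΦ a.1 (y - a.1) :=
      (continuous_supDeriv hΦ a.1).comp (by fun_prop)
    have hc2 : Continuous fun y => ‖y - a.1‖ := by fun_prop
    exact (isClosed_le hc1 continuous_const).inter (isClosed_le hc2 continuous_const)
  -- Admissible pairs of a centre and a scale: the truncated seminorm ball stays in `U`, and the
  -- image of its part in `A` has diameter at most `1 + ε` times the scale, which is itself bounded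
  -- by `1 / (m + 1)`.
  set T : ℕ → Set (E × ℝ) := fun m => {a | a.1 ∈ A ∧ 0 < a.2 ∧ B a ⊆ U ∧
    a.2 * (1 + ε) ≤ 1 / (m + 1) ∧
    ∀ y ∈ A ∩ B a, ∀ z ∈ A ∩ B a, dist (g y) (g z) ≤ a.2 * (1 + ε)} with hT
  have hμB : ∀ m, ∀ a ∈ T m, ENNReal.ofReal a.2 ^ n * s ≤ μ (B a) := by
    intro m a ha
    rw [hB, measure_setOf_seminorm_sub_le μ _ _ ha.2.1]
    gcongr
    exact hA _ ha.1
  have hvit : ∀ m, ∃ u ⊆ T m, u.Countable ∧ u.PairwiseDisjoint B ∧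
      μ ((A ∩ {x | P x}) \ ⋃ a ∈ u, B a) = 0 := by
    intro m
    -- The ratio between the measure of a Euclidean ball of three times the radius and the lower
    -- bound `r ^ n * s` for the measure of `B a`, as the Vitali covering theorem requires.
    set D : ℝ≥0∞ := ENNReal.ofReal (3 * R) ^ n * μ (Metric.ball 0 1) / s with hD
    have hDtop : D ≠ ∞ := ENNReal.div_ne_top
      (ENNReal.mul_ne_top (ENNReal.pow_ne_top ENNReal.ofReal_ne_top) measure_ball_lt_top.ne) hs0
    refine Vitali.exists_disjoint_covering_ae μ _ (T m) D.toNNReal (fun a => a.2 * R)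
      (fun a => a.1) B (fun a _ => hBball a) ?_ ?_ ?_ ?_
    · intro a ha
      have h0 : 0 < a.2 := ha.2.1
      rw [ENNReal.coe_toNNReal hDtop, Measure.addHaar_closedBall μ _ (by positivity)]
      calc ENNReal.ofReal ((3 * (a.2 * R)) ^ n) * μ (Metric.ball 0 1)
          = D * (ENNReal.ofReal a.2 ^ n * s) := by
            rw [hD, ENNReal.div_eq_inv_mul, show (3 * (a.2 * R)) = (3 * R) * a.2 by ring, mul_pow,
              ENNReal.ofReal_mul (by positivity), ENNReal.ofReal_pow (by positivity),
              ENNReal.ofReal_pow h0.le]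
            calc _ = (s⁻¹ * s) * (ENNReal.ofReal (3 * R) ^ n * ENNReal.ofReal a.2 ^ n *
                    μ (Metric.ball 0 1)) := by rw [ENNReal.inv_mul_cancel hs0 hs, one_mul]
              _ = _ := by ring
        _ ≤ D * μ (B a) := by gcongr; exact hμB m a ha
    · intro a ha
      have h0 : 0 < a.2 := ha.2.1
      refine ⟨a.1, mem_interior_iff_mem_nhds.2 ?_⟩
      have hc1 : Continuous fun y => supDeriv hΦ a.1 (y - a.1) :=
        (continuous_supDeriv hΦ a.1).comp (by fun_prop)
      have hc2 : Continuous fun y => ‖y - a.1‖ := by fun_prop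
      have h1 : ∀ᶠ y in nhds a.1, supDeriv hΦ a.1 (y - a.1) < a.2 / 2 :=
        hc1.tendsto a.1 |>.eventually (gt_mem_nhds (by simpa using h0))
      have h2 : ∀ᶠ y in nhds a.1, ‖y - a.1‖ < a.2 * R :=
        hc2.tendsto a.1 |>.eventually (gt_mem_nhds (by simpa using mul_pos h0 hR))
      filter_upwards [h1, h2] with y hy1 hy2 using ⟨hy1.le, hy2.le⟩
    · exact fun a _ => hBcl a
    · rintro x ⟨hxA, hxP⟩ ρ hρ
      -- The truncated ball of scale `q` has Euclidean radius `q * R`, so an error of `ε / R` per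
      -- unit length becomes `ε * q`.
      obtain ⟨δ, hδ, hxδ⟩ := hxP (ε / R) (by positivity)
      obtain ⟨δ', hδ', hxU⟩ := Metric.isOpen_iff.1 hUo x (hAU hxA)
      set q : ℝ := min (min (ρ / R) (1 / (m + 1) / (1 + ε))) (min (δ / R / 2) (δ' / R / 2))
      have hq : 0 < q := by positivity
      have hq1 : q ≤ ρ / R := (min_le_left _ _).trans (min_le_left _ _)
      have hq2 : q ≤ 1 / (m + 1) / (1 + ε) := (min_le_left _ _).trans (min_le_right _ _)
      have hq3 : q ≤ δ / R / 2 := (min_le_right _ _).trans (min_le_left _ _)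
      have hq4 : q ≤ δ' / R / 2 := (min_le_right _ _).trans (min_le_right _ _)
      have hqδ : q * R < δ := by
        rw [← lt_div_iff₀ hR]
        have : 0 < δ / R := by positivity
        linarith
      have hqδ' : q * R < δ' := by
        rw [← lt_div_iff₀ hR]
        have : 0 < δ' / R := by positivity
        linarith
      refine ⟨(x, q), ⟨hxA, hq, ?_, ?_, ?_⟩, ?_, rfl⟩
      · exact (hBball _).trans ((Metric.closedBall_subset_ball hqδ').trans hxU)
      · exact (le_div_iff₀ (by positivity)).1 hq2
      · rintro y ⟨hyA, hy⟩ z ⟨hzA, hz⟩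
        refine hgΦ y hyA z hzA _ (by positivity) fun k => ?_
        refine (hxδ (q * R) (by positivity) hqδ y (hBball _ hy) z (hBball _ hz) k).trans ?_
        have h1 : supDeriv hΦ x (z - y) ≤ q / 2 + q / 2 := by
          calc supDeriv hΦ x (z - y) = supDeriv hΦ x ((z - x) - (y - x)) := by congr 1; abel
            _ ≤ supDeriv hΦ x (z - x) + supDeriv hΦ x (y - x) := map_sub_le_add _ _ _
            _ ≤ _ := add_le_add hz.1 hy.1
        have h2 : ε / R * (q * R) = ε * q := by field_simp
        rw [h2]
        linarith
      · exact (le_div_iff₀ hR).1 hq1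
  choose u huT huc hud hu0 using hvit
  -- The points covered by the Vitali families at every mesh `1 / (m + 1)`. The rest of `A` is null,
  -- hence so is its Lipschitz image.
  set A' : Set E := {x ∈ A | ∀ m, x ∈ ⋃ a ∈ u m, B a} with hA'
  have hnull : μ (A \ A') = 0 := by
    refine measure_mono_null (t := {x | ¬ P x} ∪ ⋃ m, ((A ∩ {x | P x}) \ ⋃ a ∈ u m, B a)) ?_
      (measure_union_null hPae (measure_iUnion_null hu0))
    rintro x ⟨hxA, hx⟩
    by_cases hxP : P x
    · right
      have : ∃ m, x ∉ ⋃ a ∈ u m, B a := by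
        by_contra! h
        exact hx ⟨hxA, h⟩
      obtain ⟨m, hm⟩ := this
      exact mem_iUnion.2 ⟨m, ⟨hxA, hxP⟩, hm⟩
    · exact Or.inl hxP
  have hsplit : g '' A ⊆ g '' A' ∪ g '' (A \ A') := by
    rw [← image_union]
    exact image_mono fun x hx => by by_cases h : x ∈ A' <;> simp [h, hx]
  have h1 : μH[(n : ℝ)] (g '' A) ≤ μH[(n : ℝ)] (g '' A') := by
    refine (measure_mono hsplit).trans ((measure_union_le _ _).trans ?_)
    rw [hausdorffMeasure_image_eq_zero μ (hg.mono sdiff_subset) hnull, add_zero]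
  refine h1.trans ?_
  have hcount : ∀ m, Countable (u m) := fun m => (huc m).to_subtype
  have hdiam : ∀ m, ∀ a : u m, Metric.ediam (g '' (A' ∩ B a)) ≤
      ENNReal.ofReal (1 + ε) * ENNReal.ofReal a.1.2 := by
    intro m a
    refine Metric.ediam_le ?_
    rintro _ ⟨y, hy, rfl⟩ _ ⟨z, hz, rfl⟩
    rw [← ENNReal.ofReal_mul (by positivity), edist_dist, mul_comm]
    exact ENNReal.ofReal_le_ofReal
      ((huT m a.2).2.2.2.2 y ⟨hy.1.1, hy.2⟩ z ⟨hz.1.1, hz.2⟩)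
  refine (Measure.hausdorffMeasure_le_liminf_tsum (n : ℝ) (g '' A') (l := Filter.atTop)
    (fun m : ℕ => ENNReal.ofReal (1 / (m + 1))) ?_ (fun m (a : u m) => g '' (A' ∩ B a))
    (Filter.Eventually.of_forall fun m a => ?_) (Filter.Eventually.of_forall fun m => ?_)).trans ?_
  · rw [← ENNReal.ofReal_zero]
    exact (ENNReal.continuous_ofReal.tendsto 0).comp tendsto_one_div_add_atTop_nhds_zero_nat
  · refine (hdiam m a).trans ?_
    rw [← ENNReal.ofReal_mul (by positivity), mul_comm]
    exact ENNReal.ofReal_le_ofReal (huT m a.2).2.2.2.1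
  · rintro _ ⟨x, hx, rfl⟩
    obtain ⟨a, ha, hxa⟩ := mem_iUnion₂.1 (hx.2 m)
    exact mem_iUnion.2 ⟨⟨a, ha⟩, x, ⟨hx, hxa⟩, rfl⟩
  · refine Filter.liminf_le_of_le (by isBoundedDefault) fun b hb => ?_
    obtain ⟨m, hm⟩ := hb.exists
    refine hm.trans ?_
    calc ∑' a : u m, Metric.ediam (g '' (A' ∩ B a)) ^ (n : ℝ)
        ≤ ∑' a : u m, ENNReal.ofReal (1 + ε) ^ n * (μ (B a) / s) := by
          refine ENNReal.tsum_le_tsum fun a => ?_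
          rw [ENNReal.rpow_natCast]
          refine (pow_le_pow_left' (hdiam m a) n).trans ?_
          rw [mul_pow]
          gcongr
          exact (ENNReal.le_div_iff_mul_le (Or.inl hs0) (Or.inl hs)).2 (hμB m a (huT m a.2))
      _ = ENNReal.ofReal (1 + ε) ^ n * (μ (⋃ a ∈ u m, B a) / s) := by
          rw [ENNReal.tsum_mul_left,
            measure_biUnion (huc m) (hud m) (fun a _ => (hBcl a).measurableSet)]
          simp only [div_eq_mul_inv, ENNReal.tsum_mul_right]
      _ ≤ ENNReal.ofReal (1 + ε) ^ n * ((μ A + ENNReal.ofReal ε) / s) := by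
          gcongr
          exact (measure_mono (iUnion₂_subset fun a ha => (huT m ha).2.2.1)).trans hU

theorem exists_countable_cover_dist_lt {α Z : Type*} [PseudoMetricSpace Z]
    [TopologicalSpace.SeparableSpace Z] (h : α → Z) (S : Set α) {ε : ℝ} (hε : 0 < ε) :
    ∃ T : Set (Set α), T.Countable ∧ S ⊆ ⋃₀ T ∧
      ∀ A ∈ T, A ⊆ S ∧ ∀ x ∈ A, ∀ y ∈ A, dist (h x) (h y) < ε := by
  obtain ⟨D, hDc, hDd⟩ := TopologicalSpace.exists_countable_dense Z
  refine ⟨(fun z => {x ∈ S | dist (h x) z < ε / 2}) '' D, hDc.image _, fun x hx => ?_, ?_⟩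
  · obtain ⟨z, hz, hxz⟩ := hDd.exists_dist_lt (h x) (half_pos hε)
    exact ⟨_, ⟨z, hz, rfl⟩, hx, hxz⟩
  · rintro _ ⟨z, -, rfl⟩
    refine ⟨sep_subset _ _, fun x hx y hy => ?_⟩
    have := dist_triangle_right (h x) (h y) z
    linarith [hx.2, hy.2]

/-! ### Lower bound for the Hausdorff measure of a Lipschitz image -/

section Pieces

variable {ι E : Type*} [NormedAddCommGroup E] [NormedSpace ℝ E] [FiniteDimensional ℝ E]
  {L : ℝ≥0} {Φ : ι → E → ℝ}

/-- By compactness of the unit sphere finitely many members almost attain the supremum in every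
direction. This makes the linearization below uniform. -/
theorem exists_finset_mul_supDeriv_le (hΦ : ∀ k, LipschitzWith L (Φ k)) {x : E} {c : ℝ}
    (hc : 0 < c) (hN : ∀ v, c * ‖v‖ ≤ supDeriv hΦ x v) {α : ℝ} (hα0 : 0 ≤ α) (hα : α < 1) :
    ∃ F : Finset ι, ∀ v, v ≠ 0 → ∃ k ∈ F, α * supDeriv hΦ x v ≤ |fderiv ℝ (Φ k) x v| := by
  have hsph : IsCompact (Metric.sphere (0 : E) 1) := isCompact_sphere 0 1
  obtain ⟨F, hF⟩ := hsph.elim_finite_subcover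
    (fun k : ι => {v | α * supDeriv hΦ x v < |fderiv ℝ (Φ k) x v|})
    (fun k => isOpen_lt (continuous_const.mul (continuous_supDeriv hΦ x)) (by fun_prop)) (by
      intro v hv
      have hv1 : ‖v‖ = 1 := by simpa using hv
      have hpos : 0 < supDeriv hΦ x v := by
        have := hN v
        rw [hv1, mul_one] at this
        linarith
      obtain ⟨k, hk⟩ := exists_lt_abs_fderiv hΦ (x := x) (v := v) (a := α * supDeriv hΦ x v)
        (by positivity) (by nlinarith)
      exact mem_iUnion.2 ⟨k, hk⟩)
  refine ⟨F, fun v hv => ?_⟩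
  have hv0 : 0 < ‖v‖ := norm_pos_iff.2 hv
  have hmem : ‖v‖⁻¹ • v ∈ Metric.sphere (0 : E) 1 := by
    rw [mem_sphere_zero_iff_norm, norm_smul, norm_inv, norm_norm, inv_mul_cancel₀ hv0.ne']
  obtain ⟨k, hkF, hk⟩ := mem_iUnion₂.1 (hF hmem)
  refine ⟨k, hkF, ?_⟩
  simp only [mem_ofPred_eq, map_smul, map_smul_eq_mul, smul_eq_mul, abs_mul, norm_inv, norm_norm,
    abs_inv, abs_norm] at hk
  have : ‖v‖⁻¹ * (α * supDeriv hΦ x v) < ‖v‖⁻¹ * |fderiv ℝ (Φ k) x v| := by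
    calc _ = α * (‖v‖⁻¹ * supDeriv hΦ x v) := by ring
      _ < _ := hk
  exact (lt_of_mul_lt_mul_left this (by positivity)).le

/-- Points of differentiability at which the metric derivative is a norm are covered by countably
many pieces on which increments are bounded below by the metric derivative at one point. -/
theorem exists_countable_cover_le_abs_sub [Nonempty ι] [Countable ι]
    (hΦ : ∀ k, LipschitzWith L (Φ k)) {S : Set E}
    (hS : ∀ x ∈ S, (∀ k, DifferentiableAt ℝ (Φ k) x) ∧ ∃ c > 0, ∀ v, c * ‖v‖ ≤ supDeriv hΦ x v)
    {β : ℝ} (hβ0 : 0 ≤ β) (hβ : β < 1) :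
    ∃ T : Set (Set E), T.Countable ∧ S ⊆ ⋃₀ T ∧ ∀ A ∈ T, A ⊆ S ∧
      ∀ x ∈ A, ∀ y ∈ A, ∀ z ∈ A, ∃ k, β * supDeriv hΦ x (z - y) ≤ |Φ k z - Φ k y| := by
  -- The margin `α - β` absorbs two errors of size `1 / (m + 1) * ‖z - y‖`: the linearization error
  -- at `y`, and the change of the derivative from `x` to `y`.
  set α : ℝ := (1 + β) / 2 with hα
  have hβα : 0 < α - β := by rw [hα]; linarith
  have hη : ∀ m : ℕ, (0 : ℝ) < 1 / (m + 1) := fun m => Nat.one_div_pos_of_nat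
  -- The index records a finite almost norming set `F`, the tolerance `1 / (m + 1)` and the scale `1
  -- / (p + 1)` at which the members of `F` are linear up to that tolerance.
  set S' : Finset ι × ℕ × ℕ → Set E := fun j => {x ∈ S |
    (∀ v, v ≠ 0 → ∃ k ∈ j.1, α * supDeriv hΦ x v ≤ |fderiv ℝ (Φ k) x v|) ∧
    (∀ v, 2 * (1 / (j.2.1 + 1)) * ‖v‖ ≤ (α - β) * supDeriv hΦ x v) ∧
    (∀ z, ‖z - x‖ < 1 / (j.2.2 + 1) → ∀ k ∈ j.1,
      |Φ k z - Φ k x - fderiv ℝ (Φ k) x (z - x)| ≤ 1 / (j.2.1 + 1) * ‖z - x‖)} with hS'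
  have hcov : S ⊆ ⋃ j, S' j := by
    intro x hx
    obtain ⟨hd, c, hc, hcN⟩ := hS x hx
    obtain ⟨F, hF⟩ := exists_finset_mul_supDeriv_le hΦ hc hcN (α := α) (by positivity)
      (by rw [hα]; linarith)
    obtain ⟨m, hm⟩ := exists_nat_one_div_lt (show 0 < (α - β) * c / 2 by positivity)
    have hev : ∀ᶠ z in nhds x, ∀ k ∈ F,
        |Φ k z - Φ k x - fderiv ℝ (Φ k) x (z - x)| ≤ 1 / (m + 1) * ‖z - x‖ := by
      rw [Filter.eventually_all_finset]
      exact fun k _ => (hd k).hasFDerivAt.isLittleO.def (hη m)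
    obtain ⟨δ, hδ, h⟩ := Metric.eventually_nhds_iff.1 hev
    obtain ⟨p, hp⟩ := exists_nat_one_div_lt hδ
    refine mem_iUnion.2 ⟨(F, m, p), hx, hF, fun v => ?_, fun z hz => h ?_⟩
    · have h2 := mul_le_mul_of_nonneg_left (hcN v) hβα.le
      nlinarith [norm_nonneg v]
    · rw [dist_eq_norm]
      exact hz.trans hp
  -- Each set is cut further into pieces smaller than the scale, on which the derivatives of the
  -- members of `F` oscillate less than the tolerance. As `F` is finite, these derivatives take
  -- values in a separable space.
  have hpiece : ∀ j, ∃ T : Set (Set E), T.Countable ∧ S' j ⊆ ⋃₀ T ∧ ∀ A ∈ T, A ⊆ S' j ∧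
      ∀ x ∈ A, ∀ y ∈ A, dist (x, fun k : j.1 => fderiv ℝ (Φ k) x)
        (y, fun k : j.1 => fderiv ℝ (Φ k) y) <
          min (1 / ((j.2.1 : ℝ) + 1)) (1 / ((j.2.2 : ℝ) + 1)) :=
    fun j => exists_countable_cover_dist_lt (fun x => (x, fun k : j.1 => fderiv ℝ (Φ k) x)) (S' j)
      (lt_min (hη _) (hη _))
  choose T hTc hTcov hT using hpiece
  refine ⟨⋃ j, T j, countable_iUnion hTc, fun x hx => ?_, fun A hA => ?_⟩
  · obtain ⟨j, hj⟩ := mem_iUnion.1 (hcov hx)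
    obtain ⟨A, hA, hxA⟩ := hTcov j hj
    exact ⟨A, mem_iUnion.2 ⟨j, hA⟩, hxA⟩
  · obtain ⟨j, hj⟩ := mem_iUnion.1 hA
    obtain ⟨hAS, hAd⟩ := hT j A hj
    refine ⟨hAS.trans (sep_subset _ _), fun x hx y hy z hz => ?_⟩
    rcases eq_or_ne z y with rfl | hzy
    · exact ⟨Classical.arbitrary ι, by simp⟩
    obtain ⟨k, hk, hkx⟩ := (hAS hx).2.1 (z - y) (sub_ne_zero.2 hzy)
    refine ⟨k, ?_⟩
    have h1 := (hAS hx).2.2.1 (z - y)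
    have hdzy := hAd z hz y hy
    have hdyx := hAd y hy x hx
    rw [Prod.dist_eq, max_lt_iff, lt_min_iff, lt_min_iff] at hdzy hdyx
    have h2 := (hAS hy).2.2.2 z (by rw [← dist_eq_norm]; exact hdzy.1.2) k hk
    have h3 : ‖fderiv ℝ (Φ k) y - fderiv ℝ (Φ k) x‖ ≤ 1 / (j.2.1 + 1) := by
      rw [← dist_eq_norm]
      exact (dist_le_pi_dist (fun k : j.1 => fderiv ℝ (Φ k) y) (fun k : j.1 => fderiv ℝ (Φ k) x)
        ⟨k, hk⟩).trans hdyx.2.1.le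
    have h4 : |fderiv ℝ (Φ k) y (z - y) - fderiv ℝ (Φ k) x (z - y)|
        ≤ 1 / (j.2.1 + 1) * ‖z - y‖ := by
      have := (fderiv ℝ (Φ k) y - fderiv ℝ (Φ k) x).le_of_opNorm_le h3 (z - y)
      simpa using this
    have h5 : |fderiv ℝ (Φ k) x (z - y)| ≤ |Φ k z - Φ k y| +
        |Φ k z - Φ k y - fderiv ℝ (Φ k) y (z - y)| +
        |fderiv ℝ (Φ k) y (z - y) - fderiv ℝ (Φ k) x (z - y)| := by
      set a := fderiv ℝ (Φ k) x (z - y)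
      set b := fderiv ℝ (Φ k) y (z - y)
      have e : a = (Φ k z - Φ k y) - (Φ k z - Φ k y - b) - (b - a) := by ring
      calc |a| = |(Φ k z - Φ k y) - (Φ k z - Φ k y - b) - (b - a)| := by rw [← e]
        _ ≤ _ := (abs_sub _ _).trans (by gcongr; exact abs_sub _ _)
    linarith

end Pieces

/-- Lower bound for the Hausdorff measure of the image of a map which expands a norm. -/
theorem volume_le_mul_hausdorffMeasure_image {n : ℕ} {X : Type*} [MetricSpace X]
    [MeasurableSpace X] [BorelSpace X] (N : Seminorm ℝ (EuclideanSpace ℝ (Fin n)))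
    (hN : Continuous N) {c : ℝ} (hc : 0 < c) (hcN : ∀ v, c * ‖v‖ ≤ N v)
    {A : Set (EuclideanSpace ℝ (Fin n))} {g : EuclideanSpace ℝ (Fin n) → X} {β : ℝ} (hβ : 0 < β)
    (hg : ∀ y ∈ A, ∀ z ∈ A, β * N (z - y) ≤ dist (g y) (g z)) {s : ℝ≥0∞} (hs0 : s ≠ 0)
    (hs : s ≠ ∞) (hNs : volume {v | N v ≤ 1 / 2} ≤ s) :
    volume A ≤ ENNReal.ofReal β⁻¹ ^ n * s * μH[(n : ℝ)] (g '' A) := by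
  set D : ℝ≥0∞ := ENNReal.ofReal β⁻¹ ^ n * s with hD
  have hD0 : D ≠ 0 := mul_ne_zero (pow_ne_zero _ (by simpa using hβ)) hs0
  have hDt : D ≠ ∞ := ENNReal.mul_ne_top (ENNReal.pow_ne_top ENNReal.ofReal_ne_top) hs
  rw [← ENNReal.div_le_iff' hD0 hDt, Measure.hausdorffMeasure_apply]
  -- Covers at scale `1` suffice, since only finiteness of the diameters is used. Pulling the cover
  -- back, the isodiametric inequality for `N` bounds each piece.
  refine le_iSup₂_of_le 1 one_pos (le_iInf₂ fun t ht => le_iInf fun ht1 => ?_)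
  rw [ENNReal.div_le_iff' hD0 hDt, ← ENNReal.tsum_mul_left]
  have hA : A ⊆ ⋃ i, A ∩ g ⁻¹' t i := fun x hx => by
    obtain ⟨i, hi⟩ := mem_iUnion.1 (ht ⟨x, hx, rfl⟩)
    exact mem_iUnion.2 ⟨i, hx, hi⟩
  refine (measure_mono hA).trans ((measure_iUnion_le _).trans (ENNReal.tsum_le_tsum fun i => ?_))
  rcases (A ∩ g ⁻¹' t i).eq_empty_or_nonempty with he | ⟨x, hx⟩
  · rw [he, measure_empty]; exact zero_le
  have hfin : Metric.ediam (t i) ≠ ∞ := ne_top_of_le_ne_top ENNReal.one_ne_top (ht1 i)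
  rw [iSup_pos ⟨g x, hx.2⟩, ENNReal.rpow_natCast]
  have key := volume_le_of_seminorm_sub_le N hN hc hcN (V := A ∩ g ⁻¹' t i)
    (d := β⁻¹ * (Metric.ediam (t i)).toReal) (by positivity) ?_
  · refine key.trans ?_
    rw [ENNReal.ofReal_mul (by positivity), ENNReal.ofReal_toReal hfin, mul_pow, hD]
    calc _ ≤ ENNReal.ofReal β⁻¹ ^ n * Metric.ediam (t i) ^ n * s := by gcongr
      _ = _ := by ring
  · intro u hu v hv
    rw [le_inv_mul_iff₀ hβ]
    refine (hg v hv.1 u hu.1).trans ?_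
    rw [dist_edist]
    exact ENNReal.toReal_mono hfin (Metric.edist_le_ediam_of_mem hv.2 hu.2)

/-! ### Degenerate metric derivatives, and comparison of metric derivatives by volume -/

section Degenerate

variable {ι E : Type*} [NormedAddCommGroup E] [NormedSpace ℝ E] [FiniteDimensional ℝ E]
  {L : ℝ≥0} {Φ : ι → E → ℝ}

/-- Otherwise the minimum of the seminorm over the unit sphere would serve as `c`. An empty sphere
means that the space is trivial, and then any `c` works. -/
theorem exists_norm_eq_one_supDeriv_eq_zero (hΦ : ∀ k, LipschitzWith L (Φ k)) {x : E}
    (hx : ¬ ∃ c > 0, ∀ v, c * ‖v‖ ≤ supDeriv hΦ x v) : ∃ v, ‖v‖ = 1 ∧ supDeriv hΦ x v = 0 := by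
  rcases (Metric.sphere (0 : E) 1).eq_empty_or_nonempty with he | hne
  · refine absurd ⟨1, one_pos, fun v => ?_⟩ hx
    have : ‖v‖ = 0 := by
      by_contra h
      have hmem : ‖v‖⁻¹ • v ∈ Metric.sphere (0 : E) 1 := by
        rw [mem_sphere_zero_iff_norm, norm_smul, norm_inv, norm_norm, inv_mul_cancel₀ h]
      rw [he] at hmem
      exact hmem
    rw [this, mul_zero]
    exact apply_nonneg _ _
  obtain ⟨v, hv, hmin⟩ := (isCompact_sphere (0 : E) 1).exists_isMinOn hne
    (continuous_supDeriv hΦ x).continuousOn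
  refine ⟨v, by simpa using hv, ?_⟩
  by_contra h
  have hpos : 0 < supDeriv hΦ x v := lt_of_le_of_ne (apply_nonneg _ _) (Ne.symm h)
  refine hx ⟨_, hpos, fun w => ?_⟩
  rcases eq_or_ne w 0 with rfl | hw
  · simp
  have hw0 : 0 < ‖w‖ := norm_pos_iff.2 hw
  have hmem : ‖w‖⁻¹ • w ∈ Metric.sphere (0 : E) 1 := by
    rw [mem_sphere_zero_iff_norm, norm_smul, norm_inv, norm_norm, inv_mul_cancel₀ hw0.ne']
  have := hmin hmem
  simp only [mem_ofPred_eq, map_smul_eq_mul, norm_inv, norm_norm] at this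
  rwa [le_inv_mul_iff₀ hw0, mul_comm] at this

variable [MeasurableSpace E] [BorelSpace E]

omit [FiniteDimensional ℝ E] in
-- `M` disjoint balls of radius `ρ` are strung along the null direction `v`, each inside the unit
-- ball of the seminorm up to normalization. As `M` is arbitrary, that unit ball has infinite
-- volume.
theorem nat_mul_le_measure_supDeriv_le (μ : Measure E) [μ.IsAddHaarMeasure]
    (hΦ : ∀ k, LipschitzWith L (Φ k)) {x v : E} (hv : ‖v‖ = 1) (hv0 : supDeriv hΦ x v = 0)
    {ρ : ℝ} (hρ : 0 < ρ) (hL : L * ρ ≤ 1 / 2) (M : ℕ) :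
    M * μ (Metric.ball 0 ρ) ≤
      μ ({w | supDeriv hΦ x w ≤ 1 / 2} ∩ Metric.closedBall 0 (2 * ρ * M + ρ)) := by
  have hdisj : (Finset.range M : Set ℕ).PairwiseDisjoint
      fun j : ℕ => Metric.ball ((2 * ρ * j) • v) ρ := by
    intro i _ j _ hij
    refine Metric.ball_disjoint_ball ?_
    rw [dist_eq_norm, ← sub_smul, norm_smul, hv, mul_one, ← mul_sub, norm_mul,
      Real.norm_of_nonneg (by positivity)]
    have : (1 : ℝ) ≤ ‖(i : ℝ) - j‖ := by
      have h : (1 : ℤ) ≤ |(i : ℤ) - j| := Int.one_le_abs (by omega)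
      rw [Real.norm_eq_abs]
      exact_mod_cast h
    nlinarith
  calc M * μ (Metric.ball 0 ρ) = ∑ j ∈ Finset.range M, μ (Metric.ball ((2 * ρ * j) • v) ρ) := by
        simp [Measure.addHaar_ball_center]
    _ = μ (⋃ j ∈ Finset.range M, Metric.ball ((2 * ρ * j) • v) ρ) :=
        (measure_biUnion_finset hdisj fun _ _ => measurableSet_ball).symm
    _ ≤ _ := by
        refine measure_mono (iUnion₂_subset fun j hj w hw => ⟨?_, ?_⟩)
        · rw [Metric.mem_ball, dist_eq_norm] at hw
          refine (supDeriv_le_add hΦ x w ((2 * ρ * j) • v)).trans ?_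
          rw [map_smul_eq_mul, hv0, mul_zero, zero_add]
          exact (mul_le_mul_of_nonneg_left hw.le L.2).trans hL
        · rw [Metric.mem_ball] at hw
          have hj' : (j : ℝ) ≤ M := by exact_mod_cast (Finset.mem_range.1 hj).le
          have h1 : dist ((2 * ρ * j) • v) 0 = 2 * ρ * j := by
            rw [dist_zero_right, norm_smul, hv, mul_one, Real.norm_of_nonneg (by positivity)]
          rw [Metric.mem_closedBall]
          have h2 : 2 * ρ * j ≤ 2 * ρ * M := by gcongr
          linarith [dist_triangle w ((2 * ρ * j) • v) 0]

/-- The set of points where the metric derivative degenerates has negligible image. -/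
theorem hausdorffMeasure_image_degenerate_eq_zero {X : Type*} [MetricSpace X]
    [MeasurableSpace X] [BorelSpace X] [Countable ι] (μ : Measure E) [μ.IsAddHaarMeasure]
    {C : ℝ≥0} (hΦ : ∀ k, LipschitzWith L (Φ k)) {A : Set E} {g : E → X}
    (hg : LipschitzOnWith C g A)
    (hgΦ : ∀ y ∈ A, ∀ z ∈ A, ∀ a, 0 ≤ a → (∀ k, |Φ k z - Φ k y| ≤ a) → dist (g y) (g z) ≤ a)
    (hA : ∀ x ∈ A, ¬ ∃ c > 0, ∀ v, c * ‖v‖ ≤ supDeriv hΦ x v) :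
    μH[(Module.finrank ℝ E : ℝ)] (g '' A) = 0 := by
  have hcov : g '' A ⊆ ⋃ j : ℕ, g '' (A ∩ Metric.ball 0 j) := by
    rw [← image_iUnion, ← inter_iUnion, Metric.iUnion_ball_nat, inter_univ]
  refine measure_mono_null hcov (measure_iUnion_null fun j => ?_)
  set A' := A ∩ Metric.ball (0 : E) j
  have hA' : μ A' ≠ ∞ := ne_top_of_le_ne_top (measure_ball_lt_top (x := (0 : E)) (r := j)).ne
    (measure_mono inter_subset_right)
  set ρ : ℝ := 1 / (2 * (L + 1)) with hρ
  have hρ0 : 0 < ρ := by positivity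
  have hL : L * ρ ≤ 1 / 2 := by
    rw [hρ, mul_one_div, div_le_div_iff₀ (by positivity) (by norm_num)]
    linarith
  set b := μ (Metric.ball (0 : E) ρ) with hb
  have hb0 : b ≠ 0 := (Metric.measure_ball_pos μ 0 hρ0).ne'
  have hbt : b ≠ ∞ := measure_ball_lt_top.ne
  -- The upper bound for images with a volume threshold growing linearly in `M`; letting `M → ∞`
  -- gives zero.
  have key : ∀ M : ℕ, μH[(Module.finrank ℝ E : ℝ)] (g '' A') ≤ μ A' / ((M + 1 : ℕ) * b) := by
    intro M
    refine hausdorffMeasure_image_le_of_supDeriv μ hΦ (hg.mono inter_subset_left)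
      (fun y hy z hz => hgΦ y hy.1 z hz.1) (mul_ne_zero (by simp) hb0)
      (ENNReal.mul_ne_top (by simp) hbt) (R := 2 * ρ * (M + 1 : ℕ) + ρ) (by positivity)
      fun x hx => ?_
    obtain ⟨v, hv, hv0⟩ := exists_norm_eq_one_supDeriv_eq_zero hΦ (hA x hx.1)
    exact nat_mul_le_measure_supDeriv_le μ hΦ hv hv0 hρ0 hL (M + 1)
  have hlim : Filter.Tendsto (fun M : ℕ => μ A' / ((M + 1 : ℕ) * b)) Filter.atTop
      (nhds (μ A' / ∞)) := by
    refine ENNReal.Tendsto.div tendsto_const_nhds (Or.inr ENNReal.top_ne_zero) ?_ (Or.inr hA')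
    have h1 : Filter.Tendsto (fun M : ℕ => ((M + 1 : ℕ) : ℝ≥0∞)) Filter.atTop (nhds ∞) :=
      ENNReal.tendsto_nat_nhds_top.comp (Filter.tendsto_add_atTop_nat 1)
    have := ENNReal.Tendsto.mul_const h1 (b := b) (Or.inl ENNReal.top_ne_zero)
    rwa [ENNReal.top_mul hb0] at this
  have := ge_of_tendsto' hlim key
  rw [ENNReal.div_top] at this
  exact le_antisymm this bot_le

omit [BorelSpace E] in
theorem measure_setOf_seminorm_le_ne_top (μ : Measure E) [IsFiniteMeasureOnCompacts μ]
    {N : Seminorm ℝ E} {c : ℝ} (hc : 0 < c) (hN : ∀ v, c * ‖v‖ ≤ N v) :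
    μ {v | N v ≤ 1 / 2} ≠ ∞ := by
  refine ne_top_of_le_ne_top (isCompact_closedBall (0 : E) (1 / 2 / c)).measure_ne_top
    (measure_mono fun v hv => ?_)
  rw [mem_closedBall_zero_iff, le_div_iff₀ hc, mul_comm]
  exact (hN v).trans hv

/-- A norm strictly larger than a seminorm has a unit ball of strictly smaller volume. -/
theorem measure_setOf_seminorm_le_lt (μ : Measure E) [μ.IsAddHaarMeasure]
    {N₁ N₂ : Seminorm ℝ E} (h₁ : Continuous N₁) (h₂ : Continuous N₂) {c : ℝ} (hc : 0 < c)
    (hN : ∀ v, c * ‖v‖ ≤ N₁ v) (hle : ∀ v, N₂ v ≤ N₁ v) {w : E} (hw : N₂ w < N₁ w) :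
    μ {v | N₁ v ≤ 1 / 2} < μ {v | N₂ v ≤ 1 / 2} := by
  set U : Set E := {v | N₂ v < 1 / 2} ∩ {v | 1 / 2 < N₁ v}
  have hU : IsOpen U := (isOpen_lt h₂ continuous_const).inter (isOpen_lt continuous_const h₁)
  have hUne : U.Nonempty := by
    have h0 : 0 ≤ N₂ w := apply_nonneg _ _
    have hs : 0 < N₁ w + N₂ w := by linarith
    -- After this rescaling the two seminorms of `w` sum to `1` and differ, so they lie on either
    -- side of `1 / 2`.
    refine ⟨(N₁ w + N₂ w)⁻¹ • w, ?_, ?_⟩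
    · simp only [mem_ofPred_eq, map_smul_eq_mul, norm_inv, Real.norm_of_nonneg hs.le]
      rw [inv_mul_lt_iff₀ hs]; linarith
    · simp only [mem_ofPred_eq, map_smul_eq_mul, norm_inv, Real.norm_of_nonneg hs.le]
      rw [lt_inv_mul_iff₀ hs]; linarith
  have hUpos : 0 < μ U := hU.measure_pos μ hUne
  have hdisj : Disjoint {v | N₁ v ≤ 1 / 2} U :=
    disjoint_left.2 fun v hv hv' => not_lt.2 (show N₁ v ≤ 1 / 2 from hv) hv'.2
  calc μ {v | N₁ v ≤ 1 / 2} < μ {v | N₁ v ≤ 1 / 2} + μ U :=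
        ENNReal.lt_add_right (measure_setOf_seminorm_le_ne_top μ hc hN) hUpos.ne'
    _ = μ ({v | N₁ v ≤ 1 / 2} ∪ U) := (measure_union hdisj hU.measurableSet).symm
    _ ≤ _ := measure_mono (union_subset (fun v hv => (hle v).trans hv) fun v hv =>
        (show N₂ v < 1 / 2 from hv.1).le)

end Degenerate

/-- Suppose that the image under `g` has at most the Hausdorff measure of the image under a map
`g'`, whose metric derivative is induced by a subfamily of the functions inducing that of `g`.
Then, outside of a negligible set, the two metric derivatives agree. -/
theorem hausdorffMeasure_image_setOf_not_supDeriv_le {n : ℕ} {ι κ X Y : Type*}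
    [MetricSpace X] [MeasurableSpace X] [BorelSpace X] [MetricSpace Y] [MeasurableSpace Y]
    [BorelSpace Y] [Countable ι] [Countable κ] [Nonempty ι] {L C : ℝ≥0}
    {Φ : ι → EuclideanSpace ℝ (Fin n) → ℝ} (hΦ : ∀ k, LipschitzWith L (Φ k)) (τ : κ → ι)
    {A : Set (EuclideanSpace ℝ (Fin n))} {g : EuclideanSpace ℝ (Fin n) → X}
    {g' : EuclideanSpace ℝ (Fin n) → Y} (hg : LipschitzOnWith C g A) (hg' : LipschitzOnWith C g' A)
    (hΦg : ∀ y ∈ A, ∀ z ∈ A, ∀ k, |Φ k z - Φ k y| ≤ dist (g y) (g z))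
    (hgΦ : ∀ y ∈ A, ∀ z ∈ A, ∀ a, 0 ≤ a → (∀ k, |Φ k z - Φ k y| ≤ a) → dist (g y) (g z) ≤ a)
    (hgΦ' : ∀ y ∈ A, ∀ z ∈ A, ∀ a, 0 ≤ a → (∀ k, |Φ (τ k) z - Φ (τ k) y| ≤ a) →
      dist (g' y) (g' z) ≤ a)
    (hvol : ∀ S ⊆ A, μH[(n : ℝ)] (g '' S) ≤ μH[(n : ℝ)] (g' '' S)) :
    μH[(n : ℝ)] (g '' {x ∈ A | ¬ ((∀ k, DifferentiableAt ℝ (Φ k) x) ∧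
      (∃ c > 0, ∀ v, c * ‖v‖ ≤ supDeriv hΦ x v) ∧
      ∀ v, supDeriv hΦ x v ≤ supDeriv (fun k => hΦ (τ k)) x v)}) = 0 := by
  have hfin : (n : ℝ) = Module.finrank ℝ (EuclideanSpace ℝ (Fin n)) := by simp
  set A₁ := {x ∈ A | ¬ ∀ k, DifferentiableAt ℝ (Φ k) x} with hA₁
  set A₂ := {x ∈ A | ¬ ∃ c > 0, ∀ v, c * ‖v‖ ≤ supDeriv hΦ x v} with hA₂
  set P := {x ∈ A | (∀ k, DifferentiableAt ℝ (Φ k) x) ∧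
    (∃ c > 0, ∀ v, c * ‖v‖ ≤ supDeriv hΦ x v) ∧
    ∃ v, supDeriv (fun k => hΦ (τ k)) x v < supDeriv hΦ x v} with hP
  have h1 : μH[(n : ℝ)] (g '' A₁) = 0 := by
    rw [hfin]
    refine hausdorffMeasure_image_eq_zero volume (hg.mono (sep_subset _ _)) ?_
    refine measure_mono_null (fun x hx => hx.2) (ae_all_iff.2 fun k => (hΦ k).ae_differentiableAt)
  have h2 : μH[(n : ℝ)] (g '' A₂) = 0 := by
    rw [hfin]
    exact hausdorffMeasure_image_degenerate_eq_zero volume hΦ (hg.mono (sep_subset _ _))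
      (fun y hy z hz => hgΦ y hy.1 z hz.1) fun x hx => hx.2
  suffices h3 : volume P = 0 by
    have h3' : μH[(n : ℝ)] (g '' P) = 0 := by
      rw [hfin]
      exact hausdorffMeasure_image_eq_zero volume (hg.mono (sep_subset _ _)) h3
    refine measure_mono_null ?_ (measure_union_null (measure_union_null h1 h2) h3')
    rw [← image_union, ← image_union]
    refine image_mono fun x hx => ?_
    by_cases hx1 : ∀ k, DifferentiableAt ℝ (Φ k) x
    · by_cases hx2 : ∃ c > 0, ∀ v, c * ‖v‖ ≤ supDeriv hΦ x v
      · refine Or.inr ⟨hx.1, hx1, hx2, ?_⟩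
        by_contra! h
        exact hx.2 ⟨hx1, hx2, h⟩
      · exact Or.inl (Or.inr ⟨hx.1, hx2⟩)
    · exact Or.inl (Or.inl ⟨hx.1, hx1⟩)
  -- A strict gap between the metric derivatives gives a strict gap between the volumes of their
  -- unit balls. Thresholds `s₁ < s₂` in that gap may be taken from a countable dense set, and `R`
  -- makes everything bounded.
  set Q : ℝ≥0 × ℝ≥0 × ℕ → Set (EuclideanSpace ℝ (Fin n)) := fun j => {x ∈ P |
    volume {v | supDeriv hΦ x v ≤ 1 / 2} ≤ j.1 ∧
    (j.2.1 : ℝ≥0∞) ≤ volume ({v | supDeriv (fun k => hΦ (τ k)) x v ≤ 1 / 2} ∩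
      Metric.closedBall 0 j.2.2) ∧ x ∈ Metric.closedBall 0 j.2.2 ∧ 0 < j.2.2 } with hQ
  obtain ⟨D, hDc, hDd⟩ := TopologicalSpace.exists_countable_dense ℝ≥0
  have hPQ : P ⊆ ⋃ j ∈ {j : ℝ≥0 × ℝ≥0 × ℕ | j.1 ∈ D ∧ j.2.1 ∈ D ∧ 0 < j.1 ∧ j.1 < j.2.1}, Q j := by
    intro x hx
    obtain ⟨hxA, hxd, ⟨c, hc, hcN⟩, w, hw⟩ := hx
    have hlt := measure_setOf_seminorm_le_lt volume (continuous_supDeriv hΦ x)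
      (continuous_supDeriv (fun k => hΦ (τ k)) x) hc hcN
      (fun v => supDeriv_le (fun k => hΦ (τ k)) (apply_nonneg _ _)
        fun k => abs_fderiv_le_supDeriv hΦ x v (τ k)) hw
    obtain ⟨r₁, hr₁, hr₁'⟩ := ENNReal.lt_iff_exists_nnreal_btwn.1 hlt
    obtain ⟨r₂, hr₂, hr₂'⟩ := ENNReal.lt_iff_exists_nnreal_btwn.1 hr₁'
    have hr₁₂ : r₁ < r₂ := by exact_mod_cast hr₂
    obtain ⟨s₁, hs₁D, hs₁, hs₁'⟩ := hDd.exists_between hr₁₂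
    obtain ⟨s₂, hs₂D, hs₂, hs₂'⟩ := hDd.exists_between hs₁'
    have hmono : Monotone fun R : ℕ => {v | supDeriv (fun k => hΦ (τ k)) x v ≤ 1 / 2} ∩
        Metric.closedBall (0 : EuclideanSpace ℝ (Fin n)) R := fun a b hab =>
      inter_subset_inter_right _ (Metric.closedBall_subset_closedBall (by exact_mod_cast hab))
    have hlim := tendsto_measure_iUnion_atTop (μ := volume) hmono
    rw [← inter_iUnion, Metric.iUnion_closedBall_nat, inter_univ] at hlim
    have hs₂lt : (s₂ : ℝ≥0∞) < volume {v | supDeriv (fun k => hΦ (τ k)) x v ≤ 1 / 2} :=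
      lt_trans (by exact_mod_cast hs₂') hr₂'
    have hev := hlim.eventually (lt_mem_nhds hs₂lt)
    obtain ⟨R₀, hR₀⟩ := exists_nat_ge ‖x‖
    obtain ⟨R, hR, hRR, hR0⟩ := (hev.and ((Filter.eventually_ge_atTop R₀).and
      (Filter.eventually_gt_atTop 0))).exists
    refine mem_iUnion₂.2 ⟨(s₁, s₂, R), ⟨hs₁D, hs₂D, lt_of_le_of_lt zero_le hs₁, hs₂⟩,
      ⟨hxA, hxd, ⟨c, hc, hcN⟩, w, hw⟩, ?_, hR.le, ?_, hR0⟩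
    · exact (hr₁.trans (by exact_mod_cast hs₁)).le
    · rw [mem_closedBall_zero_iff]
      exact hR₀.trans (by exact_mod_cast hRR)
  have hcount : {j : ℝ≥0 × ℝ≥0 × ℕ | j.1 ∈ D ∧ j.2.1 ∈ D ∧ 0 < j.1 ∧ j.1 < j.2.1}.Countable := by
    refine (hDc.prod (hDc.prod (countable_univ (α := ℕ)))).mono ?_
    rintro ⟨a, b, c⟩ ⟨ha, hb, -⟩
    exact ⟨ha, hb, mem_univ _⟩
  refine measure_mono_null hPQ ((measure_biUnion_null_iff hcount).2 ?_)
  rintro ⟨s₁, s₂, R⟩ ⟨-, -, hs₁, hs₁₂⟩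
  simp only at hs₁ hs₁₂
  -- choose `β < 1` with `β⁻ⁿ s₁ < s₂`
  obtain ⟨β, hβ0, hβ1, hβ⟩ : ∃ β : ℝ, 0 < β ∧ β < 1 ∧
      ENNReal.ofReal β⁻¹ ^ n * s₁ < (s₂ : ℝ≥0∞) := by
    have hlim : Filter.Tendsto (fun β : ℝ => ENNReal.ofReal β⁻¹ ^ n * (s₁ : ℝ≥0∞))
        (nhdsWithin 1 (Iio 1)) (nhds (ENNReal.ofReal 1⁻¹ ^ n * s₁)) := by
      refine Filter.Tendsto.mono_left ?_ nhdsWithin_le_nhds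
      refine ENNReal.Tendsto.mul_const ?_ (Or.inr (by simp))
      refine ((ENNReal.continuous_pow n).tendsto _).comp
        ((ENNReal.continuous_ofReal.tendsto _).comp ?_)
      exact tendsto_inv₀ one_ne_zero
    have hlt : ENNReal.ofReal 1⁻¹ ^ n * (s₁ : ℝ≥0∞) < s₂ := by
      simpa using hs₁₂
    have hpos : ∀ᶠ β : ℝ in nhdsWithin 1 (Iio 1), 0 < β :=
      nhdsWithin_le_nhds (lt_mem_nhds one_pos)
    obtain ⟨β, h1, h2, h3⟩ := ((hlim.eventually (gt_mem_nhds hlt)).and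
      (hpos.and self_mem_nhdsWithin)).exists
    exact ⟨β, h2, h3, h1⟩
  obtain ⟨T, hTc, hTcov, hT⟩ := exists_countable_cover_le_abs_sub hΦ (S := Q (s₁, s₂, R))
    (fun x hx => ⟨hx.1.2.1, hx.1.2.2.1⟩) hβ0.le hβ1
  refine measure_mono_null hTcov ((measure_sUnion_null_iff hTc).2 fun S hS => ?_)
  obtain ⟨hSQ, hSN⟩ := hT S hS
  rcases S.eq_empty_or_nonempty with rfl | ⟨x, hx⟩
  · exact measure_empty
  have hSA : S ⊆ A := fun y hy => (hSQ hy).1.1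
  obtain ⟨c, hc, hcN⟩ := (hSQ hx).1.2.2.1
  have low := volume_le_mul_hausdorffMeasure_image (supDeriv hΦ x) (continuous_supDeriv hΦ x)
    hc hcN (A := S) (g := g) hβ0 (fun y hy z hz => by
      obtain ⟨k, hk⟩ := hSN x hx y hy z hz
      exact hk.trans (hΦg y (hSA hy) z (hSA hz) k))
    (s := s₁) (by exact_mod_cast hs₁.ne') ENNReal.coe_ne_top (hSQ hx).2.1
  have hs₂0 : (s₂ : ℝ≥0∞) ≠ 0 := by exact_mod_cast (hs₁.trans hs₁₂).ne'
  have up : μH[(n : ℝ)] (g' '' S) ≤ volume S / s₂ := by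
    rw [hfin]
    refine hausdorffMeasure_image_le_of_supDeriv volume (fun k => hΦ (τ k)) (hg'.mono hSA)
      (fun y hy z hz => hgΦ' y (hSA hy) z (hSA hz)) hs₂0 ENNReal.coe_ne_top (R := R)
      (by exact_mod_cast (hSQ hx).2.2.2.2) fun y hy => (hSQ hy).2.2.1
  by_contra hne
  have hSfin : volume S ≠ ∞ := ne_top_of_le_ne_top
    (measure_closedBall_lt_top (x := (0 : EuclideanSpace ℝ (Fin n))) (r := R)).ne
    (measure_mono fun y hy => (hSQ hy).2.2.2.1)
  -- The lower bound for `g`, the volume hypothesis and the upper bound for `g'` give `|S| ≤ β⁻ⁿ (s₁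
  -- / s₂) |S|`, with a factor less than `1`.
  have : volume S < volume S := by
    calc volume S ≤ ENNReal.ofReal β⁻¹ ^ n * s₁ * (volume S / s₂) :=
          low.trans (by gcongr; exact (hvol S hSA).trans up)
      _ < s₂ * (volume S / s₂) := by
          refine ENNReal.mul_lt_mul_left ?_ ?_ hβ
          · exact (ENNReal.div_pos hne ENNReal.coe_ne_top).ne'
          · exact ENNReal.div_ne_top hSfin hs₂0
      _ = volume S := ENNReal.mul_div_cancel hs₂0 ENNReal.coe_ne_top
  exact lt_irrefl _ this

/-! ### Derivatives along curves -/

/-- The isolated points of `s` form a discrete, hence countable, set. At the other points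
derivatives within `s` are unique. -/
theorem ae_accPt_of_mem (s : Set ℝ) :
    ∀ᵐ t : ℝ, t ∈ s → AccPt t (Filter.principal s) := by
  set S : Set ℝ := {t ∈ s | ¬ AccPt t (Filter.principal s)} with hS
  have hd : DiscreteTopology S := by
    rw [discreteTopology_subtype_iff]
    intro x hx
    have h1 : nhdsWithin x {x}ᶜ ⊓ Filter.principal s = ⊥ := by
      simpa [AccPt, Filter.neBot_iff] using hx.2
    exact le_bot_iff.1 (h1 ▸ inf_le_inf_left _ (Filter.principal_mono.2 (sep_subset _ _)))
  have hc : S.Countable := by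
    have : Countable S := TopologicalSpace.separableSpace_iff_countable.1 inferInstance
    exact this.to_set
  have h0 : volume S = 0 := hc.measure_zero volume
  filter_upwards [compl_mem_ae_iff.2 h0] with t ht hts
  by_contra h
  exact ht ⟨hts, h⟩

theorem abs_deriv_le_of_abs_sub_le {p w : ℝ → ℝ} {t : ℝ} (hp : DifferentiableAt ℝ p t)
    (hw : DifferentiableAt ℝ w t) (h : ∀ᶠ s in nhds t, |p s - p t| ≤ |w s - w t|) :
    |deriv p t| ≤ |deriv w t| := by
  have h1 := (hasDerivAt_iff_tendsto_slope.1 hp.hasDerivAt).abs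
  have h2 := (hasDerivAt_iff_tendsto_slope.1 hw.hasDerivAt).abs
  refine le_of_tendsto_of_tendsto h1 h2 ?_
  filter_upwards [nhdsWithin_le_nhds h] with s hs
  rw [slope_def_field, slope_def_field, abs_div, abs_div]
  exact div_le_div_of_nonneg_right hs (abs_nonneg _)

theorem LipschitzWith.abs_sub_le_of_abs_deriv_le {p w : ℝ → ℝ} {K K' : ℝ≥0}
    (hp : LipschitzWith K p) (hw : LipschitzWith K' w) {a b : ℝ} (hab : a ≤ b)
    (h : ∀ᵐ t, t ∈ Icc a b → |deriv p t| ≤ deriv w t) : |p b - p a| ≤ w b - w a := by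
  have hp' : AbsolutelyContinuousOnInterval p a b :=
    (hp.lipschitzOnWith (s := uIcc a b)).absolutelyContinuousOnInterval
  have hw' : AbsolutelyContinuousOnInterval w a b :=
    (hw.lipschitzOnWith (s := uIcc a b)).absolutelyContinuousOnInterval
  rw [← hp'.integral_deriv_eq_sub, ← hw'.integral_deriv_eq_sub]
  refine intervalIntegral.norm_integral_le_of_norm_le (f := deriv p) (g := deriv w) hab ?_
    hw'.intervalIntegrable_deriv
  filter_upwards [h] with t ht hts using ht (Ioc_subset_Icc_self hts)

/-- Along a curve running through a Lipschitz chart, the derivatives of the functions inducing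
the metric are computed by the metric derivative of the chart. -/
theorem ae_abs_deriv_le_of_mem_image {n : ℕ} {ι κ X : Type*} [MetricSpace X] [Countable ι]
    [Nonempty ι] {L : ℝ≥0} {Φ : ι → EuclideanSpace ℝ (Fin n) → ℝ}
    (hΦ : ∀ k, LipschitzWith L (Φ k)) (τ : κ → ι) {G : Set (EuclideanSpace ℝ (Fin n))}
    {g : EuclideanSpace ℝ (Fin n) → X} {φ : ι → X → ℝ} (hφ : ∀ k, LipschitzWith 1 (φ k))
    (hΦφ : ∀ x ∈ G, ∀ k, Φ k x = φ k (g x))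
    (hG : ∀ x ∈ G, (∀ k, DifferentiableAt ℝ (Φ k) x) ∧
      (∃ c > 0, ∀ v, c * ‖v‖ ≤ supDeriv hΦ x v) ∧
      ∀ v, supDeriv hΦ x v ≤ supDeriv (fun k => hΦ (τ k)) x v)
    {c : ℝ → X} (hc : LipschitzWith 1 c) :
    ∀ᵐ t, c t ∈ g '' G → ∀ a, 0 ≤ a → (∀ j, |deriv (fun s => φ (τ j) (c s)) t| ≤ a) →
      ∀ k, |deriv (fun s => φ k (c s)) t| ≤ a := by
  obtain ⟨T, hTc, hTcov, hT⟩ := exists_countable_cover_le_abs_sub hΦ (S := G)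
    (fun x hx => ⟨(hG x hx).1, (hG x hx).2.1⟩) (β := 1 / 2) (by norm_num) (by norm_num)
  have hφc : ∀ k, LipschitzWith 1 (fun s => φ k (c s)) := fun k => by
    simpa [Function.comp_def] using (hφ k).comp hc
  suffices H : ∀ S ∈ T, ∀ᵐ t, c t ∈ g '' S → ∀ a, 0 ≤ a →
      (∀ j, |deriv (fun s => φ (τ j) (c s)) t| ≤ a) → ∀ k, |deriv (fun s => φ k (c s)) t| ≤ a by
    filter_upwards [(ae_ball_iff hTc).2 H] with t ht hct
    obtain ⟨x, hx, hxt⟩ := hct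
    obtain ⟨S, hS, hxS⟩ := hTcov hx
    exact ht S hS ⟨x, hxS, hxt⟩
  intro S hS
  obtain ⟨hSG, hSN⟩ := hT S hS
  rcases S.eq_empty_or_nonempty with rfl | ⟨x₀, hx₀⟩
  · simp
  obtain ⟨c₀, hc₀, hN⟩ := (hG x₀ (hSG hx₀)).2.1
  -- At the times in `s` the curve is lifted to the chart by selecting preimages. Since the chart
  -- expands a norm on `S`, the lift is Lipschitz on `s`.
  set s : Set ℝ := {t | c t ∈ g '' S} with hs
  have hsel : ∀ t, ∃ x, t ∈ s → x ∈ S ∧ g x = c t := fun t => by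
    by_cases ht : t ∈ s
    · obtain ⟨x, hx⟩ := ht
      exact ⟨x, fun _ => hx⟩
    · exact ⟨x₀, fun h => absurd h ht⟩
  choose p hp using hsel
  have hplip : LipschitzOnWith (Real.toNNReal (2 / c₀)) p s := by
    refine LipschitzOnWith.of_dist_le_mul fun t ht u hu => ?_
    rw [Real.coe_toNNReal _ (by positivity)]
    obtain ⟨k, hk⟩ := hSN x₀ hx₀ (p u) (hp u hu).1 (p t) (hp t ht).1
    have h1 : |Φ k (p t) - Φ k (p u)| ≤ dist t u := by
      rw [hΦφ _ (hSG (hp t ht).1), hΦφ _ (hSG (hp u hu).1), (hp t ht).2, (hp u hu).2]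
      simpa [Real.dist_eq] using (hφc k).dist_le_mul t u
    have h2 := hN (p t - p u)
    rw [dist_eq_norm (p t), div_mul_eq_mul_div, le_div_iff₀ hc₀]
    linarith
  -- The extension is differentiable almost everywhere, although it represents the curve only at the
  -- times in `s`.
  obtain ⟨q, hq, hqp⟩ := hplip.extend_finite_dimension
  have hφd : ∀ᵐ t : ℝ, ∀ k, DifferentiableAt ℝ (fun s => φ k (c s)) t :=
    ae_all_iff.2 fun k => (hφc k).ae_differentiableAt_real
  filter_upwards [ae_accPt_of_mem s, hq.ae_differentiableAt_real, hφd] with t hacc hqd hφt hts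
    a ha hj
  have hpt : p t ∈ G := hSG (hp t hts).1
  have hqt : q t = p t := (hqp hts).symm
  -- The chain rule holds within `s`, and `t` is an accumulation point of `s`, so both sides are
  -- derivatives of the same function within `s`.
  have hder : ∀ k, deriv (fun s => φ k (c s)) t = fderiv ℝ (Φ k) (p t) (deriv q t) := by
    intro k
    have h1 : HasDerivWithinAt (fun s => φ k (c s)) (deriv (fun s => φ k (c s)) t) s t :=
      (hφt k).hasDerivAt.hasDerivWithinAt
    have hd : HasFDerivAt (Φ k) (fderiv ℝ (Φ k) (p t)) (q t) := by
      rw [hqt]; exact ((hG _ hpt).1 k).hasFDerivAt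
    have h2 : HasDerivWithinAt (fun s => Φ k (q s)) (fderiv ℝ (Φ k) (p t) (deriv q t)) s t :=
      (hd.comp_hasDerivAt t hqd.hasDerivAt).hasDerivWithinAt
    have heq : ∀ u ∈ s, Φ k (q u) = φ k (c u) := fun u hu => by
      rw [← hqp hu, hΦφ _ (hSG (hp u hu).1), (hp u hu).2]
    exact (hacc hts).uniqueDiffWithinAt.eq_deriv _ h1
      (h2.congr (fun u hu => (heq u hu).symm) (heq t hts).symm)
  intro k
  rw [hder]
  refine (abs_fderiv_le_supDeriv hΦ _ _ k).trans (((hG _ hpt).2.2 _).trans ?_)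
  refine supDeriv_le _ ha fun j => ?_
  rw [← hder]
  exact hj j

/-- The Fréchet embedding: taking `x_k` close to `x` recovers the distance from the differences. -/
theorem dist_le_of_forall_abs_dist_denseSeq_sub_le {X : Type*} [MetricSpace X]
    [TopologicalSpace.SeparableSpace X] [Nonempty X] {x y : X} {a : ℝ}
    (h : ∀ k, |dist y (TopologicalSpace.denseSeq X k) - dist x (TopologicalSpace.denseSeq X k)|
      ≤ a) : dist x y ≤ a := by
  refine le_of_forall_pos_le_add fun ε hε => ?_
  obtain ⟨k, hk⟩ := (TopologicalSpace.denseRange_denseSeq X).exists_dist_lt x (half_pos hε)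
  have h1 := (abs_le.1 (h k)).2
  have h2 := dist_triangle_right x y (TopologicalSpace.denseSeq X k)
  linarith

/-- Let `w` be the variation of `f ∘ c`. The functions `φ (τ j)` factor through `f` without
expansion, so their derivatives along `c` are at most `w'`. The hypothesis extends this bound to all
`φ k`, which recover the distance of `X`; integrating gives the claim. -/
theorem dist_le_eVariationOn_of_ae_abs_deriv_le {ι κ X Y : Type*} [Countable ι] [MetricSpace X]
    [MetricSpace Y] {f : X → Y} (hf : LipschitzWith 1 f) {φ : ι → X → ℝ}
    (hφ : ∀ k, LipschitzWith 1 (φ k)) (τ : κ → ι)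
    (hφf : ∀ j x y, |φ (τ j) x - φ (τ j) y| ≤ dist (f x) (f y))
    (hφX : ∀ x y : X, ∀ a, (∀ k, |φ k y - φ k x| ≤ a) → dist x y ≤ a)
    {c : ℝ → X} (hc : LipschitzWith 1 c) {a b : ℝ} (hab : a ≤ b)
    (h : ∀ᵐ t, t ∈ Icc a b → ∀ r, 0 ≤ r → (∀ j, |deriv (fun s => φ (τ j) (c s)) t| ≤ r) →
      ∀ k, |deriv (fun s => φ k (c s)) t| ≤ r) :
    edist (c a) (c b) ≤ eVariationOn (f ∘ c) (Icc a b) := by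
  have hfc : LipschitzWith 1 (f ∘ c) := by simpa using hf.comp hc
  have hbv : LocallyBoundedVariationOn (f ∘ c) univ := hfc.locallyBoundedVariationOn univ
  have hφc : ∀ k, LipschitzWith 1 (fun s => φ k (c s)) := fun k => by
    simpa [Function.comp_def] using (hφ k).comp hc
  set w : ℝ → ℝ := variationOnFromTo (f ∘ c) univ a with hw
  have hwmono : Monotone w := fun s t hst =>
    variationOnFromTo.monotoneOn hbv (mem_univ a) (mem_univ s) (mem_univ t) hst
  have hwsub : ∀ s t, s ≤ t → w t - w s = (eVariationOn (f ∘ c) (Icc s t)).toReal := by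
    intro s t hst
    rw [hw, variationOnFromTo.sub_right hbv (mem_univ a) (mem_univ t) (mem_univ s),
      variationOnFromTo.eq_of_le _ _ hst, univ_inter]
  have hfin : ∀ s t, eVariationOn (f ∘ c) (Icc s t) ≠ ∞ := fun s t => by
    simpa [BoundedVariationOn] using hbv s t (mem_univ s) (mem_univ t)
  have hwd : ∀ s t, dist (f (c s)) (f (c t)) ≤ |w s - w t| := by
    intro s t
    wlog hst : s ≤ t generalizing s t
    · rw [dist_comm, abs_sub_comm]
      exact this t s (le_of_not_ge hst)
    rw [abs_sub_comm, abs_of_nonneg (sub_nonneg.2 (hwmono hst)), hwsub s t hst, dist_edist]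
    exact ENNReal.toReal_mono (hfin s t)
      (eVariationOn.edist_le (f ∘ c) (left_mem_Icc.2 hst) (right_mem_Icc.2 hst))
  have hwlip : LipschitzWith 1 w := by
    refine LipschitzWith.of_dist_le_mul fun s t => ?_
    rw [NNReal.coe_one, one_mul]
    wlog hst : s ≤ t generalizing s t
    · rw [dist_comm, dist_comm s]
      exact this t s (le_of_not_ge hst)
    rw [dist_comm, Real.dist_eq, abs_of_nonneg (sub_nonneg.2 (hwmono hst)), hwsub s t hst,
      dist_comm, Real.dist_eq, abs_of_nonneg (sub_nonneg.2 hst)]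
    refine ENNReal.toReal_le_of_le_ofReal (sub_nonneg.2 hst) ?_
    have := (hfc.lipschitzOnWith (s := univ)).comp_eVariationOn_le (g := id) (s := Icc s t)
      (mapsTo_univ _ _)
    rw [eVariationOn_id_Icc] at this
    simpa using this
  have key : dist (c a) (c b) ≤ w b - w a := by
    refine hφX _ _ _ fun k => ?_
    refine (hφc k).abs_sub_le_of_abs_deriv_le hwlip hab ?_
    filter_upwards [h, hwlip.ae_differentiableAt_real,
      (ae_all_iff (ι := ι)).2 fun k => (hφc k).ae_differentiableAt_real] with t ht hwt hφt hts
    refine ht hts _ hwmono.deriv_nonneg (fun j => ?_) k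
    rw [← abs_of_nonneg (hwmono.deriv_nonneg (x := t))]
    exact abs_deriv_le_of_abs_sub_le (hφt _) hwt
      (Filter.Eventually.of_forall fun s => (hφf j _ _).trans (hwd s t))
  rw [hwsub a b hab] at key
  rw [edist_dist]
  exact ENNReal.ofReal_le_of_le_toReal key

theorem euclideanHausdorffMeasure_apply_eq_zero_iff {X : Type*} [MetricSpace X]
    [MeasurableSpace X] [BorelSpace X] (n : ℕ) (S : Set X) :
    (μHE[n] : Measure X) S = 0 ↔ (μH[(n : ℝ)] : Measure X) S = 0 := by
  rw [Measure.euclideanHausdorffMeasure_def, Measure.smul_apply, ENNReal.smul_def, smul_eq_mul,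
    mul_eq_zero, or_iff_right]
  exact_mod_cast Measure.addHaarScalarFactor_volume_hausdorffMeasure_ne_zero n

theorem hausdorffMeasure_image_eq_of_map_eq {X Y : Type*} [MetricSpace X]
    [MeasurableSpace X] [BorelSpace X] [MetricSpace Y] [MeasurableSpace Y] [BorelSpace Y] {n : ℕ}
    (f : X ≃ₜ Y) (h : Measure.map f (μHE[n] : Measure X) = μHE[n]) (S : Set X) :
    (μH[(n : ℝ)] : Measure Y) (f '' S) = (μH[(n : ℝ)] : Measure X) S := by
  have h1 : (μHE[n] : Measure Y) (f '' S) = (μHE[n] : Measure X) S := by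
    rw [← h, ← Homeomorph.toMeasurableEquiv_coe, MeasurableEquiv.map_apply,
      Homeomorph.toMeasurableEquiv_coe, preimage_image_eq _ f.injective]
  rw [Measure.euclideanHausdorffMeasure_def, Measure.euclideanHausdorffMeasure_def,
    Measure.smul_apply, Measure.smul_apply, ENNReal.smul_def, smul_eq_mul, ENNReal.smul_def,
    smul_eq_mul] at h1
  refine (ENNReal.mul_right_inj ?_ ENNReal.coe_ne_top).1 h1
  exact_mod_cast Measure.addHaarScalarFactor_volume_hausdorffMeasure_ne_zero n

/-- The functions `d(·, x_k)` and `d(f ·, y_k)` for dense sequences `x_k` and `y_k`. -/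
noncomputable def denseDist {X Y : Type*} [MetricSpace X] [MetricSpace Y]
    [TopologicalSpace.SeparableSpace X] [TopologicalSpace.SeparableSpace Y] [Nonempty X]
    [Nonempty Y] (f : X → Y) : ℕ ⊕ ℕ → X → ℝ :=
  Sum.elim (fun k x => dist x (TopologicalSpace.denseSeq X k))
    (fun k x => dist (f x) (TopologicalSpace.denseSeq Y k))

section DenseDist

variable {X Y : Type*} [MetricSpace X] [MetricSpace Y] [TopologicalSpace.SeparableSpace X]
  [TopologicalSpace.SeparableSpace Y] [Nonempty X] [Nonempty Y] {f : X → Y}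

theorem abs_denseDist_inr_sub_le (j : ℕ) (x y : X) :
    |denseDist f (Sum.inr j) x - denseDist f (Sum.inr j) y| ≤ dist (f x) (f y) :=
  abs_dist_sub_le _ _ _

theorem lipschitzWith_denseDist (hf : LipschitzWith 1 f) (k : ℕ ⊕ ℕ) :
    LipschitzWith 1 (denseDist f k) := by
  refine LipschitzWith.of_dist_le_mul fun x y => ?_
  rw [NNReal.coe_one, one_mul, Real.dist_eq]
  rcases k with k | k
  · exact abs_dist_sub_le _ _ _
  · exact (abs_denseDist_inr_sub_le k x y).trans (by simpa using hf.dist_le_mul x y)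

theorem dist_le_of_abs_denseDist_sub_le (x y : X) (a : ℝ)
    (h : ∀ k, |denseDist f k y - denseDist f k x| ≤ a) : dist x y ≤ a :=
  dist_le_of_forall_abs_dist_denseSeq_sub_le fun k => h (Sum.inl k)

theorem dist_map_le_of_abs_denseDist_sub_le (x y : X) (a : ℝ)
    (h : ∀ k, |denseDist f (Sum.inr k) y - denseDist f (Sum.inr k) x| ≤ a) :
    dist (f x) (f y) ≤ a :=
  dist_le_of_forall_abs_dist_denseSeq_sub_le h

end DenseDist

/-! ### Maps of rectifiable spaces that preserve volume -/

section Rectifiable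

variable {X Y : Type*} [MetricSpace X] [MeasurableSpace X] [BorelSpace X]
    [MetricSpace Y] [MeasurableSpace Y] [BorelSpace Y] [TopologicalSpace.SeparableSpace X]
    [TopologicalSpace.SeparableSpace Y] [Nonempty X] [Nonempty Y]

/-- The functions `denseDist f k ∘ g` extend from `A` to Lipschitz functions on `ℝⁿ`. The comparison
of metric derivatives for `g` and `f ∘ g` then yields the good set `G`, on which derivatives along
curves can be computed in the chart. -/
theorem exists_subset_ae_abs_deriv_denseDist_le {n : ℕ} {f : X → Y} (hf : LipschitzWith 1 f)
    (hvol : ∀ S : Set X, (μH[(n : ℝ)] : Measure X) S ≤ (μH[(n : ℝ)] : Measure Y) (f '' S))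
    {A : Set (EuclideanSpace ℝ (Fin n))} {g : EuclideanSpace ℝ (Fin n) → X} {C : ℝ≥0}
    (hg : LipschitzOnWith C g A) :
    ∃ G ⊆ A, (μH[(n : ℝ)] : Measure X) (g '' (A \ G)) = 0 ∧ ∀ c : ℝ → X, LipschitzWith 1 c →
      ∀ᵐ t, c t ∈ g '' G → ∀ a, 0 ≤ a →
        (∀ j, |deriv (fun s => denseDist f (Sum.inr j) (c s)) t| ≤ a) →
          ∀ k, |deriv (fun s => denseDist f k (c s)) t| ≤ a := by
  have hex : ∀ k, ∃ Φ : EuclideanSpace ℝ (Fin n) → ℝ, LipschitzWith C Φ ∧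
      EqOn (denseDist f k ∘ g) Φ A := fun k => by
    have := ((lipschitzWith_denseDist hf k).comp_lipschitzOnWith hg).extend_real
    simpa using this
  choose Φ hΦ hΦg using hex
  have hsub : ∀ y ∈ A, ∀ z ∈ A, ∀ k, |Φ k z - Φ k y| =
      |denseDist f k (g z) - denseDist f k (g y)| := fun y hy z hz k => by
    rw [← hΦg k hy, ← hΦg k hz]; rfl
  have key := hausdorffMeasure_image_setOf_not_supDeriv_le hΦ Sum.inr (A := A) (g := g)
    (g' := f ∘ g) hg (by simpa using hf.comp_lipschitzOnWith hg) ?_ ?_ ?_ ?_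
  · refine ⟨_, sep_subset A (fun x => (∀ k, DifferentiableAt ℝ (Φ k) x) ∧
      (∃ c > 0, ∀ v, c * ‖v‖ ≤ supDeriv hΦ x v) ∧
      ∀ v, supDeriv hΦ x v ≤ supDeriv (fun k => hΦ (Sum.inr k)) x v), ?_, fun c hc => ?_⟩
    · convert key using 3
      ext x
      simp only [mem_sdiff, mem_ofPred_eq]
      exact and_congr_right fun h => not_congr (and_iff_right h)
    · exact ae_abs_deriv_le_of_mem_image hΦ Sum.inr (lipschitzWith_denseDist hf)
        (fun x hx k => (hΦg k hx.1).symm) (fun x hx => hx.2) hc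
  · intro y hy z hz k
    rw [hsub y hy z hz, dist_comm]
    simpa [Real.dist_eq] using (lipschitzWith_denseDist hf k).dist_le_mul (g z) (g y)
  · intro y hy z hz a _ h
    exact dist_le_of_abs_denseDist_sub_le (f := f) _ _ a fun k => by
      rw [← hsub y hy z hz]; exact h k
  · intro y hy z hz a _ h
    exact dist_map_le_of_abs_denseDist_sub_le (f := f) _ _ a fun k => by
      rw [← hsub y hy z hz]; exact h k
  · intro S _
    rw [image_comp]
    exact hvol _

/-- If `f` is `1`-Lipschitz and volume preserving on a rectifiable space, then it does not shorten
curves which avoid a certain null set at almost every time. -/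
theorem exists_null_forall_edist_le_eVariationOn {n : ℕ} (hX : IsRectifiableSpace n X) (f : X ≃ₜ Y)
    (hf : LipschitzWith 1 f) (hvol : Measure.map f (μHE[n] : Measure X) = μHE[n]) :
    ∃ N : Set X, MeasurableSet N ∧ (μHE[n] : Measure X) N = 0 ∧
      ∀ c : ℝ → X, LipschitzWith 1 c → ∀ a b, a ≤ b → (∀ᵐ t, t ∈ Icc a b → c t ∉ N) →
        edist (c a) (c b) ≤ eVariationOn (f ∘ c) (Icc a b) := by
  classical
  obtain ⟨E, g, L, -, hg, hnull⟩ := hX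
  set g' : ℕ → EuclideanSpace ℝ (Fin n) → X := fun i x =>
    if h : x ∈ E i then g i ⟨x, h⟩ else Classical.arbitrary X with hg'
  have hgg' : ∀ i (x : E i), g' i x = g i x := fun i x => by simp [hg']
  have hlip : ∀ i, LipschitzOnWith (L i) (g' i) (E i) := fun i => by
    rw [lipschitzOnWith_iff_restrict]
    convert hg i using 1
    ext x
    exact hgg' i x
  choose G hGE hG0 hG using fun i => exists_subset_ae_abs_deriv_denseDist_le hf
    (fun S => (hausdorffMeasure_image_eq_of_map_eq f hvol S).ge) (hlip i)
  -- The points outside all charts and the images of the bad parts of the charts; `N` is a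
  -- measurable null superset.
  set N₀ : Set X := (⋃ i, range (g i))ᶜ ∪ ⋃ i, g' i '' (E i \ G i) with hN₀
  have hN₀0 : (μHE[n] : Measure X) N₀ = 0 := measure_union_null hnull
    (measure_iUnion_null fun i => (euclideanHausdorffMeasure_apply_eq_zero_iff n _).2 (hG0 i))
  refine ⟨toMeasurable μHE[n] N₀, measurableSet_toMeasurable _ _, by rwa [measure_toMeasurable],
    fun c hc a b hab hct => ?_⟩
  refine dist_le_eVariationOn_of_ae_abs_deriv_le hf (lipschitzWith_denseDist hf) Sum.inr
    abs_denseDist_inr_sub_le dist_le_of_abs_denseDist_sub_le hc hab ?_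
  filter_upwards [hct, ae_all_iff.2 fun i => hG i c hc] with t ht hGt hts
  have h1 : c t ∉ N₀ := fun h => ht hts (subset_toMeasurable _ _ h)
  simp only [hN₀, mem_union, mem_compl_iff, not_or, not_not] at h1
  obtain ⟨i, ⟨x, hx⟩, hxt⟩ := mem_iUnion.1 h1.1
  have hxG : x ∈ G i := by
    by_contra h
    exact h1.2 (mem_iUnion.2 ⟨i, x, ⟨hx, h⟩, by rw [hgg' i ⟨x, hx⟩, hxt]⟩)
  exact hGt i ⟨x, hxG, by rw [hgg' i ⟨x, hx⟩, hxt]⟩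

end Rectifiable

/-! ### Arc length parametrization, line integrals and subcurves -/

section Curves

variable {X : Type*} [MetricSpace X] {γ : C(I, X)}

theorem locallyBoundedVariationOn_of_curveLength_ne_top (hγ : curveLength γ ≠ ∞) :
    LocallyBoundedVariationOn γ univ :=
  BoundedVariationOn.locallyBoundedVariationOn hγ

theorem variationOnFromTo_zero_one : variationOnFromTo γ univ 0 1 = (curveLength γ).toReal := by
  rw [variationOnFromTo.eq_of_le _ _ zero_le_one, curveLength, univ_inter]
  congr 2
  exact eq_univ_of_forall fun t => ⟨unitInterval.nonneg', unitInterval.le_one'⟩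

theorem continuous_variationOnFromTo (hγ : curveLength γ ≠ ∞) :
    Continuous (variationOnFromTo γ univ 0) := by
  have hbv := locallyBoundedVariationOn_of_curveLength_ne_top hγ
  rw [continuous_iff_continuousAt]
  intro t
  rw [continuousAt_iff_continuous_left'_right']
  constructor
  · have := variationOnFromTo.tendsto_left (s := univ) (f := γ) (l := γ t) (mem_univ 0)
      (mem_univ t) hbv (γ.continuous.continuousAt.mono_left nhdsWithin_le_nhds)
    simpa [ContinuousWithinAt] using this
  · have := variationOnFromTo.tendsto_right (s := univ) (f := γ) (l := γ t) (mem_univ 0)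
      (mem_univ t) hbv (γ.continuous.continuousAt.mono_left nhdsWithin_le_nhds)
    simpa [ContinuousWithinAt] using this

theorem image_variationOnFromTo (hγ : curveLength γ ≠ ∞) :
    variationOnFromTo γ univ 0 '' univ = Icc 0 (curveLength γ).toReal := by
  have hbv := locallyBoundedVariationOn_of_curveLength_ne_top hγ
  refine Subset.antisymm ?_ ?_
  · rintro _ ⟨t, -, rfl⟩
    refine ⟨variationOnFromTo.nonneg_of_le _ _ t.2.1, ?_⟩
    rw [← variationOnFromTo_zero_one]
    exact variationOnFromTo.monotoneOn hbv (mem_univ 0) (mem_univ t) (mem_univ 1) t.2.2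
  · have h := intermediate_value_univ (0 : I) 1 (continuous_variationOnFromTo hγ)
    rw [variationOnFromTo.self, variationOnFromTo_zero_one] at h
    rwa [image_univ]

theorem naturalParameterization_variationOnFromTo (hγ : curveLength γ ≠ ∞) (t : I) :
    naturalParameterization γ univ 0 (variationOnFromTo γ univ 0 t) = γ t :=
  edist_eq_zero.1 (edist_naturalParameterization_eq_zero
    (locallyBoundedVariationOn_of_curveLength_ne_top hγ) (mem_univ 0) (mem_univ t))

theorem naturalParameterization_zero (hγ : curveLength γ ≠ ∞) :
    naturalParameterization γ univ 0 0 = γ 0 := by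
  have := naturalParameterization_variationOnFromTo hγ 0
  rwa [variationOnFromTo.self] at this

theorem naturalParameterization_curveLength (hγ : curveLength γ ≠ ∞) :
    naturalParameterization γ univ 0 (curveLength γ).toReal = γ 1 := by
  have := naturalParameterization_variationOnFromTo hγ 1
  rwa [variationOnFromTo_zero_one] at this

theorem hasUnitSpeedOn_naturalParameterization (hγ : curveLength γ ≠ ∞) :
    HasUnitSpeedOn (naturalParameterization γ univ 0) (Icc 0 (curveLength γ).toReal) := by
  rw [← image_variationOnFromTo hγ]
  exact has_unit_speed_naturalParameterization _
    (locallyBoundedVariationOn_of_curveLength_ne_top hγ) (mem_univ 0)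

theorem HasUnitSpeedOn.eVariationOn_Icc {c : ℝ → X} {a b : ℝ} (hc : HasUnitSpeedOn c (Icc a b))
    {x y : ℝ} (hx : x ∈ Icc a b) (hy : y ∈ Icc a b) :
    eVariationOn c (Icc x y) = ENNReal.ofReal (y - x) := by
  have := hc hx hy
  rwa [inter_eq_right.2 (Icc_subset_Icc hx.1 hy.2), NNReal.coe_one, one_mul] at this

theorem HasUnitSpeedOn.lipschitzOnWith {c : ℝ → X} {a b : ℝ} (hc : HasUnitSpeedOn c (Icc a b)) :
    LipschitzOnWith 1 c (Icc a b) := by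
  intro x hx y hy
  rw [ENNReal.coe_one, one_mul]
  wlog hxy : x ≤ y generalizing x y
  · rw [edist_comm, edist_comm x]
    exact this hy hx (le_of_not_ge hxy)
  rw [edist_comm x, edist_dist y, Real.dist_eq, abs_of_nonneg (sub_nonneg.2 hxy),
    ← hc.eVariationOn_Icc hx hy]
  exact eVariationOn.edist_le c (left_mem_Icc.2 hxy) (right_mem_Icc.2 hxy)

theorem lineIntegral_of_curveLength_ne_top (hγ : curveLength γ ≠ ∞) (ρ : X → ℝ≥0∞) :
    lineIntegral ρ γ = ∫⁻ t in Icc (0 : ℝ) (curveLength γ).toReal,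
      ρ (naturalParameterization γ univ 0 t) := if_neg hγ

theorem lineIntegral_of_curveLength_eq_top (hγ : curveLength γ = ∞) (ρ : X → ℝ≥0∞) :
    lineIntegral ρ γ = ∞ := if_pos hγ

theorem lineIntegral_mono {ρ ρ' : X → ℝ≥0∞} (h : ∀ x, ρ x ≤ ρ' x) (γ : C(I, X)) :
    lineIntegral ρ γ ≤ lineIntegral ρ' γ := by
  by_cases hγ : curveLength γ = ∞
  · rw [lineIntegral_of_curveLength_eq_top hγ, lineIntegral_of_curveLength_eq_top hγ]
  · rw [lineIntegral_of_curveLength_ne_top hγ, lineIntegral_of_curveLength_ne_top hγ]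
    exact lintegral_mono fun t => h _

theorem lineIntegral_const_mul {C : ℝ≥0∞} (hC0 : C ≠ 0) (hC : C ≠ ∞) (ρ : X → ℝ≥0∞)
    (γ : C(I, X)) : lineIntegral (fun x => C * ρ x) γ = C * lineIntegral ρ γ := by
  by_cases hγ : curveLength γ = ∞
  · rw [lineIntegral_of_curveLength_eq_top hγ, lineIntegral_of_curveLength_eq_top hγ,
      ENNReal.mul_top hC0]
  · rw [lineIntegral_of_curveLength_ne_top hγ, lineIntegral_of_curveLength_ne_top hγ,
      lintegral_const_mul' _ _ hC]

/-- A unit speed curve is, after rescaling to `[0, 1]`, a curve whose line integrals are the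
integrals along the given parametrization. -/
theorem exists_curve_of_hasUnitSpeedOn {c : ℝ → X} {a b : ℝ} (hab : a ≤ b)
    (hc : HasUnitSpeedOn c (Icc a b)) :
    ∃ η : C(I, X), η 0 = c a ∧ η 1 = c b ∧ curveLength η ≠ ∞ ∧
      ∀ ρ : X → ℝ≥0∞, lineIntegral ρ η = ∫⁻ t in Icc a b, ρ (c t) := by
  have hmem : ∀ t : I, a + t * (b - a) ∈ Icc a b := fun t =>
    ⟨by nlinarith [t.2.1], by nlinarith [t.2.2]⟩
  have hcont : Continuous fun t : I => c (a + t * (b - a)) :=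
    hc.lipschitzOnWith.continuousOn.comp_continuous (by fun_prop) hmem
  set η : C(I, X) := ⟨fun t => c (a + t * (b - a)), hcont⟩ with hη
  have hφ : Monotone fun t : I => a + t * (b - a) := fun s t hst => by
    have : (s : ℝ) ≤ t := hst
    simp only
    nlinarith
  have hvar : ∀ s t : I, s ≤ t → eVariationOn η (Icc s t) = ENNReal.ofReal ((t - s) * (b - a)) := by
    intro s t hst
    have h1 := eVariationOn.comp_inter_Icc_eq_of_monotoneOn c (t := (univ : Set I))
      (fun t : I => a + t * (b - a)) (hφ.monotoneOn _) (mem_univ s) (mem_univ t)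
    rw [univ_inter] at h1
    have himg : (fun t : I => a + t * (b - a)) '' univ = Icc a b := by
      refine Subset.antisymm (by rintro _ ⟨t, -, rfl⟩; exact hmem t) ?_
      rw [image_univ]
      have := intermediate_value_univ (0 : I) 1 (f := fun t : I => a + t * (b - a)) (by fun_prop)
      simpa using this
    rw [himg, inter_eq_right.2 (Icc_subset_Icc (hmem s).1 (hmem t).2)] at h1
    rw [show (η : I → X) = c ∘ fun t : I => a + t * (b - a) from rfl, h1,
      hc.eVariationOn_Icc (hmem s) (hmem t)]
    congr 1
    ring
  have hlen : curveLength η = ENNReal.ofReal (b - a) := by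
    have := hvar 0 1 zero_le_one
    simp only [Icc.coe_one, Icc.coe_zero, sub_zero, one_mul] at this
    rw [← this, curveLength]
    congr 1
    exact (eq_univ_of_forall (s := Icc (0 : I) 1)
      fun t => ⟨unitInterval.nonneg', unitInterval.le_one'⟩).symm
  have hlen' : curveLength η ≠ ∞ := by rw [hlen]; exact ENNReal.ofReal_ne_top
  have hV : ∀ t : I, variationOnFromTo η univ 0 t = t * (b - a) := by
    intro t
    rw [variationOnFromTo.eq_of_le _ _ unitInterval.nonneg', univ_inter,
      hvar 0 t unitInterval.nonneg', ENNReal.toReal_ofReal]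
    · simp
    · exact mul_nonneg (by simpa using t.2.1) (sub_nonneg.2 hab)
  have hP : ∀ s ∈ Icc 0 (b - a), naturalParameterization η univ 0 s = c (a + s) := by
    intro s hs
    have : s ∈ variationOnFromTo η univ 0 '' univ := by
      rw [image_variationOnFromTo hlen', hlen, ENNReal.toReal_ofReal (sub_nonneg.2 hab)]
      exact hs
    obtain ⟨t, -, rfl⟩ := this
    rw [naturalParameterization_variationOnFromTo hlen', hV]
    rfl
  refine ⟨η, by simp [hη], by simp [hη], hlen', fun ρ => ?_⟩
  rw [lineIntegral_of_curveLength_ne_top hlen', hlen, ENNReal.toReal_ofReal (sub_nonneg.2 hab),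
    setLIntegral_congr_fun measurableSet_Icc (fun s hs => by rw [hP s hs])]
  have h := (measurePreserving_add_left (volume : Measure ℝ) a).setLIntegral_comp_preimage_emb
    (measurableEmbedding_addLeft a) (fun t => ρ (c t)) (Icc a b)
  rw [← h]
  simp

/-- Allows the upper gradient inequality to be used on every arc of a curve, and so to be localized
to derivatives. -/
theorem exists_subcurve (hγ : curveLength γ ≠ ∞) {a b : ℝ} (ha : 0 ≤ a) (hab : a ≤ b)
    (hb : b ≤ (curveLength γ).toReal) :
    ∃ η : C(I, X), η 0 = naturalParameterization γ univ 0 a ∧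
      η 1 = naturalParameterization γ univ 0 b ∧ curveLength η ≠ ∞ ∧
      ∀ ρ : X → ℝ≥0∞, lineIntegral ρ η =
        ∫⁻ t in Icc a b, ρ (naturalParameterization γ univ 0 t) := by
  refine exists_curve_of_hasUnitSpeedOn hab fun x hx y hy => ?_
  have hsub : Icc a b ⊆ Icc 0 (curveLength γ).toReal := Icc_subset_Icc ha hb
  rw [inter_eq_right.2 (Icc_subset_Icc hx.1 hy.2), NNReal.coe_one, one_mul]
  exact (hasUnitSpeedOn_naturalParameterization hγ).eVariationOn_Icc (hsub hx) (hsub hy)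

theorem lineIntegral_subcurve_le {η : C(I, X)} (hγ : curveLength γ ≠ ∞) {a b : ℝ} (ha : 0 ≤ a)
    (hb : b ≤ (curveLength γ).toReal) {ρ : X → ℝ≥0∞}
    (hη : lineIntegral ρ η = ∫⁻ t in Icc a b, ρ (naturalParameterization γ univ 0 t)) :
    lineIntegral ρ η ≤ lineIntegral ρ γ := by
  rw [hη, lineIntegral_of_curveLength_ne_top hγ]
  exact lintegral_mono_set (Icc_subset_Icc ha hb)

end Curves

/-- If increments of `h` are bounded by the integrals of each of two functions, then they are
bounded by the integral of their minimum. -/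
theorem edist_le_setLIntegral_min {h : ℝ → ℝ} {l : ℝ} (hl : 0 ≤ l) {G₁ G₂ : ℝ → ℝ≥0∞}
    (hG₁ : AEMeasurable G₁ (volume.restrict (Icc 0 l)))
    (hG₂ : AEMeasurable G₂ (volume.restrict (Icc 0 l)))
    (hi₁ : ∫⁻ t in Icc 0 l, G₁ t ≠ ∞) (hi₂ : ∫⁻ t in Icc 0 l, G₂ t ≠ ∞)
    (h₁ : ∀ a b, 0 ≤ a → a ≤ b → b ≤ l → edist (h a) (h b) ≤ ∫⁻ t in Icc a b, G₁ t)
    (h₂ : ∀ a b, 0 ≤ a → a ≤ b → b ≤ l → edist (h a) (h b) ≤ ∫⁻ t in Icc a b, G₂ t) :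
    edist (h 0) (h l) ≤ ∫⁻ t in Icc 0 l, min (G₁ t) (G₂ t) := by
  have huIcc : uIcc 0 l = Icc 0 l := uIcc_of_le hl
  have hint : ∀ G : ℝ → ℝ≥0∞, AEMeasurable G (volume.restrict (Icc 0 l)) →
      ∫⁻ t in Icc 0 l, G t ≠ ∞ → IntervalIntegrable (fun t => (G t).toReal) volume 0 l := by
    intro G hG hi
    rw [intervalIntegrable_iff_integrableOn_Icc_of_le hl]
    exact integrable_toReal_of_lintegral_ne_top hG hi
  have hconv : ∀ G : ℝ → ℝ≥0∞, AEMeasurable G (volume.restrict (Icc 0 l)) →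
      ∫⁻ t in Icc 0 l, G t ≠ ∞ → ∀ a b, 0 ≤ a → a ≤ b → b ≤ l →
        ENNReal.ofReal (∫ t in a..b, (G t).toReal) = ∫⁻ t in Icc a b, G t := by
    intro G hG hi a b ha hab hb
    have hsub : Icc a b ⊆ Icc 0 l := Icc_subset_Icc ha hb
    have hi' : ∫⁻ t in Icc a b, G t ≠ ∞ := ne_top_of_le_ne_top hi (lintegral_mono_set hsub)
    have hG' : AEMeasurable G (volume.restrict (Icc a b)) := hG.mono_set hsub
    rw [intervalIntegral.integral_of_le hab, ← integral_Icc_eq_integral_Ioc,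
      integral_toReal hG' (ae_lt_top' hG' hi'), ENNReal.ofReal_toReal hi']
  have hreal : ∀ G : ℝ → ℝ≥0∞, AEMeasurable G (volume.restrict (Icc 0 l)) →
      ∫⁻ t in Icc 0 l, G t ≠ ∞ →
      (∀ a b, 0 ≤ a → a ≤ b → b ≤ l → edist (h a) (h b) ≤ ∫⁻ t in Icc a b, G t) →
      ∀ a ∈ Icc 0 l, ∀ b ∈ Icc 0 l, |h b - h a| ≤
        |(∫ t in (0 : ℝ)..b, (G t).toReal) - ∫ t in (0 : ℝ)..a, (G t).toReal| := by
    intro G hG hi hh a ha b hb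
    wlog hab : a ≤ b generalizing a b
    · rw [abs_sub_comm, abs_sub_comm (∫ t in (0 : ℝ)..b, (G t).toReal)]
      exact this b hb a ha (le_of_not_ge hab)
    have hII : ∀ x ∈ Icc 0 l, IntervalIntegrable (fun t => (G t).toReal) volume 0 x :=
      fun x hx => (hint G hG hi).mono_set (by
        rw [huIcc, uIcc_of_le hx.1]; exact Icc_subset_Icc_right hx.2)
    rw [intervalIntegral.integral_interval_sub_left (hII b hb) (hII a ha)]
    have := hh a b ha.1 hab hb.2
    rw [← hconv G hG hi a b ha.1 hab hb.2, edist_comm, edist_dist] at this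
    refine le_trans ?_ (le_abs_self _)
    exact (ENNReal.ofReal_le_ofReal_iff (intervalIntegral.integral_nonneg hab
      fun t _ => ENNReal.toReal_nonneg)).1 this
  -- The increments of `h` are dominated by those of the integral of `G₁`. Hence `h` is the integral
  -- of its derivative, which is almost everywhere bounded by both `G₁` and `G₂`.
  have hac : AbsolutelyContinuousOnInterval h 0 l := by
    have hF := (hint G₁ hG₁ hi₁).absolutelyContinuousOnInterval_intervalIntegral
      (c := 0) left_mem_uIcc
    rw [absolutelyContinuousOnInterval_iff] at hF ⊢
    intro ε hε
    obtain ⟨δ, hδ, hE⟩ := hF ε hε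
    refine ⟨δ, hδ, fun E hE1 hE2 => lt_of_le_of_lt (Finset.sum_le_sum fun i hi => ?_)
      (hE E hE1 hE2)⟩
    have hm := hE1.1 i hi
    rw [huIcc] at hm
    rw [Real.dist_eq, Real.dist_eq]
    exact hreal G₁ hG₁ hi₁ h₁ _ hm.2 _ hm.1
  have hder : ∀ G : ℝ → ℝ≥0∞, AEMeasurable G (volume.restrict (Icc 0 l)) →
      ∫⁻ t in Icc 0 l, G t ≠ ∞ →
      (∀ a b, 0 ≤ a → a ≤ b → b ≤ l → edist (h a) (h b) ≤ ∫⁻ t in Icc a b, G t) →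
      ∀ᵐ t, t ∈ Ioo 0 l → |deriv h t| ≤ (G t).toReal := by
    intro G hG hi hh
    filter_upwards [hac.ae_differentiableAt, (hint G hG hi).ae_hasDerivAt_integral]
      with t ht htG hts
    have htI : t ∈ uIcc 0 l := by rw [huIcc]; exact Ioo_subset_Icc_self hts
    have hd := htG htI 0 left_mem_uIcc
    have key := abs_deriv_le_of_abs_sub_le (ht htI) hd.differentiableAt (by
      filter_upwards [Icc_mem_nhds hts.1 hts.2] with s hs
      exact hreal G hG hi hh t (Ioo_subset_Icc_self hts) s hs)
    rwa [hd.deriv, abs_of_nonneg ENNReal.toReal_nonneg] at key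
  have hmin : AEMeasurable (fun t => min (G₁ t) (G₂ t)) (volume.restrict (Icc 0 l)) := hG₁.min hG₂
  have himin : ∫⁻ t in Icc 0 l, min (G₁ t) (G₂ t) ≠ ∞ :=
    ne_top_of_le_ne_top hi₁ (lintegral_mono fun t => min_le_left _ _)
  rw [← hconv _ hmin himin 0 l le_rfl hl le_rfl, edist_comm, edist_dist]
  refine ENNReal.ofReal_le_ofReal ?_
  rw [Real.dist_eq, ← hac.integral_deriv_eq_sub]
  refine intervalIntegral.norm_integral_le_of_norm_le (f := deriv h) hl ?_
    (hint _ hmin himin)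
  have hne : ∀ᵐ t : ℝ, t ≠ l := by simp [ae_iff]
  have hfin : ∀ G : ℝ → ℝ≥0∞, AEMeasurable G (volume.restrict (Icc 0 l)) →
      ∫⁻ t in Icc 0 l, G t ≠ ∞ → ∀ᵐ t, t ∈ Icc 0 l → G t < ∞ := fun G hG hi =>
    (ae_restrict_iff' measurableSet_Icc).1 (ae_lt_top' hG hi)
  filter_upwards [hder G₁ hG₁ hi₁ h₁, hder G₂ hG₂ hi₂ h₂, hne, hfin G₁ hG₁ hi₁, hfin G₂ hG₂ hi₂]
    with t ht₁ ht₂ htl hf₁ hf₂ hts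
  have hts' : t ∈ Ioo 0 l := ⟨hts.1, lt_of_le_of_ne hts.2 htl⟩
  have htI : t ∈ Icc 0 l := Ioc_subset_Icc_self hts
  rw [ENNReal.toReal_min (hf₁ htI).ne (hf₂ htI).ne]
  exact le_min (ht₁ hts') (ht₂ hts')

/-! ### Modulus, weak upper gradients and existence of minimal ones -/

/-- The pointwise `ℓ^p` norm of the sequence dominates every member, and its energy is the sum of
the energies. -/
theorem exists_forall_le_of_tsum_lintegral_rpow_lt_top {X : Type*} [MeasurableSpace X]
    {p : ℝ} {μ : Measure X} (hp : 1 ≤ p) {τ : ℕ → X → ℝ≥0∞}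
    (hτ : ∀ k, Measurable (τ k)) (hsum : ∑' k, ∫⁻ x, τ k x ^ p ∂μ < ∞) :
    ∃ ρ : X → ℝ≥0∞, Measurable ρ ∧ ∫⁻ x, ρ x ^ p ∂μ < ∞ ∧ ∀ k x, τ k x ≤ ρ x := by
  have hp0 : 0 < p := by linarith
  refine ⟨fun x => (∑' k, τ k x ^ p) ^ (1 / p),
    (Measurable.tsum fun k => (hτ k).pow_const p).pow_const _, ?_, fun k x => ?_⟩
  · simp_rw [← ENNReal.rpow_mul, one_div, inv_mul_cancel₀ hp0.ne', ENNReal.rpow_one]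
    rwa [lintegral_tsum fun k => ((hτ k).pow_const p).aemeasurable]
  · rw [one_div, ENNReal.le_rpow_inv_iff hp0]
    exact ENNReal.le_tsum k

section WeakUpperGradients

variable {X : Type*} [MetricSpace X] [MeasurableSpace X] {p : ℝ} {μ : Measure X}

/-- Countably many `p`-integrable functions are integrable along every curve along which a suitable
`p`-integrable function is. -/
theorem exists_forall_lineIntegral_ne_top (hp : 1 ≤ p) {ρ : ℕ → X → ℝ≥0∞}
    (hρ : ∀ k, Measurable (ρ k)) (hfin : ∀ k, ∫⁻ x, ρ k x ^ p ∂μ < ∞) :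
    ∃ ρ' : X → ℝ≥0∞, Measurable ρ' ∧ ∫⁻ x, ρ' x ^ p ∂μ < ∞ ∧
      ∀ γ : C(I, X), lineIntegral ρ' γ ≠ ∞ → ∀ k, lineIntegral (ρ k) γ ≠ ∞ := by
  have hp0 : 0 < p := by linarith
  obtain ⟨δ, hδ, hsum⟩ := ENNReal.exists_pos_tsum_mul_lt_of_countable one_ne_zero
    (fun k => ∫⁻ x, ρ k x ^ p ∂μ) fun k => (hfin k).ne
  set c : ℕ → ℝ≥0∞ := fun k => (δ k : ℝ≥0∞) ^ (1 / p) with hc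
  have hcp : ∀ k, c k ^ p = δ k := fun k => by
    rw [hc, ← ENNReal.rpow_mul, one_div, inv_mul_cancel₀ hp0.ne', ENNReal.rpow_one]
  have hc0 : ∀ k, c k ≠ 0 := fun k =>
    (ENNReal.rpow_pos (ENNReal.coe_pos.2 (hδ k)) ENNReal.coe_ne_top).ne'
  have hct : ∀ k, c k ≠ ∞ := fun k =>
    ENNReal.rpow_ne_top_of_nonneg (by positivity) ENNReal.coe_ne_top
  obtain ⟨ρ', hm, hi, hle⟩ := exists_forall_le_of_tsum_lintegral_rpow_lt_top (μ := μ) hp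
    (τ := fun k x => c k * ρ k x) (fun k => (hρ k).const_mul _) (by
      refine lt_of_eq_of_lt (tsum_congr fun k => ?_) (hsum.trans ENNReal.one_lt_top)
      simp_rw [ENNReal.mul_rpow_of_nonneg _ _ hp0.le, hcp]
      rw [lintegral_const_mul _ ((hρ k).pow_const p), mul_comm])
  refine ⟨ρ', hm, hi, fun γ hγ k h => hγ ?_⟩
  have := lineIntegral_mono (hle k) γ
  rw [lineIntegral_const_mul (hc0 k) (hct k), h, ENNReal.mul_top (hc0 k)] at this
  exact top_le_iff.1 this

/-- Fuglede's criterion. Admissible functions `ρ k` of rapidly decreasing energy are combined so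
that `(k + 1) * ρ k` is dominated for every `k`. Conversely, arbitrarily small multiples of a
function with infinite line integrals are still admissible. -/
theorem curveModulus_eq_zero_iff (hp : 1 ≤ p) {Γ : Set C(I, X)} :
    curveModulus p μ Γ = 0 ↔ ∃ ρ : X → ℝ≥0∞, Measurable ρ ∧ ∫⁻ x, ρ x ^ p ∂μ < ∞ ∧
      ∀ γ ∈ Γ, lineIntegral ρ γ = ∞ := by
  have hp0 : 0 < p := by linarith
  constructor
  · intro h
    obtain ⟨δ, hδ, hsum⟩ := ENNReal.exists_pos_tsum_mul_lt_of_countable one_ne_zero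
      (fun k : ℕ => ((k : ℝ≥0∞) + 1) ^ p) fun k =>
        ENNReal.rpow_ne_top_of_nonneg hp0.le (by simp)
    have hex : ∀ k, ∃ ρ : X → ℝ≥0∞, (Measurable ρ ∧ ∀ γ ∈ Γ, 1 ≤ lineIntegral ρ γ) ∧
        ∫⁻ x, ρ x ^ p ∂μ < δ k := by
      intro k
      have hlt : curveModulus p μ Γ < δ k := by rw [h]; exact ENNReal.coe_pos.2 (hδ k)
      rw [curveModulus, iInf_lt_iff] at hlt
      obtain ⟨ρ, hρ⟩ := hlt
      rw [iInf_lt_iff] at hρ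
      obtain ⟨h1, h2⟩ := hρ
      exact ⟨ρ, h1, h2⟩
    choose ρ hadm hlt using hex
    obtain ⟨ρ', hm, hi, hle⟩ := exists_forall_le_of_tsum_lintegral_rpow_lt_top (μ := μ) hp
      (τ := fun k x => ((k : ℝ≥0∞) + 1) * ρ k x) (fun k => (hadm k).1.const_mul _) (by
        refine lt_of_le_of_lt (ENNReal.tsum_le_tsum fun k => ?_) (hsum.trans ENNReal.one_lt_top)
        simp_rw [ENNReal.mul_rpow_of_nonneg _ _ hp0.le]
        rw [lintegral_const_mul _ ((hadm k).1.pow_const p)]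
        exact mul_le_mul_right (hlt k).le _)
    refine ⟨ρ', hm, hi, fun γ hγ => ENNReal.eq_top_of_forall_nnreal_le fun r => ?_⟩
    obtain ⟨k, hk⟩ := exists_nat_ge r
    have hk' : (r : ℝ≥0∞) ≤ (k : ℝ≥0∞) + 1 :=
      le_trans (by exact_mod_cast hk) le_self_add
    refine le_trans ?_ (lineIntegral_mono (hle k) γ)
    rw [lineIntegral_const_mul (by simp) (by simp)]
    exact hk'.trans (le_mul_of_one_le_right' ((hadm k).2 γ hγ))
  · rintro ⟨ρ, hm, hi, hΓ⟩
    by_contra h0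
    obtain ⟨ε, hε, hlt⟩ := ENNReal.exists_nnreal_pos_mul_lt hi.ne h0
    have hc0 : (ε : ℝ≥0∞) ^ (1 / p) ≠ 0 :=
      (ENNReal.rpow_pos (ENNReal.coe_pos.2 hε) ENNReal.coe_ne_top).ne'
    have hct : (ε : ℝ≥0∞) ^ (1 / p) ≠ ∞ :=
      ENNReal.rpow_ne_top_of_nonneg (by positivity) ENNReal.coe_ne_top
    refine hlt.not_ge ?_
    refine (iInf₂_le (fun x => (ε : ℝ≥0∞) ^ (1 / p) * ρ x)
      ⟨hm.const_mul _, fun γ hγ => ?_⟩).trans ?_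
    · simp_rw [ENNReal.mul_rpow_of_nonneg _ _ hp0.le, ← ENNReal.rpow_mul, one_div,
        inv_mul_cancel₀ hp0.ne', ENNReal.rpow_one]
      rw [lintegral_const_mul _ (hm.pow_const p)]
    · rw [lineIntegral_const_mul hc0 hct, hΓ γ hγ, ENNReal.mul_top hc0]
      exact le_top

theorem isWeakUpperGradient_iff (hp : 1 ≤ p) {u : X → ℝ} {g : X → ℝ≥0∞} :
    IsWeakUpperGradient p μ u g ↔ Measurable g ∧ ∃ ρ : X → ℝ≥0∞, Measurable ρ ∧
      ∫⁻ x, ρ x ^ p ∂μ < ∞ ∧ ∀ γ : C(I, X), lineIntegral ρ γ ≠ ∞ →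
        edist (u (γ 1)) (u (γ 0)) ≤ lineIntegral g γ := by
  refine and_congr_right fun _ => ⟨?_, ?_⟩
  · rintro ⟨Γ, hΓ, h⟩
    obtain ⟨ρ, hm, hi, hρ⟩ := (curveModulus_eq_zero_iff hp).1 hΓ
    exact ⟨ρ, hm, hi, fun γ hγ => h γ fun hmem => hγ (hρ γ hmem)⟩
  · rintro ⟨ρ, hm, hi, h⟩
    exact ⟨{γ | lineIntegral ρ γ = ∞}, (curveModulus_eq_zero_iff hp).2 ⟨ρ, hm, hi, fun γ hγ => hγ⟩,
      fun γ hγ => h γ hγ⟩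

/-- Adding the function `ρ` that detects the exceptional curves makes the inequality trivial on
them. -/
theorem IsWeakUpperGradient.exists_isUpperGradient (hp : 1 ≤ p) {u : X → ℝ} {g : X → ℝ≥0∞}
    (hg : IsWeakUpperGradient p μ u g) (hgi : ∫⁻ x, g x ^ p ∂μ < ∞) :
    ∃ g' : X → ℝ≥0∞, IsUpperGradient u g' ∧ ∫⁻ x, g' x ^ p ∂μ < ∞ := by
  obtain ⟨hgm, ρ, hm, hi, h⟩ := (isWeakUpperGradient_iff hp).1 hg
  refine ⟨g + ρ, ⟨hgm.add hm, fun γ => ?_⟩,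
    ENNReal.lintegral_rpow_add_lt_top_of_lintegral_rpow_lt_top hgm.aemeasurable hgi hi hp⟩
  by_cases hγ : lineIntegral ρ γ = ∞
  · exact le_top.trans (hγ.symm.le.trans (lineIntegral_mono (fun x => le_add_self) γ))
  · exact (h γ hγ).trans (lineIntegral_mono (fun x => le_self_add) γ)

variable [BorelSpace X]

theorem aemeasurable_comp_naturalParameterization {γ : C(I, X)} (hγ : curveLength γ ≠ ∞)
    {ρ : X → ℝ≥0∞} (hρ : Measurable ρ) :
    AEMeasurable (fun t => ρ (naturalParameterization γ univ 0 t))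
      (volume.restrict (Icc 0 (curveLength γ).toReal)) :=
  hρ.comp_aemeasurable ((hasUnitSpeedOn_naturalParameterization hγ).lipschitzOnWith.continuousOn
    |>.aemeasurable measurableSet_Icc)

/-- Along a curve on which both gradients and both exceptional functions are integrable, the two
inequalities hold on every subcurve, and `edist_le_setLIntegral_min` applies. -/
theorem IsWeakUpperGradient.min (hp : 1 ≤ p) {u : X → ℝ} {g₁ g₂ : X → ℝ≥0∞}
    (hg₁ : IsWeakUpperGradient p μ u g₁) (hi₁ : ∫⁻ x, g₁ x ^ p ∂μ < ∞)
    (hg₂ : IsWeakUpperGradient p μ u g₂) (hi₂ : ∫⁻ x, g₂ x ^ p ∂μ < ∞) :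
    IsWeakUpperGradient p μ u fun x => min (g₁ x) (g₂ x) := by
  obtain ⟨hm₁, ρ₁, hρm₁, hρi₁, h₁⟩ := (isWeakUpperGradient_iff hp).1 hg₁
  obtain ⟨hm₂, ρ₂, hρm₂, hρi₂, h₂⟩ := (isWeakUpperGradient_iff hp).1 hg₂
  set F : ℕ → X → ℝ≥0∞ := fun k => if k = 0 then g₁ else if k = 1 then g₂ else
    if k = 2 then ρ₁ else ρ₂ with hF
  obtain ⟨ρ, hρm, hρi, hρ⟩ := exists_forall_lineIntegral_ne_top (μ := μ) hp (ρ := F)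
    (fun k => by simp only [hF]; split_ifs <;> assumption)
    (fun k => by simp only [hF]; split_ifs <;> assumption)
  refine (isWeakUpperGradient_iff hp).2 ⟨hm₁.min hm₂, ρ, hρm, hρi, fun γ hγ => ?_⟩
  have hlen : curveLength γ ≠ ∞ := fun h => hγ (lineIntegral_of_curveLength_eq_top h _)
  have hg₁γ : lineIntegral g₁ γ ≠ ∞ := hρ γ hγ 0
  have hg₂γ : lineIntegral g₂ γ ≠ ∞ := hρ γ hγ 1
  have hρ₁γ : lineIntegral ρ₁ γ ≠ ∞ := hρ γ hγ 2
  have hρ₂γ : lineIntegral ρ₂ γ ≠ ∞ := hρ γ hγ 3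
  have hsub : ∀ g ρ : X → ℝ≥0∞, lineIntegral ρ γ ≠ ∞ → (∀ γ : C(I, X), lineIntegral ρ γ ≠ ∞ →
      edist (u (γ 1)) (u (γ 0)) ≤ lineIntegral g γ) → ∀ a b, 0 ≤ a → a ≤ b →
      b ≤ (curveLength γ).toReal → edist (u (naturalParameterization γ univ 0 a))
        (u (naturalParameterization γ univ 0 b)) ≤
          ∫⁻ t in Icc a b, g (naturalParameterization γ univ 0 t) := by
    intro g ρ hργ h a b ha hab hb
    obtain ⟨η, h0, h1, -, hη⟩ := exists_subcurve hlen ha hab hb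
    rw [← hη, ← h0, ← h1, edist_comm]
    exact h η (ne_top_of_le_ne_top hργ (lineIntegral_subcurve_le hlen ha hb (hη ρ)))
  have key := edist_le_setLIntegral_min (h := fun t => u (naturalParameterization γ univ 0 t))
    (l := (curveLength γ).toReal) ENNReal.toReal_nonneg
    (aemeasurable_comp_naturalParameterization hlen hm₁)
    (aemeasurable_comp_naturalParameterization hlen hm₂)
    (by rwa [← lineIntegral_of_curveLength_ne_top hlen])
    (by rwa [← lineIntegral_of_curveLength_ne_top hlen])
    (hsub g₁ ρ₁ hρ₁γ h₁) (hsub g₂ ρ₂ hρ₂γ h₂)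
  rw [naturalParameterization_zero hlen, naturalParameterization_curveLength hlen,
    edist_comm] at key
  rwa [lineIntegral_of_curveLength_ne_top hlen]

theorem isWeakUpperGradient_iInf_of_antitone (hp : 1 ≤ p) {u : X → ℝ} {g : ℕ → X → ℝ≥0∞}
    (hanti : Antitone g) (hg : ∀ k, IsWeakUpperGradient p μ u (g k))
    (hi : ∫⁻ x, g 0 x ^ p ∂μ < ∞) : IsWeakUpperGradient p μ u fun x => ⨅ k, g k x := by
  have h := fun k => ((isWeakUpperGradient_iff hp).1 (hg k)).2
  have hgm := fun k => (hg k).1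
  choose ρ hρm hρi hρ using h
  -- Index `0` is `g 0`, whose integrability along `γ` permits monotone convergence from above;
  -- index `k + 1` is the exceptional function of `g k`.
  obtain ⟨ρ', hm', hi', hρ'⟩ := exists_forall_lineIntegral_ne_top (μ := μ) hp
    (ρ := fun k => Nat.casesOn k (g 0) ρ)
    (fun k => by cases k; exacts [hgm 0, hρm _]) (fun k => by cases k; exacts [hi, hρi _])
  refine (isWeakUpperGradient_iff hp).2 ⟨Measurable.iInf hgm, ρ', hm', hi', fun γ hγ => ?_⟩
  have hlen : curveLength γ ≠ ∞ := fun h => hγ (lineIntegral_of_curveLength_eq_top h _)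
  have h0 : lineIntegral (g 0) γ ≠ ∞ := hρ' γ hγ 0
  rw [lineIntegral_of_curveLength_ne_top hlen] at h0 ⊢
  rw [lintegral_iInf' (fun k => aemeasurable_comp_naturalParameterization hlen (hgm k))
    (ae_of_all _ fun t k l hkl => hanti hkl _) h0]
  refine le_iInf fun k => ?_
  rw [← lineIntegral_of_curveLength_ne_top hlen]
  exact hρ k γ (hρ' γ hγ (k + 1))

/-- Running minima of an energy-minimizing sequence decrease to a weak upper gradient of least
energy. Its minimum with any competitor is again a weak upper gradient and cannot have smaller
energy, hence agrees with it almost everywhere. -/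
theorem exists_isMinimalWeakUpperGradient (hp : 1 ≤ p) {u : X → ℝ}
    (hex : ∃ g : X → ℝ≥0∞, IsWeakUpperGradient p μ u g ∧ ∫⁻ x, g x ^ p ∂μ < ∞) :
    ∃ g : X → ℝ≥0∞, IsMinimalWeakUpperGradient p μ u g := by
  have hp0 : 0 < p := by linarith
  set S : Set ℝ≥0∞ := {r | ∃ g : X → ℝ≥0∞, IsWeakUpperGradient p μ u g ∧
    ∫⁻ x, g x ^ p ∂μ < ∞ ∧ ∫⁻ x, g x ^ p ∂μ = r} with hS
  have hSne : S.Nonempty := by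
    obtain ⟨g, hg, hi⟩ := hex
    exact ⟨_, g, hg, hi, rfl⟩
  obtain ⟨r, -, hr, hrS⟩ := exists_seq_tendsto_sInf hSne (OrderBot.bddBelow S)
  choose g hg hgi hgr using hrS
  set G : ℕ → X → ℝ≥0∞ := fun k => Nat.rec (g 0) (fun k F x => min (F x) (g (k + 1) x)) k with hG
  have hGs : ∀ k, G (k + 1) = fun x => min (G k x) (g (k + 1) x) := fun k => rfl
  have hanti : Antitone G := antitone_nat_of_succ_le fun k x => by
    rw [hGs]; exact min_le_left _ _
  have hGg : ∀ k x, G k x ≤ g k x := fun k x => by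
    cases k
    · exact le_rfl
    · rw [hGs]; exact min_le_right _ _
  have hGi : ∀ k, ∫⁻ x, G k x ^ p ∂μ ≤ r k := fun k => by
    rw [← hgr k]
    exact lintegral_mono fun x => ENNReal.rpow_le_rpow (hGg k x) hp0.le
  have hGi' : ∀ k, ∫⁻ x, G k x ^ p ∂μ < ∞ := fun k =>
    (hGi k).trans_lt (by rw [← hgr k]; exact hgi k)
  have hGw : ∀ k, IsWeakUpperGradient p μ u (G k) := fun k => by
    induction k with
    | zero => exact hg 0
    | succ k ih => rw [hGs]; exact ih.min hp (hGi' k) (hg _) (hgi _)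
  have hw := isWeakUpperGradient_iInf_of_antitone hp hanti hGw (hGi' 0)
  have hle : ∫⁻ x, (⨅ k, G k x) ^ p ∂μ ≤ sInf S := ge_of_tendsto' hr fun k =>
    (lintegral_mono fun x => ENNReal.rpow_le_rpow (iInf_le _ k) hp0.le).trans (hGi k)
  have hfin : ∫⁻ x, (⨅ k, G k x) ^ p ∂μ < ∞ :=
    (lintegral_mono fun x => ENNReal.rpow_le_rpow (iInf_le _ 0) hp0.le).trans_lt (hGi' 0)
  refine ⟨_, hw, hfin, fun h hh hhi => ?_⟩
  have hmin := hw.min hp hfin hh hhi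
  have hmin_le : ∀ x, min (⨅ k, G k x) (h x) ^ p ≤ (⨅ k, G k x) ^ p := fun x =>
    ENNReal.rpow_le_rpow (min_le_left _ _) hp0.le
  have hmini := (lintegral_mono (μ := μ) hmin_le).trans_lt hfin
  have hae := ae_eq_of_ae_le_of_lintegral_le (ae_of_all μ hmin_le) hmini.ne
    (hw.1.pow_const p).aemeasurable (hle.trans (sInf_le ⟨_, hmin, hmini, rfl⟩))
  filter_upwards [hae] with x hx
  rw [← ENNReal.rpow_left_injective hp0.ne' hx]
  exact min_le_right _ _

end WeakUpperGradients

/-! ### Lifting curves of `Y` to `X`, and the weak upper gradient of the test function -/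

/-- The image of the set where `h` is positive covers the interval between the end values up to the
point `0`, and a `1`-Lipschitz map does not increase length. Counting only this set gives a gradient
supported in a ball, hence integrable. -/
theorem edist_le_volume_setOf_pos {h : ℝ → ℝ} {l : ℝ} (hl : 0 ≤ l)
    (hh : LipschitzOnWith 1 h (Icc 0 l)) (h0 : ∀ t, 0 ≤ h t) :
    edist (h l) (h 0) ≤ volume ({t | 0 < h t} ∩ Icc 0 l) := by
  have hsub : uIcc (h 0) (h l) \ {0} ⊆ h '' ({t | 0 < h t} ∩ Icc 0 l) := by
    rintro y ⟨hy, hy0⟩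
    have hc := intermediate_value_uIcc (a := 0) (b := l) (f := h)
      (by rw [uIcc_of_le hl]; exact hh.continuousOn)
    obtain ⟨t, ht, rfl⟩ := hc hy
    rw [uIcc_of_le hl] at ht
    exact ⟨t, ⟨lt_of_le_of_ne (h0 t) (Ne.symm hy0), ht⟩, rfl⟩
  have himg := (hh.mono inter_subset_right).hausdorffMeasure_image_le
    (s := {t | 0 < h t} ∩ Icc 0 l) (d := 1) zero_le_one
  rw [hausdorffMeasure_real, ENNReal.coe_one, ENNReal.one_rpow, one_mul] at himg
  calc edist (h l) (h 0) = volume (uIcc (h 0) (h l)) := by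
        rw [Real.volume_interval, edist_dist, Real.dist_eq]
    _ = volume (uIcc (h 0) (h l) \ {0}) := (measure_sdiff_null (by simp)).symm
    _ ≤ _ := (measure_mono hsub).trans himg

/-- The integrand equals `∞` times itself, so its integral is either `0` or `∞`. -/
theorem lineIntegral_indicator_top {X : Type*} [MetricSpace X] [MeasurableSpace X] [BorelSpace X]
    {N : Set X} (hN : MeasurableSet N) {γ : C(I, X)}
    (hγ : lineIntegral (N.indicator fun _ => ∞) γ ≠ 0) :
    lineIntegral (N.indicator fun _ => ∞) γ = ∞ := by
  by_cases hlen : curveLength γ = ∞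
  · exact lineIntegral_of_curveLength_eq_top hlen _
  rw [lineIntegral_of_curveLength_ne_top hlen] at hγ ⊢
  have hm : Measurable (N.indicator fun _ => (∞ : ℝ≥0∞)) := measurable_const.indicator hN
  have hmul : ∀ x, N.indicator (fun _ => (∞ : ℝ≥0∞)) x = ∞ * N.indicator (fun _ => ∞) x :=
    fun x => by
    by_cases hx : x ∈ N <;> simp [hx]
  have := lintegral_const_mul'' ∞ (aemeasurable_comp_naturalParameterization hlen hm)
  simp_rw [← hmul] at this
  rw [this, ENNReal.top_mul hγ]

section

variable {X Y : Type*} [MetricSpace X] [MetricSpace Y]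

theorem LipschitzWith.curveLength_le_curveLength_symm_comp {f : X ≃ₜ Y} (hf : LipschitzWith 1 f)
    (γ : C(I, Y)) : curveLength γ ≤ curveLength ((f.symm : C(Y, X)).comp γ) := by
  have := (hf.lipschitzOnWith (s := univ)).comp_eVariationOn_le
    (mapsTo_univ ((f.symm : C(Y, X)).comp γ) univ)
  rw [ENNReal.coe_one, one_mul] at this
  refine le_trans (le_of_eq ?_) this
  rw [curveLength]
  congr 1
  ext t
  simp

theorem edist_symm_naturalParameterization_le {f : X ≃ₜ Y} {γ : C(I, Y)}
    (hlen : curveLength γ ≠ ∞)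
    (h : ∀ s t : I, s ≤ t → edist (f.symm (γ s)) (f.symm (γ t)) ≤ eVariationOn γ (Icc s t)) :
    LipschitzOnWith 1 (f.symm ∘ naturalParameterization γ univ 0)
      (Icc 0 (curveLength γ).toReal) := by
  have hbv := locallyBoundedVariationOn_of_curveLength_ne_top hlen
  rw [← image_variationOnFromTo hlen]
  rintro _ ⟨s, -, rfl⟩ _ ⟨t, -, rfl⟩
  wlog hst : s ≤ t generalizing s t
  · rw [edist_comm, edist_comm (variationOnFromTo γ univ 0 s)]
    exact this t s (le_of_not_ge hst)
  rw [ENNReal.coe_one, one_mul, Function.comp, Function.comp,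
    naturalParameterization_variationOnFromTo hlen, naturalParameterization_variationOnFromTo hlen,
    edist_comm (variationOnFromTo γ univ 0 s), edist_dist (variationOnFromTo γ univ 0 t),
    Real.dist_eq]
  have hadd := variationOnFromTo.add hbv (mem_univ 0) (mem_univ s) (mem_univ t)
  rw [← hadd, add_sub_cancel_left, variationOnFromTo.eq_of_le _ _ hst, univ_inter,
    abs_of_nonneg ENNReal.toReal_nonneg, ENNReal.ofReal_toReal]
  · exact h s t hst
  · have := hbv s t (mem_univ s) (mem_univ t)
    rwa [univ_inter] at this

variable [MeasurableSpace X] [BorelSpace X]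

/-- If the lift of `γ` meets the exceptional set only in a set of zero length, then displacements
of the lift are bounded by the variation of `γ`. -/
theorem edist_symm_comp_le_eVariationOn {f : X ≃ₜ Y} {N : Set X} (hNm : MeasurableSet N)
    (hN : ∀ c : ℝ → X, LipschitzWith 1 c → ∀ a b, a ≤ b → (∀ᵐ t, t ∈ Icc a b → c t ∉ N) →
      edist (c a) (c b) ≤ eVariationOn (f ∘ c) (Icc a b))
    {γ : C(I, Y)} (hγ : lineIntegral (N.indicator fun _ => ∞) ((f.symm : C(Y, X)).comp γ) = 0)
    {s t : I} (hst : s ≤ t) :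
    edist (f.symm (γ s)) (f.symm (γ t)) ≤ eVariationOn γ (Icc s t) := by
  set η : C(I, X) := (f.symm : C(Y, X)).comp γ with hη
  have hlen : curveLength η ≠ ∞ := fun h => by
    rw [lineIntegral_of_curveLength_eq_top h] at hγ
    exact ENNReal.top_ne_zero hγ
  set l := (curveLength η).toReal with hl
  have hl0 : 0 ≤ l := ENNReal.toReal_nonneg
  have hLip := (hasUnitSpeedOn_naturalParameterization hlen).lipschitzOnWith
  -- The unit speed parametrization of the lift, extended by constants so as to be `1`-Lipschitz on
  -- all of `ℝ`.
  set c : ℝ → X := fun τ => naturalParameterization η univ 0 (projIcc 0 l hl0 τ) with hc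
  have hcLip : LipschitzWith 1 c := by
    have := hLip.to_restrict.comp (LipschitzWith.projIcc hl0)
    rwa [one_mul] at this
  have hcP : ∀ τ ∈ Icc 0 l, c τ = naturalParameterization η univ 0 τ := fun τ hτ => by
    rw [hc]; simp only [projIcc_of_mem hl0 hτ]
  set V := variationOnFromTo η univ 0 with hV
  have himg : V '' univ = Icc 0 l := image_variationOnFromTo hlen
  have hVmem : ∀ r, V r ∈ Icc 0 l := fun r => himg ▸ mem_image_of_mem V (mem_univ r)
  have hcV : ∀ r, c (V r) = η r := fun r => by
    rw [hcP _ (hVmem r), hV, naturalParameterization_variationOnFromTo hlen]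
  have hVmono : MonotoneOn V univ := variationOnFromTo.monotoneOn
    (locallyBoundedVariationOn_of_curveLength_ne_top hlen) (mem_univ 0)
  have hVst := hVmono (mem_univ s) (mem_univ t) hst
  have hsub : Icc (V s) (V t) ⊆ Icc 0 l := Icc_subset_Icc (hVmem s).1 (hVmem t).2
  -- A vanishing integral of `∞ · 1_N` means that the lift spends zero time in `N`.
  have hae : ∀ᵐ τ, τ ∈ Icc (V s) (V t) → c τ ∉ N := by
    rw [lineIntegral_of_curveLength_ne_top hlen, lintegral_eq_zero_iff'
      (aemeasurable_comp_naturalParameterization hlen (measurable_const.indicator hNm))] at hγ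
    filter_upwards [(ae_restrict_iff' measurableSet_Icc).1 hγ] with τ hτ hmem hτN
    have := hτ (hsub hmem)
    rw [← hcP τ (hsub hmem)] at this
    simp [hτN] at this
  have key := hN c hcLip _ _ hVst hae
  have hvar := eVariationOn.comp_inter_Icc_eq_of_monotoneOn (f ∘ c) (t := (univ : Set I)) V hVmono
    (mem_univ s) (mem_univ t)
  rw [himg, inter_eq_right.2 hsub, univ_inter] at hvar
  have hcomp : (f ∘ c) ∘ V = γ := by
    ext r
    simp [hcV, hη]
  rw [hcV, hcV, ← hvar, hcomp] at key
  exact key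

end

section

variable {X Y : Type*} [MetricSpace X] [MeasurableSpace X] [BorelSpace X]
  [MetricSpace Y] [MeasurableSpace Y] [BorelSpace Y]

/-- The cut-off distance function from a point, transported to `Y`, has the indicator function of a
ball as a weak upper gradient. -/
theorem isWeakUpperGradient_max_sub_dist_symm {n : ℕ} (hn : 1 ≤ n) [ProperSpace X]
    [SecondCountableTopology Y] [Nonempty X]
    (hXrect : IsRectifiableSpace n X)
    {f : X ≃ₜ Y} (hvol : Measure.map f (μHE[n] : Measure X) = μHE[n]) (hlip : LipschitzWith 1 f)
    (hqc : IsQuasiconformal n (μHE[n] : Measure Y) (μHE[n] : Measure X) f.symm)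
    (x₀ : X) (R : ℝ) :
    IsWeakUpperGradient n (μHE[n] : Measure Y) (fun y => max 0 (R - dist (f.symm y) x₀))
      ((f '' Metric.closedBall x₀ R).indicator 1) := by
  have hn' : (1 : ℝ) ≤ n := by exact_mod_cast hn
  have : Nonempty Y := Nonempty.map f inferInstance
  obtain ⟨N, hNm, hN0, hN⟩ := exists_null_forall_edist_le_eVariationOn hXrect f hlip hvol
  have hBm : MeasurableSet (f '' Metric.closedBall x₀ R) :=
    ((isCompact_closedBall x₀ R).image f.continuous).measurableSet
  refine ⟨measurable_one.indicator hBm,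
    {γ | lineIntegral (N.indicator fun _ => ∞) ((f.symm : C(Y, X)).comp γ) ≠ 0}, ?_, ?_⟩
  · obtain ⟨K, hK⟩ := hqc
    refine le_antisymm ((hK _).trans ?_) bot_le
    rw [(curveModulus_eq_zero_iff hn').2, mul_zero]
    refine ⟨N.indicator fun _ => ∞, measurable_const.indicator hNm, ?_, ?_⟩
    · rw [lintegral_eq_zero_of_ae_eq_zero]
      · simp
      · filter_upwards [measure_eq_zero_iff_ae_notMem.1 hN0] with x hx
        simp [hx, Nat.ne_of_gt hn]
    · rintro _ ⟨γ, hγ, rfl⟩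
      exact lineIntegral_indicator_top hNm hγ
  · intro γ hγ
    have hγ0 : lineIntegral (N.indicator fun _ => ∞) ((f.symm : C(Y, X)).comp γ) = 0 :=
      not_not.1 hγ
    have hlen : curveLength γ ≠ ∞ := fun h => by
      have hl := hlip.curveLength_le_curveLength_symm_comp γ
      rw [h, top_le_iff] at hl
      rw [lineIntegral_of_curveLength_eq_top hl] at hγ0
      exact ENNReal.top_ne_zero hγ0
    -- For the remaining curves, `f⁻¹` composed with the arc length parametrization of `γ` is
    -- `1`-Lipschitz.
    have hLip := edist_symm_naturalParameterization_le hlen fun s t hst =>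
      edist_symm_comp_le_eVariationOn hNm hN hγ0 hst
    have hw : LipschitzWith 1 fun x : X => max 0 (R - dist x x₀) := by
      refine LipschitzWith.of_dist_le_mul fun x y => ?_
      rw [NNReal.coe_one, one_mul, Real.dist_eq]
      refine (abs_max_sub_max_le_max _ _ _ _).trans ?_
      rw [sub_self, abs_zero, sub_sub_sub_cancel_left, max_eq_right (abs_nonneg _), dist_comm x y]
      exact abs_dist_sub_le y x x₀
    have hcomp := hw.comp_lipschitzOnWith hLip
    rw [one_mul] at hcomp
    have key := edist_le_volume_setOf_pos ENNReal.toReal_nonneg hcomp fun t => le_max_left _ _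
    simp only [Function.comp, naturalParameterization_zero hlen,
      naturalParameterization_curveLength hlen] at key
    refine key.trans ?_
    rw [lineIntegral_of_curveLength_ne_top hlen, ← Measure.restrict_apply' measurableSet_Icc]
    refine meas_le_lintegral₀ (aemeasurable_comp_naturalParameterization hlen
      (measurable_one.indicator hBm)) fun t ht => ?_
    have hdist : dist (f.symm (naturalParameterization γ univ 0 t)) x₀ ≤ R := by
      have : 0 < R - dist (f.symm (naturalParameterization γ univ 0 t)) x₀ := by
        simpa using ht
      linarith
    rw [indicator_of_mem (show _ ∈ f '' Metric.closedBall x₀ R from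
      ⟨_, hdist, f.apply_symm_apply _⟩), Pi.one_apply]

end

/-! ### Conclusion -/

theorem proposition1p8 (n : ℕ) (hn : 1 ≤ n)
    {X Y : Type*} [MetricSpace X] [MeasurableSpace X] [BorelSpace X]
    [MetricSpace Y] [MeasurableSpace Y] [BorelSpace Y]
    (hX : IsMetricMeasureSpace X μHE[n]) (hY : IsMetricMeasureSpace Y μHE[n])
    (hXrect : IsRectifiableSpace n X) (hYrect : IsRectifiableSpace n Y)
    (f : X ≃ₜ Y) (hvol : Measure.map f (μHE[n] : Measure X) = μHE[n])
    (hlip : LipschitzWith 1 f)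
    (hqc : IsQuasiconformal n (μHE[n] : Measure Y) (μHE[n] : Measure X) f.symm)
    (hSL : HasSobolevToLipschitz n (μHE[n] : Measure Y)) :
    Isometry f := by
  have hn' : (1 : ℝ) ≤ n := by exact_mod_cast hn
  have := hX.proper
  have := hY.proper
  have hfin : IsFiniteMeasureOnCompacts (μHE[n] : Measure Y) := ⟨fun K hK => by
    rcases K.eq_empty_or_nonempty with rfl | ⟨y, hy⟩
    · simp
    · obtain ⟨r, hr, hsub⟩ := hK.isBounded.subset_ball_lt 0 y
      exact (measure_mono hsub).trans_lt (hY.ball_lt_top y r hr)⟩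
  have hopen : Measure.IsOpenPosMeasure (μHE[n] : Measure Y) := ⟨fun U hU ⟨y, hy⟩ => by
    obtain ⟨r, hr, hsub⟩ := Metric.isOpen_iff.1 hU y hy
    exact ((hY.ball_pos y r hr).trans_le (measure_mono hsub)).ne'⟩
  refine Isometry.of_dist_eq fun x x₀ => le_antisymm (by simpa using hlip.dist_le_mul x x₀) ?_
  have : Nonempty X := ⟨x⟩
  -- With this radius the truncation at `0` is inactive at both points: `u` is `1` at `f x` and `R`
  -- at `f x₀`, so the two values differ by exactly `dist x x₀`.
  set R := dist x x₀ + 1 with hR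
  set B := f '' Metric.closedBall x₀ R with hB
  have hBc : IsCompact B := (isCompact_closedBall x₀ R).image f.continuous
  set u : Y → ℝ := fun y => max 0 (R - dist (f.symm y) x₀) with hu
  have hw : IsWeakUpperGradient n (μHE[n] : Measure Y) u (B.indicator 1) :=
    isWeakUpperGradient_max_sub_dist_symm hn hXrect hvol hlip hqc x₀ R
  have hwi : ∫⁻ y, B.indicator 1 y ^ (n : ℝ) ∂(μHE[n] : Measure Y) < ∞ := by
    refine lt_of_le_of_lt (lintegral_mono fun y => ?_)
      ((lintegral_indicator_one hBc.measurableSet).trans_lt hBc.measure_lt_top)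
    by_cases hy : y ∈ B <;> simp [hy, Nat.ne_of_gt hn]
  have hucont : Continuous u := by fun_prop
  have husupp : HasCompactSupport u := HasCompactSupport.intro hBc fun y hy => by
    rw [hu]
    simp only [max_eq_left_iff, sub_nonpos]
    by_contra! h
    exact hy ⟨f.symm y, h.le, f.apply_symm_apply y⟩
  have hNewt : IsNewtonian n (μHE[n] : Measure Y) u :=
    ⟨hucont.memLp_of_hasCompactSupport husupp, hw.exists_isUpperGradient hn' hwi⟩
  obtain ⟨g, hg⟩ := exists_isMinimalWeakUpperGradient hn' ⟨_, hw, hwi⟩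
  obtain ⟨v, hv, huv⟩ := hSL u hNewt g hg (by
    filter_upwards [hg.2.2 _ hw hwi] with y hy
    exact hy.trans (indicator_le_self' (fun _ _ => bot_le) y))
  -- Two continuous functions that agree almost everywhere agree everywhere, because the measure
  -- charges every nonempty open set.
  have huv' : u = v := (hucont.ae_eq_iff_eq _ hv.continuous).1 huv
  have key := hv.dist_le_mul (f x) (f x₀)
  rw [← huv', NNReal.coe_one, one_mul] at key
  have h1 : u (f x) = 1 := by simp [hu, hR]
  have h0 : u (f x₀) = R := by
    have : 0 ≤ R := by positivity
    simp [hu, this]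
  rw [h1, h0, Real.dist_eq, abs_sub_comm, hR, add_sub_cancel_right] at key
  exact (le_abs_self _).trans key
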